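/- Let $\omega=(0,1)^2$, $L_1,L_2>0$, $Y=(0,L_1)\times(0,L_2)$, and let $G:\mathbb R^2\to\mathbb R$ be smooth and $Y$-periodic with $0<G_0\le G\le G_1$. Write $\mathbf x=(\hat x,x_3)$ with $\hat x\in\mathbb R^2$, and for $\varepsilon>0$ put $$\Omega_\varepsilon=\{(\hat x,x_3):\hat x\in\omega,\ 0<x_3<\varepsilon G(\hat x/\varepsilon)\},\qquad Y^*=\{(\hat y,y_3):\hat y\in Y,\ 0<y_3<G(\hat y)\},$$ and let $\partial Y^*_{inf}=\{\hat y\in Y,\ y_3=0\}$, $\partial Y^*_{sup}=\{\hat y\in Y,\ y_3=G(\hat y)\}$ be the bottom and the top of $Y^*$. Let $V_\varepsilon=\{\mathbf v\in H^1_0(\Omega_\varepsilon)^3:\operatorname{div}\mathbf v=0\}$, let $\mu,g>0$ be constants, and let $\mathbf f_\varepsilon\in L^2(\Omega_\varepsilon)^3$ satisfy $\varepsilon^{-1/2}\|\mathbf f_\varepsilon\|_{L^2(\Omega_\varepsilon)^3}\le C$ with $C$ independent of $\varepsilon$. Let $\mathbf u_\varepsilon\in V_\varepsilon$ be the solution of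 the Bingham variational inequality $$\mu\varepsilon^2\int_{\Omega_\varepsilon}\nabla\mathbf u_\varepsilon\cdot\nabla(\mathbf v-\mathbf u_\varepsilon)\,d\mathbf x+g\varepsilon\int_{\Omega_\varepsilon}|\nabla\mathbf v|\,d\mathbf x-g\varepsilon\int_{\Omega_\varepsilon}|\nabla\mathbf u_\varepsilon|\,d\mathbf x\ \ge\ \int_{\Omega_\varepsilon}\mathbf f_\varepsilon\cdot(\mathbf v-\mathbf u_\varepsilon)\,d\mathbf x\qquad\forall\,\mathbf v\in V_\varepsilon .$$ Let $N_\varepsilon,M_\varepsilon$ be the largest integers with $\varepsilon L_1(N_\varepsilon+1)\le1$ and $\varepsilon L_2(M_\varepsilon+1)\le1$, let $\omega^\varepsilon$ be the interior of the union of the closed rectangles $[i\varepsilon L_1,(i+1)\varepsilon L_1]\times[j\varepsilon L_2,(j+1)\varepsilon L_2]$, $0\le i\le N_\varepsilon$, $0\le j\le M_\varepsilon$, and define the unfolding operator, for $(\hat x,\mathbf y)\in\omega\times Y^*$, by $$\mathcal T_\varepsilon(\varphi)(\hat x,\mathbf y)=\begin{cases}\varphi\big(\varepsilon k_1L_1+\varepsilon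 y_1,\ \varepsilon k_2L_2+\varepsilon y_2,\ \varepsilon y_3\big), & \hat x\in\omega^\varepsilon,\quad k_j=\lfloor x_j/(\varepsilon L_j)\rfloor\ (j=1,2),\\ 0,&\hat x\in\omega\setminus\omega^\varepsilon,\end{cases}$$ componentwise on vector fields. Then every sequence of values $\varepsilon>0$ tending to $0$ has a subsequence, still denoted by $\varepsilon$, for which there is $\mathbf u=(\hat u,u_3)\in L^2(\omega;H^1(Y^*)^3)$ such that $$\mathcal T_\varepsilon(\mathbf u_\varepsilon)\rightharpoonup\mathbf u\ \text{ weakly in } L^2(\omega;H^1(Y^*)^3),\qquad \varepsilon\,\mathcal T_\varepsilon\Big(\frac{\partial\mathbf u_\varepsilon}{\partial x_i}\Big)\rightharpoonup\frac{\partial\mathbf u}{\partial y_i}\ \text{ weakly in } L^2(\omega\times Y^*)^3,\quad i=1,2,3,$$ $$\operatorname{div}_{\mathbf y}\mathbf u=0\ \text{ a.e. in }\omega\times Y^*,\qquad \mathbf u=0\ \text{ on }\omega\times(\partial Y^*_{inf}\cup\partial Y^*_{sup})\ \text{ in the sense of traces, for a.e. } \hat x\in\omega,$$ $$\int_{Y^*}u_3(\hat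 x,\mathbf y)\,d\mathbf y=0\ \text{ for a.e. }\hat x\in\omega,$$ $$\operatorname{div}_{\hat x}\Big(\int_{Y^*}\hat u\,d\mathbf y\Big)=0\ \text{ in }\omega,\qquad \Big(\int_{Y^*}\hat u\,d\mathbf y\Big)\cdot n=0\ \text{ on }\partial\omega,$$ where $n$ is the outward normal; the divergence is taken in the sense of distributions and the normal trace in the weak sense, i.e. $\int_\omega\big(\int_{Y^*}\hat u\,d\mathbf y\big)\cdot\nabla q\,d\hat x=0$ for all $q\in H^1(\omega)$. -/

import Mathlib

open MeasureTheory Filter Topology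
open scoped ContDiff

namespace ThinBingham

noncomputable section

/-- Euclidean space `ℝᵈ`. Coordinates `1, 2, 3` of the mathematics are the indices `0, 1, 2`. -/
abbrev E (d : ℕ) : Type := EuclideanSpace ℝ (Fin d)

/-- The horizontal part `(x₁, x₂)` of a point or vector of `ℝ³`. -/
def hat (x : E 3) : E 2 := !₂[x 0, x 1]

/-- Classical partial derivative `∂φ/∂xᵢ`. -/
def pderiv {d : ℕ} {F : Type*} [NormedAddCommGroup F] [InnerProductSpace ℝ F]
    (i : Fin d) (φ : E d → F) (x : E d) : F :=
  fderiv ℝ φ x (EuclideanSpace.single i (1 : ℝ))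

/-- Smooth functions whose compact support is contained in `U`. -/
def IsTest {d : ℕ} {F : Type*} [NormedAddCommGroup F] [InnerProductSpace ℝ F]
    (U : Set (E d)) (φ : E d → F) : Prop :=
  ContDiff ℝ ∞ φ ∧ HasCompactSupport φ ∧ tsupport φ ⊆ U

/-- `v ∈ L²(U; F)`. -/
def IsL2 {d : ℕ} {F : Type*} [NormedAddCommGroup F] [InnerProductSpace ℝ F]
    (U : Set (E d)) (v : E d → F) : Prop :=
  MemLp v 2 (volume.restrict U)

/-- `v ∈ H¹(U; F)`, and `Dv i` is its weak partial derivative in the direction `xᵢ`. -/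
def IsH1 {d : ℕ} {F : Type*} [NormedAddCommGroup F] [InnerProductSpace ℝ F]
    (U : Set (E d)) (v : E d → F) (Dv : Fin d → E d → F) : Prop :=
  IsL2 U v ∧ (∀ i, IsL2 U (Dv i)) ∧
    ∀ i, ∀ φ : E d → ℝ, IsTest U φ →
      ∫ x in U, pderiv i φ x • v x = - ∫ x in U, φ x • Dv i x

/-- The smooth functions `φ n` converge to `v`, whose weak partial derivatives are `Dv i`,
in the norm of `H¹(U; F)`. -/
def TendstoH1 {d : ℕ} {F : Type*} [NormedAddCommGroup F] [InnerProductSpace ℝ F]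
    (U : Set (E d)) (φ : ℕ → E d → F) (v : E d → F) (Dv : Fin d → E d → F) : Prop :=
  Tendsto (fun n => eLpNorm (fun x => φ n x - v x) 2 (volume.restrict U)) atTop (𝓝 0) ∧
    ∀ i, Tendsto (fun n => eLpNorm (fun x => pderiv i (φ n) x - Dv i x) 2 (volume.restrict U))
      atTop (𝓝 0)

/-- `v ∈ H¹₀(U; F)`, the closure of the test functions in `H¹(U; F)`, with weak partial
derivatives `Dv i`. -/
def IsH10 {d : ℕ} {F : Type*} [NormedAddCommGroup F] [InnerProductSpace ℝ F]
    (U : Set (E d)) (v : E d → F) (Dv : Fin d → E d → F) : Prop :=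
  IsH1 U v Dv ∧ ∃ φ : ℕ → E d → F, (∀ n, IsTest U (φ n)) ∧ TendstoH1 U φ v Dv

/-- The function `v ∈ H¹(U; F)`, with weak partial derivatives `Dv i`, has the trace `t` on the
part `Γ` of the boundary of the bounded Lipschitz domain `U ⊆ ℝ³`: the trace operator is the
continuous extension to `H¹` of the restriction to `Γ` of the functions that are smooth up to the
boundary, with values in `L²(Γ)` for the surface measure (two-dimensional Hausdorff measure). -/
def HasTrace {F : Type*} [NormedAddCommGroup F] [InnerProductSpace ℝ F]
    (U Γ : Set (E 3)) (v : E 3 → F) (Dv : Fin 3 → E 3 → F) (t : E 3 → F) : Prop :=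
  IsH1 U v Dv ∧ ∃ φ : ℕ → E 3 → F, (∀ n, ContDiff ℝ ∞ (φ n)) ∧ TendstoH1 U φ v Dv ∧
    Tendsto (fun n => eLpNorm (fun x => φ n x - t x) 2
      ((Measure.hausdorffMeasure 2 : Measure (E 3)).restrict Γ)) atTop (𝓝 0)

/-- The divergence of a vector field whose partial derivatives are `Dv i`. -/
def divg {d : ℕ} (Dv : Fin d → E d → E d) (x : E d) : ℝ := ∑ i, (Dv i x) i

/-- The Frobenius norm `|∇v|` of the gradient. -/
def gradNorm (Dv : Fin 3 → E 3 → E 3) (x : E 3) : ℝ := √(∑ i, ‖Dv i x‖ ^ 2)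

/-- The Frobenius product `∇v · ∇w`. -/
def gradDot (Dv Dw : Fin 3 → E 3 → E 3) (x : E 3) : ℝ := ∑ i, inner ℝ (Dv i x) (Dw i x)

/-! ### Geometry -/

/-- `ω = (0,1)²`. -/
def omega : Set (E 2) := {x | ∀ i, x i ∈ Set.Ioo (0 : ℝ) 1}

/-- The periodicity cell `Y = (0, L₁) × (0, L₂)`. -/
def cellY (L : Fin 2 → ℝ) : Set (E 2) := {y | ∀ i, y i ∈ Set.Ioo 0 (L i)}

/-- `G` is `Y`-periodic. -/
def YPeriodic (L : Fin 2 → ℝ) (G : E 2 → ℝ) : Prop :=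
  ∀ (i : Fin 2) (y : E 2), G (y + EuclideanSpace.single i (L i)) = G y

/-- The thin domain `Ω_ε`. -/
def thinDomain (G : E 2 → ℝ) (ε : ℝ) : Set (E 3) :=
  {x | hat x ∈ omega ∧ 0 < x 2 ∧ x 2 < ε * G (ε⁻¹ • hat x)}

/-- The representative cell `Y*`. -/
def cellYstar (L : Fin 2 → ℝ) (G : E 2 → ℝ) : Set (E 3) :=
  {y | hat y ∈ cellY L ∧ 0 < y 2 ∧ y 2 < G (hat y)}

/-- The bottom boundary of `Y*`. -/
def bottomYstar (L : Fin 2 → ℝ) : Set (E 3) := {y | hat y ∈ cellY L ∧ y 2 = 0}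

/-- The upper boundary of `Y*`. -/
def topYstar (L : Fin 2 → ℝ) (G : E 2 → ℝ) : Set (E 3) :=
  {y | hat y ∈ cellY L ∧ y 2 = G (hat y)}

/-! ### The Bingham problem in the thin domain -/

/-- `v ∈ V_ε`: divergence-free fields in `H¹₀(Ω_ε)³`; `Dv i` is `∂v/∂xᵢ`. -/
def IsAdmissible (G : E 2 → ℝ) (ε : ℝ) (v : E 3 → E 3) (Dv : Fin 3 → E 3 → E 3) : Prop :=
  IsH10 (thinDomain G ε) v Dv ∧ ∀ᵐ x ∂(volume.restrict (thinDomain G ε)), divg Dv x = 0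

/-- `u`, with partial derivatives `Du i`, solves the variational inequality of the Bingham flow
in `Ω_ε` with viscosity `μ ε²`, yield stress `g ε` and body force `f`. -/
def IsBinghamSolution (G : E 2 → ℝ) (μ g ε : ℝ) (f u : E 3 → E 3)
    (Du : Fin 3 → E 3 → E 3) : Prop :=
  IsAdmissible G ε u Du ∧
    ∀ (v : E 3 → E 3) (Dv : Fin 3 → E 3 → E 3), IsAdmissible G ε v Dv →
      μ * ε ^ 2 * (∫ x in thinDomain G ε, gradDot Du (fun i z => Dv i z - Du i z) x)
          + g * ε * (∫ x in thinDomain G ε, gradNorm Dv x)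
          - g * ε * (∫ x in thinDomain G ε, gradNorm Du x)
        ≥ ∫ x in thinDomain G ε, inner ℝ (f x) (v x - u x)

/-- The rescaled norm `|||f|||_{L²(Ω_ε)} = ε^{-1/2} ‖f‖_{L²(Ω_ε)}`. -/
def rescaledL2Norm (G : E 2 → ℝ) (ε : ℝ) (f : E 3 → E 3) : ℝ :=
  ε ^ (-(1 / 2) : ℝ) * (eLpNorm f 2 (volume.restrict (thinDomain G ε))).toReal

/-! ### The unfolding operator -/

/-- The largest integer `N` with `ε ℓ (N + 1) ≤ 1` (for `ε, ℓ > 0`). -/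
def lastCell (ℓ ε : ℝ) : ℤ := ⌊1 / (ε * ℓ)⌋ - 1

/-- The open cell `(i ε L₁, (i+1) ε L₁) × (j ε L₂, (j+1) ε L₂)`, where `k = (i, j)`. -/
def epsCell (L : Fin 2 → ℝ) (ε : ℝ) (k : Fin 2 → ℤ) : Set (E 2) :=
  {x | ∀ i, x i ∈ Set.Ioo (k i * ε * L i) ((k i + 1) * ε * L i)}

/-- `ω^ε`: the interior of the union of the closed cells contained in the closure of `ω`. -/
def omegaEps (L : Fin 2 → ℝ) (ε : ℝ) : Set (E 2) :=
  interior (⋃ k ∈ {k : Fin 2 → ℤ | ∀ i, 0 ≤ k i ∧ k i ≤ lastCell (L i) ε},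
    closure (epsCell L ε k))

/-- The integer part `[x]_L` of a point of the plane. -/
def intPart (L : Fin 2 → ℝ) (x : E 2) (i : Fin 2) : ℤ := ⌊x i / L i⌋

open Classical in
/-- The unfolding operator
`T_ε(φ)(x̂, y) = φ(ε [x̂/ε]_L L + ε ŷ, ε y₃)` for `x̂ ∈ ω^ε`, and `0` for the other `x̂`. -/
def unfoldOp {F : Type*} [NormedAddCommGroup F] (L : Fin 2 → ℝ) (ε : ℝ) (φ : E 3 → F)
    (x : E 2) (y : E 3) : F :=
  if x ∈ omegaEps L ε then
    φ !₂[ε * (intPart L (ε⁻¹ • x) 0 * L 0) + ε * y 0,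
         ε * (intPart L (ε⁻¹ • x) 1 * L 1) + ε * y 1,
         ε * y 2]
  else 0

/-! ### The spaces `L²(A × U)³` and `L²(A; H¹(U)³)` and their weak convergence -/

/-- `u ∈ L²(A × U)³`. -/
def IsL2Prod (A : Set (E 2)) (U : Set (E 3)) (u : E 2 → E 3 → E 3) : Prop :=
  MemLp (Function.uncurry u) 2 (volume.restrict (A ×ˢ U))

/-- `u ∈ L²(A; H¹(U)³)`, and `Du i` is its weak partial derivative `∂u/∂yᵢ`. A Bochner square
integrable map into `H¹(U)³` is given by a jointly measurable function `u(x̂, y)` such that `u` and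
its weak `y`-gradient are square integrable on `A × U`. -/
def IsL2H1 (A : Set (E 2)) (U : Set (E 3)) (u : E 2 → E 3 → E 3)
    (Du : Fin 3 → E 2 → E 3 → E 3) : Prop :=
  IsL2Prod A U u ∧ (∀ i, IsL2Prod A U (Du i)) ∧
    ∀ᵐ x ∂(volume.restrict A), IsH1 U (u x) (fun i => Du i x)

/-- Inner product of `L²(A × U)³`. -/
def innerL2 (A : Set (E 2)) (U : Set (E 3)) (u w : E 2 → E 3 → E 3) : ℝ :=
  ∫ p in A ×ˢ U, inner ℝ (u p.1 p.2) (w p.1 p.2)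

/-- Weak convergence in `L²(A × U)³`. -/
def WeakTendstoL2 (A : Set (E 2)) (U : Set (E 3)) (un : ℕ → E 2 → E 3 → E 3)
    (u : E 2 → E 3 → E 3) : Prop :=
  (∀ n, IsL2Prod A U (un n)) ∧ IsL2Prod A U u ∧
    ∀ w, IsL2Prod A U w → Tendsto (fun n => innerL2 A U (un n) w) atTop (𝓝 (innerL2 A U u w))

/-- Weak convergence in the Hilbert space `L²(A; H¹(U)³)`, tested by the inner product with an
arbitrary element. -/
def WeakTendstoL2H1 (A : Set (E 2)) (U : Set (E 3))
    (un : ℕ → E 2 → E 3 → E 3) (Dun : ℕ → Fin 3 → E 2 → E 3 → E 3)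
    (u : E 2 → E 3 → E 3) (Du : Fin 3 → E 2 → E 3 → E 3) : Prop :=
  (∀ n, IsL2H1 A U (un n) (Dun n)) ∧ IsL2H1 A U u Du ∧
    ∀ w Dw, IsL2H1 A U w Dw →
      Tendsto (fun n => innerL2 A U (un n) w + ∑ i, innerL2 A U (Dun n i) (Dw i)) atTop
        (𝓝 (innerL2 A U u w + ∑ i, innerL2 A U (Du i) (Dw i)))

/-! ### Divergence and normal trace of planar `L²` fields -/

/-- `div V = δ` in `U` in the sense of distributions. -/
def HasWeakDiv (U : Set (E 2)) (V : E 2 → E 2) (δ : E 2 → ℝ) : Prop :=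
  ∀ φ : E 2 → ℝ, IsTest U φ →
    ∫ x in U, ∑ i, V x i * pderiv i φ x = - ∫ x in U, δ x * φ x

/-- `V · n = 0` on `∂U` for a field `V ∈ L²(U)²` with weak divergence `δ ∈ L²(U)`: the functional
`q ↦ ∫_U (V · ∇q + δ q)` on `H¹(U)`, which defines the normal trace of `V`, vanishes. -/
def HasZeroNormalTrace (U : Set (E 2)) (V : E 2 → E 2) (δ : E 2 → ℝ) : Prop :=
  IsL2 U V ∧ IsL2 U δ ∧ HasWeakDiv U V δ ∧
    ∀ (q : E 2 → ℝ) (Dq : Fin 2 → E 2 → ℝ), IsH1 U q Dq →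
      ∫ x in U, ((∑ i, V x i * Dq i x) + δ x * q x) = 0

/-- The averaged horizontal flux `x̂ ↦ ∫_{Y*} û(x̂, y) dy`. -/
def meanFlux (Ystar : Set (E 3)) (u : E 2 → E 3 → E 3) (x : E 2) : E 2 :=
  !₂[∫ y in Ystar, u x y 0, ∫ y in Ystar, u x y 1]

end

end ThinBingham

open ThinBingham

/-!
Testing the variational inequality with `v = 0` gives
`μ ε² ‖∇u_ε‖² ≤ ∫ f_ε · u_ε`, and the Poincaré inequality in the vertical direction, whose constant
is of order `ε` in a domain of that height, turns this into `‖u_ε‖ = O(√ε)` and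
`ε ‖∇u_ε‖ = O(√ε)`. On each cell the unfolding operator is a rescaling that multiplies squared
`L²` norms by `L₁ L₂ / ε`, so the unfolded fields and scaled gradients are bounded in
`L²(ω × Y*)`, and a subsequence converges weakly. The fields paired with their gradients that are
smooth in `y` and vanish at the bottom and the top of `Y*` form a subspace of `L²(ω × Y*)` whose
closure is weakly closed and consists of fields with zero trace; it contains all the unfolded pairs.

The flux conditions come from `div u_ε = 0`. Pairing with a function `q(x̂)` gives
`∫ û_ε · ∇q = 0`, and pairing with `x₃ q(x̂)` gives `∫ u_{ε,3} q = - ∫ x₃ û_ε · ∇q`, which is of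
smaller order since `x₃ = O(ε)`. Both integrals over `Ω_ε` are, up to the factor `ε / (L₁ L₂)` and
a vanishing error, the corresponding integrals of the unfolded fields over `ω × Y*`.
-/

namespace ThinBingham

open scoped ENNReal

/-! ### Duality pairings and convergence in `Lᵖ` -/

section Pairing

variable {α A B W F : Type*} {m : MeasurableSpace α} {ν : Measure α}
  [NormedAddCommGroup A] [NormedSpace ℝ A] [NormedAddCommGroup B] [NormedSpace ℝ B]
  [NormedAddCommGroup W] [NormedSpace ℝ W] [NormedAddCommGroup F]

theorem integrable_bilin {p q : ℝ≥0∞} [p.HolderConjugate q] (b : A →L[ℝ] B →L[ℝ] W)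
    {f : α → A} {g : α → B} (hf : MemLp f p ν) (hg : MemLp g q ν) :
    Integrable (fun x => b (f x) (g x)) ν :=
  memLp_one_iff_integrable.1 (b.memLp_of_bilin 1 hf hg)

theorem norm_integral_bilin_le {p q : ℝ≥0∞} [p.HolderConjugate q] (b : A →L[ℝ] B →L[ℝ] W)
    {f : α → A} {g : α → B} (hf : MemLp f p ν) (hg : MemLp g q ν) :
    ‖∫ x, b (f x) (g x) ∂ν‖ ≤ ‖b‖ * lpNorm f p ν * lpNorm g q ν := by
  have hoelder : eLpNorm (fun x => b (f x) (g x)) 1 ν ≤ ‖b‖₊ * eLpNorm f p ν * eLpNorm g q ν :=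
    eLpNorm_le_eLpNorm_mul_eLpNorm_of_nnnorm hf.1 hg.1 (fun u v => b u v) ‖b‖₊
      (Eventually.of_forall fun x => b.le_opNorm₂ _ _)
  have h := (enorm_integral_le_lintegral_enorm (μ := ν) fun x => b (f x) (g x)).trans
    (eLpNorm_one_eq_lintegral_enorm.symm.le.trans hoelder)
  simpa [ENNReal.toReal_mul, toReal_eLpNorm hf.1, toReal_eLpNorm hg.1] using
    ENNReal.toReal_mono (by finiteness [hf.2.ne, hg.2.ne]) h

theorem eventually_memLp_of_tendsto {p : ℝ≥0∞} {ι : Type*} {l : Filter ι} {φ : ι → α → F}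
    {f : α → F} (hφ : ∀ n, AEStronglyMeasurable (φ n) ν) (hf : MemLp f p ν)
    (h : Tendsto (fun n => eLpNorm (fun x => φ n x - f x) p ν) l (𝓝 0)) :
    ∀ᶠ n in l, MemLp (φ n) p ν := by
  filter_upwards [h.eventually (gt_mem_nhds (zero_lt_one : (0 : ℝ≥0∞) < 1))] with n hn
  have hsub : MemLp (φ n - f) p ν := ⟨(hφ n).sub hf.1, hn.trans ENNReal.one_lt_top⟩
  simpa using hsub.add hf

theorem tendsto_integral_bilin {p q : ℝ≥0∞} [p.HolderConjugate q] (b : A →L[ℝ] B →L[ℝ] W)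
    {ι : Type*} {l : Filter ι} {φ : ι → α → A} {f : α → A} {g : α → B}
    (hφ : ∀ n, AEStronglyMeasurable (φ n) ν) (hf : MemLp f p ν) (hg : MemLp g q ν)
    (h : Tendsto (fun n => eLpNorm (fun x => φ n x - f x) p ν) l (𝓝 0)) :
    Tendsto (fun n => ∫ x, b (φ n x) (g x) ∂ν) l (𝓝 (∫ x, b (f x) (g x) ∂ν)) := by
  rw [tendsto_iff_norm_sub_tendsto_zero]
  have hbound : Tendsto (fun n => ‖b‖ * lpNorm (φ n - f) p ν * lpNorm g q ν) l (𝓝 0) := by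
    have hreal := (ENNReal.tendsto_toReal ENNReal.zero_ne_top).comp h
    simp only [← toReal_eLpNorm ((hφ _).sub hf.1)]
    simpa [Function.comp_def, Pi.sub_def] using (hreal.const_mul ‖b‖).mul_const (lpNorm g q ν)
  refine squeeze_zero' (Eventually.of_forall fun _ => norm_nonneg _) ?_ hbound
  filter_upwards [eventually_memLp_of_tendsto hφ hf h] with n hn
  rw [← integral_sub (integrable_bilin b hn hg) (integrable_bilin b hf hg)]
  simpa using norm_integral_bilin_le b (hn.sub hf) hg

theorem tendsto_lpNorm {p : ℝ≥0∞} [Fact (1 ≤ p)] {ι : Type*} {l : Filter ι} {φ : ι → α → F}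
    {f : α → F} (hφ : ∀ n, MemLp (φ n) p ν) (hf : MemLp f p ν)
    (h : Tendsto (fun n => eLpNorm (fun x => φ n x - f x) p ν) l (𝓝 0)) :
    Tendsto (fun n => lpNorm (φ n) p ν) l (𝓝 (lpNorm f p ν)) := by
  have := ((Lp.tendsto_Lp_iff_tendsto_eLpNorm'' φ hφ f hf).2 h).norm
  simpa only [Lp.norm_toLp, toReal_eLpNorm (hφ _).1, toReal_eLpNorm hf.1] using this

end Pairing

section LpNorm

variable {α F : Type*} {m : MeasurableSpace α} {ν : Measure α} [NormedAddCommGroup F]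

theorem lpNorm_le_mul_lpNorm_of_ae_le_mul {G : Type*} [NormedAddCommGroup G] {p : ℝ≥0∞}
    {f : α → F} {g : α → G} {c : ℝ} (hc : 0 ≤ c) (hf : AEStronglyMeasurable f ν)
    (hg : MemLp g p ν) (h : ∀ᵐ x ∂ν, ‖f x‖ ≤ c * ‖g x‖) : lpNorm f p ν ≤ c * lpNorm g p ν := by
  rw [← toReal_eLpNorm hf, ← toReal_eLpNorm hg.1]
  simpa [ENNReal.toReal_mul, hc] using
    ENNReal.toReal_mono (by finiteness [hg.2.ne]) (eLpNorm_le_mul_eLpNorm_of_ae_le_mul h p)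

theorem integral_norm_sq_eq_lpNorm_sq {f : α → F} (hf : AEStronglyMeasurable f ν) :
    ∫ x, ‖f x‖ ^ 2 ∂ν = lpNorm f 2 ν ^ 2 := by
  have h := lpNorm_eq_integral_norm_rpow_toReal (p := 2) (by simp) (by simp) hf
  simp only [ENNReal.toReal_ofNat, Real.rpow_ofNat] at h
  rw [h, ← one_div, ← Real.sqrt_eq_rpow, Real.sq_sqrt (by positivity)]

variable [InnerProductSpace ℝ F] {f g : α → F}

theorem abs_integral_inner_le (hf : MemLp f 2 ν) (hg : MemLp g 2 ν) :
    |∫ x, inner ℝ (f x) (g x) ∂ν| ≤ lpNorm f 2 ν * lpNorm g 2 ν := by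
  refine (norm_integral_bilin_le (innerSL ℝ) hf hg).trans ?_
  rw [mul_assoc]
  exact mul_le_of_le_one_left (mul_nonneg lpNorm_nonneg lpNorm_nonneg) (norm_innerSL_le ℝ)

end LpNorm

/-! ### Test functions, weak derivatives and the Poincaré inequality in a slab -/

section Calculus

variable {d : ℕ} {F : Type*} [NormedAddCommGroup F] [InnerProductSpace ℝ F] {U : Set (E d)}

theorem contDiff_pderiv {φ : E d → F} (hφ : ContDiff ℝ ∞ φ) (i : Fin d) :
    ContDiff ℝ ∞ (pderiv i φ) :=
  (hφ.fderiv_right (m := ∞) (by simp)).clm_apply contDiff_const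

theorem pderiv_add {φ ψ : E d → F} (hφ : ContDiff ℝ ∞ φ) (hψ : ContDiff ℝ ∞ ψ) (i : Fin d) :
    pderiv i (fun x => φ x + ψ x) = fun x => pderiv i φ x + pderiv i ψ x := by
  ext1 x
  simp only [pderiv]
  rw [fderiv_fun_add (hφ.differentiable (by simp) x) (hψ.differentiable (by simp) x), add_apply]

theorem pderiv_const_smul {φ : E d → F} (hφ : ContDiff ℝ ∞ φ) (c : ℝ) (i : Fin d) :
    pderiv i (fun x => c • φ x) = fun x => c • pderiv i φ x := by
  ext1 x
  simp only [pderiv]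
  rw [fderiv_fun_const_smul (hφ.differentiable (by simp) x), smul_apply]

theorem pderiv_proj (i k : Fin d) (x : E d) :
    pderiv i (fun x : E d => x k) x = if i = k then 1 else 0 := by
  have h : HasFDerivAt (fun x : E d => x k) (EuclideanSpace.proj k : E d →L[ℝ] ℝ) x :=
    (EuclideanSpace.proj k : E d →L[ℝ] ℝ).hasFDerivAt
  simp [pderiv, h.fderiv, eq_comm]

theorem IsTest.pderiv {φ : E d → F} (hφ : IsTest U φ) (i : Fin d) :
    IsTest U (pderiv i φ) :=
  ⟨contDiff_pderiv hφ.1 i, hφ.2.1.fderiv_apply ℝ _,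
    (tsupport_fderiv_apply_subset ℝ _).trans hφ.2.2⟩

theorem IsTest.eq_zero {φ : E d → F} (hφ : IsTest U φ) {x : E d} (hx : x ∉ U) : φ x = 0 :=
  image_eq_zero_of_notMem_tsupport fun h => hx (hφ.2.2 h)

theorem IsTest.memLp {φ : E d → F} (hφ : IsTest U φ) (ν : Measure (E d))
    [IsFiniteMeasureOnCompacts ν] (p : ℝ≥0∞) : MemLp φ p ν :=
  hφ.1.continuous.memLp_of_hasCompactSupport hφ.2.1

theorem integral_pderiv_smul {ψ : E d → ℝ} {φ : E d → F} (hψ : ContDiff ℝ ∞ ψ)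
    (hψc : HasCompactSupport ψ) (hφ : ContDiff ℝ ∞ φ) (i : Fin d) :
    ∫ x, pderiv i ψ x • φ x = - ∫ x, ψ x • pderiv i φ x := by
  have hψ' := contDiff_pderiv hψ i
  have hφ' := contDiff_pderiv hφ i
  refine neg_eq_iff_eq_neg.1 (integral_smul_fderiv_eq_neg_fderiv_smul_of_integrable ?_ ?_ ?_
    (fun x _ => hψ.differentiable (by simp) x) (fun x _ => hφ.differentiable (by simp) x)).symm
  · exact (hψ'.continuous.smul hφ.continuous).integrable_of_hasCompactSupport
      (hψc.fderiv_apply ℝ _).smul_right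
  · exact (hψ.continuous.smul hφ'.continuous).integrable_of_hasCompactSupport hψc.smul_right
  · exact (hψ.continuous.smul hφ.continuous).integrable_of_hasCompactSupport hψc.smul_right

theorem IsTest.setIntegral_pderiv_smul {ψ : E d → ℝ} {φ : E d → F} (hψ : IsTest U ψ)
    (hφ : ContDiff ℝ ∞ φ) (i : Fin d) :
    ∫ x in U, ThinBingham.pderiv i ψ x • φ x = - ∫ x in U, ψ x • ThinBingham.pderiv i φ x := by
  rw [setIntegral_eq_integral_of_forall_compl_eq_zero
      (fun x hx => by rw [(hψ.pderiv i).eq_zero hx, zero_smul]),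
    setIntegral_eq_integral_of_forall_compl_eq_zero
      (fun x hx => by rw [hψ.eq_zero hx, zero_smul]),
    integral_pderiv_smul hψ.1 hψ.2.1 hφ]

theorem isH1_of_tendstoH1 {φ : ℕ → E d → F} {v : E d → F} {Dv : Fin d → E d → F}
    (hφ : ∀ n, ContDiff ℝ ∞ (φ n)) (hv : IsL2 U v) (hDv : ∀ i, IsL2 U (Dv i))
    (h : TendstoH1 U φ v Dv) : IsH1 U v Dv := by
  refine ⟨hv, hDv, fun i ψ hψ => ?_⟩
  let b := (ContinuousLinearMap.lsmul ℝ ℝ : ℝ →L[ℝ] F →L[ℝ] F).flip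
  have hlim := tendsto_integral_bilin b (fun n => (hφ n).continuous.aestronglyMeasurable) hv
    ((hψ.pderiv i).memLp (volume.restrict U) 2) h.1
  have hlim' := tendsto_integral_bilin b
    (fun n => (contDiff_pderiv (hφ n) i).continuous.aestronglyMeasurable) (hDv i)
    (hψ.memLp (volume.restrict U) 2) (h.2 i)
  exact tendsto_nhds_unique hlim
    (hlim'.neg.congr fun n => (hψ.setIntegral_pderiv_smul (hφ n) i).symm)

theorem IsTest.isH1 {φ : E d → F} (hφ : IsTest U φ) :
    IsH1 U φ (fun i => ThinBingham.pderiv i φ) :=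
  ⟨hφ.memLp _ 2, fun i => (hφ.pderiv i).memLp _ 2,
    fun i _ hψ => hψ.setIntegral_pderiv_smul hφ.1 i⟩

theorem IsTest.isH10 {φ : E d → F} (hφ : IsTest U φ) :
    IsH10 U φ (fun i => ThinBingham.pderiv i φ) :=
  ⟨hφ.isH1, fun _ => φ, fun _ => hφ, by simp, by simp⟩

theorem IsTest.integral_norm_sq {φ : E d → F} (hφ : IsTest U φ) (i : Fin d) :
    ∫ x in U, ‖φ x‖ ^ 2 = - ∫ x in U, 2 * inner ℝ (φ x) (ThinBingham.pderiv i φ x) * x i := by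
  have hsq : IsTest U fun x => ‖φ x‖ ^ 2 :=
    ⟨hφ.1.norm_sq ℝ, hφ.2.1.comp_left (g := fun v => ‖v‖ ^ 2) (by simp),
      (tsupport_comp_subset (g := fun v : F => ‖v‖ ^ 2) (by simp) φ).trans hφ.2.2⟩
  have hsq' : ∀ x, ThinBingham.pderiv i (fun x => ‖φ x‖ ^ 2) x =
      2 * inner ℝ (φ x) (ThinBingham.pderiv i φ x) := fun x => by
    simp [ThinBingham.pderiv,
      ((hφ.1.differentiable (by simp)) x).hasFDerivAt.norm_sq.fderiv]
  have h := hsq.setIntegral_pderiv_smul (φ := fun x : E d => x i) (by fun_prop) i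
  simp only [pderiv_proj, if_true, hsq', smul_eq_mul, mul_one] at h
  rw [h, neg_neg]

theorem IsTest.lpNorm_le_of_slab {φ : E d → F} (hφ : IsTest U φ) (i : Fin d) {a : ℝ}
    (ha : 0 ≤ a) (hU : ∀ x ∈ U, |x i| ≤ a) :
    lpNorm φ 2 (volume.restrict U) ≤
      2 * a * lpNorm (ThinBingham.pderiv i φ) 2 (volume.restrict U) := by
  have hφ2 := hφ.memLp (volume.restrict U) 2
  have hDφ2 := (hφ.pderiv i).memLp (volume.restrict U) 2
  have young : ∀ x, -(2 * inner ℝ (φ x) (ThinBingham.pderiv i φ x) * x i) ≤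
      ‖φ x‖ ^ 2 / 2 + 2 * a ^ 2 * ‖ThinBingham.pderiv i φ x‖ ^ 2 := fun x => by
    by_cases hx : x ∈ U
    · have hinner := abs_real_inner_le_norm (φ x) (ThinBingham.pderiv i φ x)
      have hprod := mul_le_mul hinner (hU x hx) (abs_nonneg _) (by positivity)
      rw [← abs_mul] at hprod
      linarith [neg_abs_le (inner ℝ (φ x) (ThinBingham.pderiv i φ x) * x i),
        two_mul_le_add_sq (‖φ x‖) (2 * a * ‖ThinBingham.pderiv i φ x‖)]
    · simp [hφ.eq_zero hx, (hφ.pderiv i).eq_zero hx]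
  have hsq := (hφ2.integrable_norm_pow two_ne_zero).div_const 2
  have hDsq := (hDφ2.integrable_norm_pow two_ne_zero).const_mul (2 * a ^ 2)
  have hprod : Integrable (fun x => 2 * inner ℝ (φ x) (ThinBingham.pderiv i φ x) * x i)
      (volume.restrict U) := by
    have hcont := hφ.1.continuous
    have hDcont := (hφ.pderiv i).1.continuous
    refine (Continuous.integrable_of_hasCompactSupport (by fun_prop) ?_)
    exact hφ.2.1.mono' fun x hx => subset_tsupport _ fun h => hx (by simp [h])
  have hint : lpNorm φ 2 (volume.restrict U) ^ 2 ≤ lpNorm φ 2 (volume.restrict U) ^ 2 / 2 +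
      2 * a ^ 2 * lpNorm (ThinBingham.pderiv i φ) 2 (volume.restrict U) ^ 2 := by
    rw [← integral_norm_sq_eq_lpNorm_sq hφ2.1, ← integral_norm_sq_eq_lpNorm_sq hDφ2.1,
      ← integral_div, ← integral_const_mul, ← integral_add hsq hDsq, hφ.integral_norm_sq i,
      ← integral_neg]
    exact integral_mono hprod.neg (hsq.add hDsq) young
  refine le_of_sq_le_sq (by linarith) ?_
  exact mul_nonneg (by positivity) lpNorm_nonneg

theorem IsH10.lpNorm_le_of_slab {v : E d → F} {Dv : Fin d → E d → F}
    (hv : IsH10 U v Dv) (i : Fin d) {a : ℝ} (ha : 0 ≤ a) (hU : ∀ x ∈ U, |x i| ≤ a) :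
    lpNorm v 2 (volume.restrict U) ≤ 2 * a * lpNorm (Dv i) 2 (volume.restrict U) := by
  obtain ⟨h1, φ, hφ, hlim⟩ := hv
  exact le_of_tendsto_of_tendsto' (tendsto_lpNorm (fun n => (hφ n).memLp _ 2) h1.1 hlim.1)
    ((tendsto_lpNorm (fun n => ((hφ n).pderiv i).memLp _ 2) (h1.2.1 i) (hlim.2 i)).const_mul _)
    fun n => (hφ n).lpNorm_le_of_slab i ha hU

end Calculus

/-! ### Boxes and the splitting `ℝ³ = ℝ² × ℝ` -/

section Boxes

variable {d : ℕ} {s : Fin d → Set ℝ}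

theorem volume_setOf_forall_mem (s : Fin d → Set ℝ) :
    volume {x : E d | ∀ i, x i ∈ s i} = ∏ i, volume (s i) := by
  rw [← volume_pi_pi, ← (PiLp.volume_preserving_ofLp (Fin d)).measure_preimage_equiv
    (f := (MeasurableEquiv.toLp 2 (Fin d → ℝ)).symm) (Set.univ.pi s)]
  congr 1
  ext x
  simp

theorem isOpen_setOf_forall_mem (hs : ∀ i, IsOpen (s i)) :
    IsOpen {x : E d | ∀ i, x i ∈ s i} := by
  rw [Set.ofPred_forall]
  exact isOpen_iInter_of_finite fun i => (hs i).preimage (by fun_prop)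

theorem volume_setOf_apply_eq (i : Fin d) (c : ℝ) : volume {x : E d | x i = c} = 0 := by
  have hbox : {x : E d | x i = c} =
      {x : E d | ∀ j, x j ∈ (if j = i then {c} else Set.univ : Set ℝ)} := by
    ext x
    refine ⟨fun h j => ?_, fun h => by simpa using h i⟩
    by_cases hj : j = i
    · subst hj
      simpa using h
    · simp [hj]
  rw [hbox, volume_setOf_forall_mem]
  exact Finset.prod_eq_zero (Finset.mem_univ i) (by simp)

theorem isOpen_omega : IsOpen omega := isOpen_setOf_forall_mem fun _ => isOpen_Ioo

theorem volume_omega : volume omega = 1 := by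
  simpa [omega] using volume_setOf_forall_mem (d := 2) fun _ => Set.Ioo (0 : ℝ) 1

end Boxes

section Hat

@[simp] theorem hat_zero_apply (x : E 3) : hat x 0 = x 0 := rfl

@[simp] theorem hat_one_apply (x : E 3) : hat x 1 = x 1 := rfl

theorem contDiff_hat : ContDiff ℝ ∞ hat :=
  contDiff_euclidean.2 <| Fin.forall_fin_two.2
    ⟨(by fun_prop : ContDiff ℝ ∞ fun x : E 3 => x 0),
      (by fun_prop : ContDiff ℝ ∞ fun x : E 3 => x 1)⟩

theorem continuous_hat : Continuous hat := contDiff_hat.continuous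

/-- The homeomorphism `x ↦ (x̂, x₃)` from `ℝ³` to `ℝ² × ℝ`. -/
noncomputable def splitHomeomorph : E 3 ≃ₜ E 2 × ℝ where
  toFun x := (hat x, x 2)
  invFun p := !₂[p.1 0, p.1 1, p.2]
  left_inv x := by ext i; fin_cases i <;> simp
  right_inv p := by
    refine Prod.ext ?_ (by simp)
    ext i; fin_cases i <;> simp [hat]
  continuous_toFun := continuous_hat.prodMk (by fun_prop)
  continuous_invFun := (PiLp.continuous_toLp 2 _).comp (by fun_prop)

theorem measurePreserving_splitHomeomorph : MeasurePreserving splitHomeomorph := by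
  have hfinSucc := (volume_preserving_piFinSuccAbove (fun _ : Fin 3 => ℝ) 2).comp
    (PiLp.volume_preserving_ofLp (Fin 3))
  have hswap : MeasurePreserving (Prod.swap : ℝ × (Fin 2 → ℝ) → (Fin 2 → ℝ) × ℝ) :=
    Measure.measurePreserving_swap
  have h := ((PiLp.volume_preserving_toLp (Fin 2)).prod
    (MeasurePreserving.id (volume : Measure ℝ))).comp (hswap.comp hfinSucc)
  convert! h using 1
  ext x
  · rename_i i
    fin_cases i <;> rfl
  · rfl

/-- The cylinder `A × (0, a)`. -/
def cylinder (A : Set (E 2)) (a : ℝ) : Set (E 3) := {x | hat x ∈ A ∧ x 2 ∈ Set.Ioo 0 a}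

variable {F : Type*} [NormedAddCommGroup F] {Ω : Set (E 3)} {A : Set (E 2)} {a : ℝ}

theorem map_hat_restrict_le (h : Ω ⊆ cylinder A a) :
    Measure.map hat (volume.restrict Ω) ≤ ENNReal.ofReal a • volume.restrict A := by
  refine Measure.le_iff.2 fun B hB => ?_
  have hhat : Measurable hat := continuous_hat.measurable
  rw [Measure.map_apply hhat hB, Measure.restrict_apply (hhat hB), Measure.smul_apply,
    Measure.restrict_apply hB, smul_eq_mul]
  calc volume (hat ⁻¹' B ∩ Ω) ≤ volume (splitHomeomorph ⁻¹' ((B ∩ A) ×ˢ Set.Ioo 0 a)) :=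
        measure_mono fun x hx => ⟨⟨hx.1, (h hx.2).1⟩, (h hx.2).2⟩
    _ = volume ((B ∩ A) ×ˢ Set.Ioo 0 a) :=
        measurePreserving_splitHomeomorph.measure_preimage_equiv
          (f := splitHomeomorph.toMeasurableEquiv) _
    _ = ENNReal.ofReal a * volume (B ∩ A) := by
        rw [Measure.volume_eq_prod, Measure.prod_prod, Real.volume_Ioo, sub_zero, mul_comm]

theorem volume_le_of_subset_cylinder (h : Ω ⊆ cylinder A a) :
    volume Ω ≤ ENNReal.ofReal a * volume A := by
  have huniv := map_hat_restrict_le h Set.univ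
  rw [Measure.map_apply continuous_hat.measurable MeasurableSet.univ] at huniv
  simpa using huniv

theorem memLp_comp_hat (h : Ω ⊆ cylinder A a) {p : ℝ≥0∞} {q : E 2 → F}
    (hq : MemLp q p (volume.restrict A)) : MemLp (fun x => q (hat x)) p (volume.restrict Ω) :=
  ((hq.smul_measure ENNReal.ofReal_ne_top).mono_measure
    (map_hat_restrict_le h)).comp_of_map continuous_hat.aemeasurable

theorem lpNorm_comp_hat_le (h : Ω ⊆ cylinder A a) {q : E 2 → F}
    (hq : MemLp q 2 (volume.restrict A)) :
    lpNorm (fun x => q (hat x)) 2 (volume.restrict Ω) ≤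
      √a * lpNorm q 2 (volume.restrict A) := by
  have hmap : AEStronglyMeasurable q (Measure.map hat (volume.restrict Ω)) :=
    ((hq.smul_measure ENNReal.ofReal_ne_top).mono_measure (map_hat_restrict_le h)).1
  have hle := eLpNorm_mono_measure (p := 2) q (map_hat_restrict_le h)
  rw [eLpNorm_map_measure hmap continuous_hat.aemeasurable,
    eLpNorm_smul_measure_of_ne_top (by norm_num)] at hle
  have hle' := ENNReal.toReal_mono (ENNReal.mul_ne_top
    (ENNReal.rpow_ne_top_of_nonneg (by simp) ENNReal.ofReal_ne_top) hq.2.ne) hle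
  rw [← toReal_eLpNorm (memLp_comp_hat h hq).1, ← toReal_eLpNorm hq.1]
  refine hle'.trans_eq ?_
  rw [ENNReal.toReal_mul, ← ENNReal.toReal_rpow]
  rcases le_total 0 a with ha | ha
  · simp [Real.sqrt_eq_rpow, ha]
  · simp [Real.sqrt_eq_zero_of_nonpos ha, ENNReal.ofReal_of_nonpos ha]

end Hat

section Domains

variable {G : E 2 → ℝ} {G₁ ε : ℝ}

theorem isOpen_thinDomain (hG : Continuous G) (ε : ℝ) : IsOpen (thinDomain G ε) := by
  have hhat := continuous_hat
  have hheight : Continuous fun x : E 3 => x 2 := by fun_prop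
  have hgraph : Continuous fun x : E 3 => ε * G (ε⁻¹ • hat x) := by fun_prop
  exact (isOpen_omega.preimage hhat).inter
    ((isOpen_lt continuous_const hheight).inter (isOpen_lt hheight hgraph))

theorem isOpen_cellYstar (hG : Continuous G) (L : Fin 2 → ℝ) : IsOpen (cellYstar L G) := by
  have hhat := continuous_hat
  have hheight : Continuous fun x : E 3 => x 2 := by fun_prop
  have hcellY : IsOpen (cellY L) := isOpen_setOf_forall_mem fun _ => isOpen_Ioo
  exact (hcellY.preimage hhat).inter
    ((isOpen_lt continuous_const hheight).inter (isOpen_lt hheight (hG.comp hhat)))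

theorem thinDomain_subset_cylinder (hε : 0 ≤ ε) (hG : ∀ y, G y ≤ G₁) :
    thinDomain G ε ⊆ cylinder omega (ε * G₁) := fun _ hx =>
  ⟨hx.1, hx.2.1, hx.2.2.trans_le (mul_le_mul_of_nonneg_left (hG _) hε)⟩

theorem abs_height_le (hε : 0 ≤ ε) (hG : ∀ y, G y ≤ G₁) : ∀ x ∈ thinDomain G ε, |x 2| ≤ ε * G₁ :=
  fun _ hx => (abs_of_pos hx.2.1).trans_le (thinDomain_subset_cylinder hε hG hx).2.2.le

theorem cellYstar_subset_cylinder {L : Fin 2 → ℝ} (hG : ∀ y, G y ≤ G₁) :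
    cellYstar L G ⊆ cylinder (cellY L) G₁ := fun _ hx =>
  ⟨hx.1, hx.2.1, hx.2.2.trans_le (hG _)⟩

end Domains

/-! ### The energy estimate -/

section Energy

variable {G : E 2 → ℝ} {G₁ μ g ε C : ℝ} {f u : E 3 → E 3} {Du : Fin 3 → E 3 → E 3}

theorem IsAdmissible.lpNorm_le (hε : 0 ≤ ε) (hG₁ : 0 ≤ G₁) (hG : ∀ y, G y ≤ G₁)
    (hu : IsAdmissible G ε u Du) :
    lpNorm u 2 (volume.restrict (thinDomain G ε)) ≤
      2 * (ε * G₁) * lpNorm (Du 2) 2 (volume.restrict (thinDomain G ε)) :=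
  hu.1.lpNorm_le_of_slab 2 (by positivity) (abs_height_le hε hG)

theorem isAdmissible_zero (G : E 2 → ℝ) (ε : ℝ) : IsAdmissible G ε 0 0 := by
  have htest : IsTest (thinDomain G ε) (0 : E 3 → E 3) :=
    ⟨contDiff_const, HasCompactSupport.zero, by simp [tsupport]⟩
  have hpderiv : (fun i => ThinBingham.pderiv i (0 : E 3 → E 3)) = 0 := by
    ext1 i
    ext1 x
    simp [ThinBingham.pderiv]
  exact ⟨hpderiv ▸ htest.isH10, by simp [divg]⟩

theorem IsBinghamSolution.energy_le (hg : 0 ≤ g) (hε : 0 ≤ ε) (hf : IsL2 (thinDomain G ε) f)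
    (hu : IsBinghamSolution G μ g ε f u Du) :
    μ * ε ^ 2 * ∑ i, lpNorm (Du i) 2 (volume.restrict (thinDomain G ε)) ^ 2 ≤
      lpNorm f 2 (volume.restrict (thinDomain G ε)) *
        lpNorm u 2 (volume.restrict (thinDomain G ε)) := by
  have htested := hu.2 0 0 (isAdmissible_zero G ε)
  obtain ⟨hu2, hDu2, -⟩ := hu.1.1.1
  have hviscous : ∫ x in thinDomain G ε,
      gradDot Du (fun i z => (0 : Fin 3 → E 3 → E 3) i z - Du i z) x =
        - ∑ i, lpNorm (Du i) 2 (volume.restrict (thinDomain G ε)) ^ 2 := by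
    simp only [gradDot, Pi.zero_apply, zero_sub, inner_neg_right, real_inner_self_eq_norm_sq,
      Finset.sum_neg_distrib, integral_neg]
    rw [integral_finsetSum _ fun i _ => (hDu2 i).integrable_norm_pow two_ne_zero]
    simp only [integral_norm_sq_eq_lpNorm_sq (hDu2 _).1]
  have hplastic : ∫ x in thinDomain G ε, gradNorm (0 : Fin 3 → E 3 → E 3) x = 0 := by
    simp [gradNorm]
  have hplastic_nonneg : 0 ≤ g * ε * ∫ x in thinDomain G ε, gradNorm Du x :=
    mul_nonneg (mul_nonneg hg hε) (integral_nonneg fun _ => Real.sqrt_nonneg _)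
  have hforce : ∫ x in thinDomain G ε, inner ℝ (f x) ((0 : E 3 → E 3) x - u x) =
      - ∫ x in thinDomain G ε, inner ℝ (f x) (u x) := by
    simp [inner_neg_right, integral_neg]
  rw [hviscous, hplastic, hforce] at htested
  have hcauchySchwarz := (le_abs_self _).trans (abs_integral_inner_le hf hu2)
  linarith

theorem lpNorm_le_of_rescaledL2Norm_le (hε : 0 < ε) (hf : IsL2 (thinDomain G ε) f)
    (hfC : rescaledL2Norm G ε f ≤ C) :
    lpNorm f 2 (volume.restrict (thinDomain G ε)) ≤ C * √ε := by
  rwa [rescaledL2Norm, toReal_eLpNorm hf.1, Real.rpow_neg hε.le, ← Real.sqrt_eq_rpow,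
    inv_mul_le_iff₀ (Real.sqrt_pos.2 hε), mul_comm] at hfC

theorem IsBinghamSolution.sum_lpNorm_sq_le (hG₁ : 0 ≤ G₁) (hG : ∀ y, G y ≤ G₁) (hμ : 0 < μ)
    (hg : 0 ≤ g) (hε : 0 < ε) (hf : IsL2 (thinDomain G ε) f) (hfC : rescaledL2Norm G ε f ≤ C)
    (hu : IsBinghamSolution G μ g ε f u Du) :
    ε ^ 2 * ∑ i, lpNorm (Du i) 2 (volume.restrict (thinDomain G ε)) ^ 2 ≤
      (2 * G₁ * C / μ) ^ 2 * ε := by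
  have henergy := hu.energy_le hg hε.le hf
  have hpoincare := hu.1.lpNorm_le hε.le hG₁ hG
  have hforce := lpNorm_le_of_rescaledL2Norm_le hε hf hfC
  set D : Fin 3 → ℝ := fun i => lpNorm (Du i) 2 (volume.restrict (thinDomain G ε))
  change μ * ε ^ 2 * ∑ i, D i ^ 2 ≤ _ at henergy
  change ε ^ 2 * ∑ i, D i ^ 2 ≤ _
  have hCε : 0 ≤ C * √ε := lpNorm_nonneg.trans hforce
  have hD2 : D 2 ≤ √(∑ i, D i ^ 2) := Real.le_sqrt_of_sq_le <|
    Finset.single_le_sum (f := fun i => D i ^ 2) (fun _ _ => sq_nonneg _) (Finset.mem_univ 2)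
  set X := ε * √(∑ i, D i ^ 2) with hX
  have hX0 : 0 ≤ X := by positivity
  have hX2 : ε ^ 2 * ∑ i, D i ^ 2 = X ^ 2 := by
    rw [hX, mul_pow, Real.sq_sqrt (Finset.sum_nonneg fun _ _ => sq_nonneg _)]
  have hquad : X * (μ * X) ≤ X * (2 * G₁ * (C * √ε)) := by
    calc X * (μ * X) = μ * ε ^ 2 * ∑ i, D i ^ 2 := by rw [mul_assoc μ, hX2]; ring
      _ ≤ (C * √ε) * (2 * (ε * G₁) * √(∑ i, D i ^ 2)) :=
        henergy.trans <| mul_le_mul hforce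
          (hpoincare.trans (mul_le_mul_of_nonneg_left hD2 (by positivity))) lpNorm_nonneg hCε
      _ = X * (2 * G₁ * (C * √ε)) := by rw [hX]; ring
  have hlin : X ≤ 2 * G₁ * C / μ * √ε := by
    rw [div_mul_eq_mul_div, le_div_iff₀ hμ, mul_comm X μ, mul_assoc _ C]
    rcases hX0.eq_or_lt with h | h
    · rw [← h, mul_zero]
      positivity
    · exact le_of_mul_le_mul_left hquad h
  rw [hX2, ← Real.sq_sqrt hε.le, ← mul_pow]
  exact pow_le_pow_left₀ hX0 hlin 2

end Energy

/-! ### The geometry of the unfolding operator -/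

section Unfolding

variable {L : Fin 2 → ℝ} {G : E 2 → ℝ} {ε : ℝ} {k : Fin 2 → ℤ} {x : E 2} {y : E 3}

/-- The indices of the `ε`-cells contained in `ω`. -/
def cellIndices (L : Fin 2 → ℝ) (ε : ℝ) : Set (Fin 2 → ℤ) :=
  {k | ∀ i, 0 ≤ k i ∧ k i ≤ lastCell (L i) ε}

/-- The union of the open `ε`-cells contained in `ω`; it fills `ω^ε` up to a null set. -/
def openCells (L : Fin 2 → ℝ) (ε : ℝ) : Set (E 2) :=
  ⋃ k : cellIndices L ε, epsCell L ε k

/-- The part of `Ω_ε` that lies over the open cells, where the unfolding operator takes its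
values. -/
def innerDomain (L : Fin 2 → ℝ) (G : E 2 → ℝ) (ε : ℝ) : Set (E 3) :=
  thinDomain G ε ∩ hat ⁻¹' openCells L ε

/-- The index `[x̂/ε]_L` of the `ε`-cell that contains `x̂`. -/
noncomputable def cellIndex (L : Fin 2 → ℝ) (ε : ℝ) (x : E 2) : Fin 2 → ℤ :=
  intPart L (ε⁻¹ • x)

/-- The affine map from `Y*` onto the part of `Ω_ε` over the `k`-th cell. -/
noncomputable def cellMap (L : Fin 2 → ℝ) (ε : ℝ) (k : Fin 2 → ℤ) (y : E 3) : E 3 :=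
  ε • (y + !₂[k 0 * L 0, k 1 * L 1, 0])

/-- The point of `Ω_ε` at which the unfolding operator evaluates. -/
noncomputable def unfoldPoint (L : Fin 2 → ℝ) (ε : ℝ) (p : E 2 × E 3) : E 3 :=
  cellMap L ε (cellIndex L ε p.1) p.2

theorem cellMap_eq (k : Fin 2 → ℤ) (y : E 3) :
    cellMap L ε k y = !₂[ε * (k 0 * L 0) + ε * y 0, ε * (k 1 * L 1) + ε * y 1, ε * y 2] := by
  ext i
  fin_cases i <;> simp [cellMap] <;> ring

theorem unfoldOp_of_mem {F : Type*} [NormedAddCommGroup F] (φ : E 3 → F)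
    (hx : x ∈ omegaEps L ε) : unfoldOp L ε φ x = φ ∘ cellMap L ε (cellIndex L ε x) := by
  ext y
  simp only [unfoldOp, if_pos hx, Function.comp_apply, cellMap_eq, cellIndex]

theorem unfoldOp_of_notMem {F : Type*} [NormedAddCommGroup F] (φ : E 3 → F)
    (hx : x ∉ omegaEps L ε) : unfoldOp L ε φ x = 0 := by
  ext y
  simp only [unfoldOp, if_neg hx, Pi.zero_apply]

theorem cellIndex_apply (x : E 2) (i : Fin 2) : cellIndex L ε x i = ⌊x i / (ε * L i)⌋ := by
  simp only [cellIndex, intPart, PiLp.smul_apply, smul_eq_mul, inv_mul_eq_div, div_div]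

theorem cellIndex_eq_of_mem (hL : ∀ i, 0 < L i) (hε : 0 < ε) (hx : x ∈ epsCell L ε k) :
    cellIndex L ε x = k := by
  ext i
  have hcell : 0 < ε * L i := mul_pos hε (hL i)
  rw [cellIndex_apply, Int.floor_eq_iff, le_div_iff₀ hcell, div_lt_iff₀ hcell]
  exact ⟨by linarith [(hx i).1], by linarith [(hx i).2]⟩

theorem pairwise_disjoint_epsCell (hL : ∀ i, 0 < L i) (hε : 0 < ε) :
    Pairwise (Function.onFun Disjoint (epsCell L ε)) := fun _ _ hkl =>
  Set.disjoint_left.2 fun _ hk hl =>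
    hkl ((cellIndex_eq_of_mem hL hε hk).symm.trans (cellIndex_eq_of_mem hL hε hl))

theorem isOpen_epsCell (k : Fin 2 → ℤ) : IsOpen (epsCell L ε k) :=
  isOpen_setOf_forall_mem fun _ => isOpen_Ioo

theorem isOpen_openCells : IsOpen (openCells L ε) := isOpen_iUnion fun _ => isOpen_epsCell _

theorem closure_epsCell (hL : ∀ i, 0 < L i) (hε : 0 < ε) (k : Fin 2 → ℤ) :
    closure (epsCell L ε k) = {x | ∀ i, x i ∈ Set.Icc (k i * ε * L i) ((k i + 1) * ε * L i)} := by
  let toPi := PiLp.homeomorph 2 (fun _ : Fin 2 => ℝ)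
  have hpreimage : epsCell L ε k =
      toPi ⁻¹' (Set.univ.pi fun i => Set.Ioo (k i * ε * L i) ((k i + 1) * ε * L i)) := by
    ext x
    simp [toPi, epsCell, PiLp.homeomorph]
  have hside : ∀ i, closure (Set.Ioo (k i * ε * L i) ((k i + 1) * ε * L i)) =
      Set.Icc (k i * ε * L i) ((k i + 1) * ε * L i) := fun i => closure_Ioo <| by
    have := mul_pos hε (hL i)
    exact ne_of_lt (by linarith)
  rw [hpreimage, ← toPi.preimage_closure, closure_pi_set]
  simp only [hside]
  exact Set.ext fun x => ⟨fun hx i => hx i (Set.mem_univ i), fun hx i _ => hx i⟩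

theorem lastCell_add_one_mul_le (hL : ∀ i, 0 < L i) (hε : 0 < ε) (i : Fin 2) :
    ((lastCell (L i) ε : ℝ) + 1) * (ε * L i) ≤ 1 := by
  simpa [lastCell] using (le_div_iff₀ (mul_pos hε (hL i))).1 (Int.floor_le (1 / (ε * L i)))

theorem one_sub_lt_lastCell (hL : ∀ i, 0 < L i) (hε : 0 < ε) (i : Fin 2) :
    1 - ε * L i < ((lastCell (L i) ε : ℝ) + 1) * (ε * L i) := by
  have hfloor := (div_lt_iff₀ (mul_pos hε (hL i))).1 (Int.lt_floor_add_one (1 / (ε * L i)))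
  simp only [lastCell, Int.cast_sub, Int.cast_one, sub_add_cancel]
  linarith

theorem cellIndex_mem (hL : ∀ i, 0 < L i) (hε : 0 < ε)
    (hx : ∀ i, x i ∈ Set.Ioo 0 (((lastCell (L i) ε : ℝ) + 1) * (ε * L i))) :
    cellIndex L ε x ∈ cellIndices L ε ∧
    ∀ i, x i ∈ Set.Ico (cellIndex L ε x i * ε * L i) ((cellIndex L ε x i + 1) * ε * L i) := by
  rw [cellIndices, Set.mem_ofPred_eq, ← forall_and]
  intro i
  have hcell : 0 < ε * L i := mul_pos hε (hL i)
  have hle := (le_div_iff₀ hcell).1 (Int.floor_le (x i / (ε * L i)))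
  have hlt := (div_lt_iff₀ hcell).1 (Int.lt_floor_add_one (x i / (ε * L i)))
  rw [cellIndex_apply]
  refine ⟨⟨Int.floor_nonneg.2 (div_nonneg (hx i).1.le hcell.le), ?_⟩, by linarith, by linarith⟩
  rw [← Int.lt_add_one_iff, Int.floor_lt, div_lt_iff₀ hcell]
  push_cast
  exact (hx i).2

theorem omegaEps_eq (hL : ∀ i, 0 < L i) (hε : 0 < ε) :
    omegaEps L ε = {x | ∀ i, x i ∈ Set.Ioo 0 (((lastCell (L i) ε : ℝ) + 1) * (ε * L i))} := by
  apply Set.Subset.antisymm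
  · have hclosed : (⋃ k ∈ {k : Fin 2 → ℤ | ∀ i, 0 ≤ k i ∧ k i ≤ lastCell (L i) ε},
        closure (epsCell L ε k)) ⊆ (PiLp.homeomorph 2 (fun _ : Fin 2 => ℝ)) ⁻¹'
          (Set.univ.pi fun i => Set.Icc 0 (((lastCell (L i) ε : ℝ) + 1) * (ε * L i))) := by
      refine Set.iUnion₂_subset fun k hk x hx i _ => ?_
      rw [closure_epsCell hL hε] at hx
      have hcell : 0 < ε * L i := mul_pos hε (hL i)
      have hk0 : (0 : ℝ) ≤ k i := by exact_mod_cast (hk i).1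
      have hk1 : (k i : ℝ) ≤ lastCell (L i) ε := by exact_mod_cast (hk i).2
      refine ⟨le_trans ?_ (hx i).1, (hx i).2.trans ?_⟩
      · rw [mul_assoc]; positivity
      · rw [mul_assoc]; gcongr
    refine (interior_mono hclosed).trans ?_
    rw [← Homeomorph.preimage_interior, interior_pi_set Set.finite_univ]
    exact fun x hx i => interior_Icc.subset (hx i (Set.mem_univ i))
  · refine interior_maximal (fun x hx => ?_) (isOpen_setOf_forall_mem fun _ => isOpen_Ioo)
    obtain ⟨hindex, hmem⟩ := cellIndex_mem hL hε hx
    refine Set.mem_iUnion₂.2 ⟨_, hindex, ?_⟩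
    rw [closure_epsCell hL hε]
    exact fun i => Set.Ico_subset_Icc_self (hmem i)

theorem epsCell_subset_omegaEps (hk : k ∈ cellIndices L ε) : epsCell L ε k ⊆ omegaEps L ε :=
  interior_maximal (subset_closure.trans
    (Set.subset_biUnion_of_mem (u := fun k => closure (epsCell L ε k)) hk)) (isOpen_epsCell k)

theorem openCells_subset_omegaEps : openCells L ε ⊆ omegaEps L ε :=
  Set.iUnion_subset fun k => epsCell_subset_omegaEps k.2

theorem omegaEps_subset_omega (hL : ∀ i, 0 < L i) (hε : 0 < ε) : omegaEps L ε ⊆ omega := by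
  rw [omegaEps_eq hL hε]
  exact fun x hx i => ⟨(hx i).1, (hx i).2.trans_le (lastCell_add_one_mul_le hL hε i)⟩

theorem volume_omegaEps_diff_openCells (hL : ∀ i, 0 < L i) (hε : 0 < ε) :
    volume (omegaEps L ε \ openCells L ε) = 0 := by
  refine measure_mono_null (t := ⋃ (i : Fin 2) (m : ℤ), {x : E 2 | x i = m * ε * L i}) ?_
    (measure_iUnion_null fun i => measure_iUnion_null fun m => volume_setOf_apply_eq i _)
  rintro x ⟨hx, hx'⟩
  rw [omegaEps_eq hL hε] at hx
  obtain ⟨hindex, hmem⟩ := cellIndex_mem hL hε hx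
  by_contra hgrid
  simp only [Set.mem_iUnion, not_exists] at hgrid
  exact hx' (Set.mem_iUnion.2
    ⟨⟨_, hindex⟩, fun i => ⟨(hmem i).1.lt_of_ne' (hgrid i _), (hmem i).2⟩⟩)

theorem volume_omega_diff_openCells (hL : ∀ i, 0 < L i) (hε : 0 < ε) :
    volume (omega \ openCells L ε) =
      1 - ∏ i, ENNReal.ofReal (((lastCell (L i) ε : ℝ) + 1) * (ε * L i)) := by
  have hae : openCells L ε =ᵐ[volume] omegaEps L ε :=
    openCells_subset_omegaEps.eventuallyLE.antisymm
      (ae_le_set.2 (volume_omegaEps_diff_openCells hL hε))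
  have hsub := omegaEps_subset_omega hL hε
  have hvol : volume (omegaEps L ε) =
      ∏ i, ENNReal.ofReal (((lastCell (L i) ε : ℝ) + 1) * (ε * L i)) := by
    rw [omegaEps_eq hL hε]
    exact (volume_setOf_forall_mem _).trans (by simp)
  rw [measure_congr ((ae_eq_refl omega).diff hae), measure_sdiff hsub
    isOpen_interior.measurableSet.nullMeasurableSet
    (measure_ne_top_of_subset hsub (by simp [volume_omega])), volume_omega, hvol]

theorem tendsto_volume_omega_diff_openCells (hL : ∀ i, 0 < L i) :
    Tendsto (fun ε => volume (omega \ openCells L ε)) (𝓝[>] 0) (𝓝 0) := by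
  have hside : ∀ i, Tendsto (fun ε => ENNReal.ofReal (((lastCell (L i) ε : ℝ) + 1) * (ε * L i)))
      (𝓝[>] 0) (𝓝 1) := fun i => by
    have hlower : Tendsto (fun ε => 1 - ε * L i) (𝓝[>] 0) (𝓝 1) :=
      (Continuous.tendsto' (by fun_prop) 0 1 (by simp)).mono_left nhdsWithin_le_nhds
    simpa using ENNReal.tendsto_ofReal <| tendsto_of_tendsto_of_tendsto_of_le_of_le' hlower
      tendsto_const_nhds
      (eventually_mem_nhdsWithin.mono fun ε hε => (one_sub_lt_lastCell hL hε i).le)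
      (eventually_mem_nhdsWithin.mono fun ε hε => lastCell_add_one_mul_le hL hε i)
  have hprod : Tendsto (fun ε =>
      1 - ∏ i, ENNReal.ofReal (((lastCell (L i) ε : ℝ) + 1) * (ε * L i))) (𝓝[>] 0) (𝓝 0) := by
    simp only [Fin.prod_univ_two]
    simpa using ENNReal.Tendsto.sub tendsto_const_nhds
      (ENNReal.Tendsto.mul (hside 0) (by simp) (hside 1) (by simp)) (Or.inl ENNReal.one_ne_top)
  exact hprod.congr' (eventually_mem_nhdsWithin.mono fun ε hε =>
    (volume_omega_diff_openCells hL hε).symm)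

theorem YPeriodic.add_lattice (hper : YPeriodic L G) (k : Fin 2 → ℤ) (y : E 2) :
    G (y + !₂[k 0 * L 0, k 1 * L 1]) = G y := by
  have hshift : (!₂[k 0 * L 0, k 1 * L 1] : E 2) =
      k 0 • EuclideanSpace.single 0 (L 0) + k 1 • EuclideanSpace.single 1 (L 1) := by
    ext i
    fin_cases i <;> simp
  have hperiodic : ∀ i, Function.Periodic G (EuclideanSpace.single i (L i)) := hper
  rw [hshift]
  exact ((hperiodic 0).zsmul (k 0)).add_period ((hperiodic 1).zsmul (k 1)) y

theorem hat_cellMap (k : Fin 2 → ℤ) (y : E 3) :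
    hat (cellMap L ε k y) = ε • (hat y + !₂[k 0 * L 0, k 1 * L 1]) := by
  ext j
  fin_cases j <;> simp [cellMap]

theorem cellMap_two (k : Fin 2 → ℤ) (y : E 3) : cellMap L ε k y 2 = ε * y 2 := by
  simp [cellMap]

theorem YPeriodic.apply_hat_cellMap (hper : YPeriodic L G) (hε : ε ≠ 0) (k : Fin 2 → ℤ)
    (y : E 3) : G (ε⁻¹ • hat (cellMap L ε k y)) = G (hat y) := by
  rw [hat_cellMap, inv_smul_smul₀ hε, hper.add_lattice]

theorem hat_cellMap_mem_epsCell (hε : 0 < ε) :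
    hat (cellMap L ε k y) ∈ epsCell L ε k ↔ hat y ∈ cellY L := by
  have hside : ∀ a b l : ℝ, ε * (a + b * l) ∈ Set.Ioo (b * ε * l) ((b + 1) * ε * l) ↔
      a ∈ Set.Ioo 0 l := fun a b l => by
    rw [show b * ε * l = ε * (0 + b * l) by ring, show (b + 1) * ε * l = ε * (l + b * l) by ring]
    simp only [Set.mem_Ioo, mul_lt_mul_iff_right₀ hε, add_lt_add_iff_right]
  rw [hat_cellMap]
  simp only [epsCell, cellY, Set.mem_ofPred_eq, Fin.forall_fin_two]
  exact and_congr (hside (y 0) (k 0) (L 0)) (hside (y 1) (k 1) (L 1))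

theorem cellMap_mem_iff (hL : ∀ i, 0 < L i) (hper : YPeriodic L G) (hε : 0 < ε)
    (hk : k ∈ cellIndices L ε) :
    cellMap L ε k y ∈ thinDomain G ε ∩ hat ⁻¹' epsCell L ε k ↔ y ∈ cellYstar L G := by
  simp only [Set.mem_inter_iff, Set.mem_preimage, thinDomain, cellYstar, Set.mem_ofPred_eq,
    cellMap_two, hper.apply_hat_cellMap hε.ne', hat_cellMap_mem_epsCell hε,
    mul_pos_iff_of_pos_left hε, mul_lt_mul_iff_right₀ hε]
  have hcell : epsCell L ε k ⊆ omega :=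
    (epsCell_subset_omegaEps hk).trans (omegaEps_subset_omega hL hε)
  exact ⟨fun h => ⟨h.2, h.1.2⟩, fun h => ⟨⟨hcell ((hat_cellMap_mem_epsCell hε).2 h.1), h.2⟩, h.1⟩⟩

theorem volume_preimage_cellMap (hε : 0 < ε) (k : Fin 2 → ℤ) (B : Set (E 3)) :
    volume (cellMap L ε k ⁻¹' B) = ENNReal.ofReal (ε ^ 3)⁻¹ * volume B := by
  have hcomp : cellMap L ε k ⁻¹' B = (fun y => y + !₂[k 0 * L 0, k 1 * L 1, 0]) ⁻¹'
    ((fun x : E 3 => ε • x) ⁻¹' B) := rfl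
  rw [hcomp, measure_preimage_add_right, Measure.addHaar_preimage_smul _ hε.ne']
  simp [abs_of_pos hε]

theorem volume_epsCell (hL : ∀ i, 0 < L i) (hε : 0 < ε) (k : Fin 2 → ℤ) :
    volume (epsCell L ε k) = ENNReal.ofReal (ε ^ 2 * (L 0 * L 1)) := by
  refine (volume_setOf_forall_mem _).trans ?_
  have hside : ∀ i, (k i + 1) * ε * L i - k i * ε * L i = ε * L i := fun i => by ring
  simp only [Fin.prod_univ_two, Real.volume_Ioo, hside]
  rw [← ENNReal.ofReal_mul (mul_pos hε (hL 0)).le]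
  congr 1
  ring

theorem measurable_unfoldPoint : Measurable (unfoldPoint L ε) := by
  have hindex : ∀ i, Measurable fun p : E 2 × E 3 => (cellIndex L ε p.1 i : ℝ) := fun i => by
    simp only [cellIndex_apply]
    have hquot : Measurable fun p : E 2 × E 3 => p.1 i / (ε * L i) := by fun_prop
    exact measurable_from_top.comp hquot.floor
  have hcoord : unfoldPoint L ε = fun p => !₂[ε * (cellIndex L ε p.1 0 * L 0) + ε * p.2 0,
      ε * (cellIndex L ε p.1 1 * L 1) + ε * p.2 1, ε * p.2 2] := funext fun p => cellMap_eq _ _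
  rw [hcoord]
  refine (WithLp.measurable_toLp 2 _).comp (measurable_pi_lambda _ fun i => ?_)
  fin_cases i
  · exact (((hindex 0).mul_const _).const_mul ε).add (by fun_prop)
  · exact (((hindex 1).mul_const _).const_mul ε).add (by fun_prop)
  · exact (by fun_prop : Measurable fun p : E 2 × E 3 => ε * p.2 2)

theorem unfoldPoint_preimage_inter (hL : ∀ i, 0 < L i) (hper : YPeriodic L G) (hε : 0 < ε)
    (B : Set (E 3)) :
    unfoldPoint L ε ⁻¹' B ∩ openCells L ε ×ˢ cellYstar L G = ⋃ k : cellIndices L ε,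
      epsCell L ε k ×ˢ (cellMap L ε k ⁻¹' (B ∩ (thinDomain G ε ∩ hat ⁻¹' epsCell L ε k))) := by
  ext ⟨x, y⟩
  simp only [Set.mem_inter_iff, Set.mem_preimage, Set.mem_prod, openCells, Set.mem_iUnion]
  constructor
  · rintro ⟨hB, ⟨k, hk⟩, hy⟩
    rw [unfoldPoint, cellIndex_eq_of_mem hL hε hk] at hB
    exact ⟨k, hk, hB, (cellMap_mem_iff hL hper hε k.2).2 hy⟩
  · rintro ⟨k, hk, hB, hy⟩
    rw [unfoldPoint, cellIndex_eq_of_mem hL hε hk]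
    exact ⟨hB, ⟨k, hk⟩, (cellMap_mem_iff hL hper hε k.2).1 hy⟩

theorem inter_innerDomain (B : Set (E 3)) : B ∩ innerDomain L G ε =
    ⋃ k : cellIndices L ε, B ∩ (thinDomain G ε ∩ hat ⁻¹' epsCell L ε k) := by
  simp only [innerDomain, openCells, Set.preimage_iUnion, Set.inter_iUnion]

/-- On each cell the unfolding replaces a volume `ε³ |·|` by `ε² |Y| |·|`. -/
theorem measurePreserving_unfoldPoint (hL : ∀ i, 0 < L i) (hGc : Continuous G)
    (hper : YPeriodic L G) (hε : 0 < ε) :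
    MeasurePreserving (unfoldPoint L ε)
      (volume.restrict (openCells L ε ×ˢ cellYstar L G))
      (ENNReal.ofReal (L 0 * L 1 / ε) • volume.restrict (innerDomain L G ε)) := by
  refine ⟨measurable_unfoldPoint, Measure.ext fun B hB => ?_⟩
  have hmeas : ∀ k : cellIndices L ε,
      MeasurableSet (B ∩ (thinDomain G ε ∩ hat ⁻¹' epsCell L ε k)) := fun k =>
    hB.inter ((isOpen_thinDomain hGc ε).inter
      ((isOpen_epsCell k).preimage continuous_hat)).measurableSet
  have hcellMap : ∀ k : cellIndices L ε, Measurable (cellMap L ε k) := fun k => by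
    unfold cellMap
    fun_prop
  have hdisj : Pairwise fun k l : cellIndices L ε => Disjoint (epsCell L ε k) (epsCell L ε l) :=
    fun _ _ hkl => pairwise_disjoint_epsCell hL hε (Subtype.coe_injective.ne hkl)
  have hL0 := hL 0
  have hL1 := hL 1
  rw [Measure.map_apply measurable_unfoldPoint hB,
    Measure.restrict_apply (measurable_unfoldPoint hB), Measure.smul_apply,
    Measure.restrict_apply hB, smul_eq_mul, unfoldPoint_preimage_inter hL hper hε,
    inter_innerDomain,
    measure_iUnion (fun k l hkl => Set.disjoint_prod.2 (Or.inl (hdisj hkl)))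
      fun k => (isOpen_epsCell _).measurableSet.prod (hcellMap k (hmeas k)),
    measure_iUnion (fun k l hkl => Disjoint.mono
      (Set.inter_subset_right.trans Set.inter_subset_right)
      (Set.inter_subset_right.trans Set.inter_subset_right)
      (Disjoint.preimage hat (hdisj hkl))) hmeas, ← ENNReal.tsum_mul_left]
  refine tsum_congr fun k => ?_
  rw [Measure.volume_eq_prod, Measure.prod_prod, volume_epsCell hL hε,
    volume_preimage_cellMap hε, ← mul_assoc, ← ENNReal.ofReal_mul (by positivity)]
  congr 2
  field_simp

end Unfolding

section UnfoldOp

variable {L : Fin 2 → ℝ} {G : E 2 → ℝ} {ε : ℝ} {F : Type*} [NormedAddCommGroup F] {φ : E 3 → F}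

theorem unfoldOp_ae_eq (hL : ∀ i, 0 < L i) (hε : 0 < ε) (φ : E 3 → F) (S : Set (E 2 × E 3)) :
    Function.uncurry (unfoldOp L ε φ) =ᵐ[volume.restrict S]
      (openCells L ε ×ˢ Set.univ).indicator (φ ∘ unfoldPoint L ε) := by
  have hnull : volume ((omegaEps L ε \ openCells L ε) ×ˢ (Set.univ : Set (E 3))) = 0 := by
    rw [Measure.volume_eq_prod, Measure.prod_prod, volume_omegaEps_diff_openCells hL hε, zero_mul]
  refine ae_restrict_of_ae ?_
  filter_upwards [compl_mem_ae_iff.2 hnull] with ⟨x, y⟩ hp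
  rw [Function.uncurry_apply_pair]
  by_cases hx : x ∈ openCells L ε
  · rw [unfoldOp_of_mem φ (openCells_subset_omegaEps hx),
      Set.indicator_of_mem (by exact ⟨hx, trivial⟩)]
    rfl
  · rw [unfoldOp_of_notMem φ fun hx' => hp ⟨⟨hx', hx⟩, trivial⟩,
      Set.indicator_of_notMem fun hx' => hx hx'.1, Pi.zero_apply]

theorem innerDomain_subset : innerDomain L G ε ⊆ thinDomain G ε := Set.inter_subset_left

theorem measurableSet_openCells_prod_univ :
    MeasurableSet (openCells L ε ×ˢ (Set.univ : Set (E 3))) :=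
  isOpen_openCells.measurableSet.prod MeasurableSet.univ

theorem restrict_prod_restrict_openCells (hL : ∀ i, 0 < L i) (hε : 0 < ε) (Z : Set (E 3)) :
    ((volume : Measure (E 2 × E 3)).restrict (omega ×ˢ Z)).restrict (openCells L ε ×ˢ Set.univ)
      = volume.restrict (openCells L ε ×ˢ Z) := by
  rw [Measure.restrict_restrict measurableSet_openCells_prod_univ, Set.prod_inter_prod,
    Set.univ_inter, Set.inter_eq_left.2
      (openCells_subset_omegaEps.trans (omegaEps_subset_omega hL hε))]

theorem memLp_unfoldOp (hL : ∀ i, 0 < L i) (hGc : Continuous G) (hper : YPeriodic L G)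
    (hε : 0 < ε) {p : ℝ≥0∞} (hφ : MemLp φ p (volume.restrict (thinDomain G ε))) :
    MemLp (Function.uncurry (unfoldOp L ε φ)) p (volume.restrict (omega ×ˢ cellYstar L G)) := by
  rw [memLp_congr_ae (unfoldOp_ae_eq hL hε φ _),
    memLp_indicator_iff_restrict measurableSet_openCells_prod_univ,
    restrict_prod_restrict_openCells hL hε]
  exact ((hφ.mono_measure (Measure.restrict_mono_set _ innerDomain_subset)).smul_measure
    ENNReal.ofReal_ne_top).comp_measurePreserving (measurePreserving_unfoldPoint hL hGc hper hε)

theorem eLpNorm_unfoldOp_le (hL : ∀ i, 0 < L i) (hGc : Continuous G) (hper : YPeriodic L G)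
    (hε : 0 < ε) (hφ : AEStronglyMeasurable φ (volume.restrict (thinDomain G ε))) :
    eLpNorm (Function.uncurry (unfoldOp L ε φ)) 2 (volume.restrict (omega ×ˢ cellYstar L G)) ≤
      ENNReal.ofReal √(L 0 * L 1 / ε) * eLpNorm φ 2 (volume.restrict (thinDomain G ε)) := by
  have hscale : 0 ≤ L 0 * L 1 / ε := div_nonneg (mul_pos (hL 0) (hL 1)).le hε.le
  have hhalf : (1 / 2 : ℝ≥0∞).toReal = 1 / 2 := by simp
  rw [eLpNorm_congr_ae (unfoldOp_ae_eq hL hε φ _),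
    eLpNorm_indicator_eq_eLpNorm_restrict measurableSet_openCells_prod_univ,
    restrict_prod_restrict_openCells hL hε, eLpNorm_comp_measurePreserving
    ((hφ.mono_measure (Measure.restrict_mono_set _ innerDomain_subset)).smul_measure _)
    (measurePreserving_unfoldPoint hL hGc hper hε), eLpNorm_smul_measure_of_ne_top (by simp),
    Real.sqrt_eq_rpow, ← ENNReal.ofReal_rpow_of_nonneg hscale (by simp), smul_eq_mul, hhalf]
  gcongr
  exact innerDomain_subset

theorem lpNorm_unfoldOp_le (hL : ∀ i, 0 < L i) (hGc : Continuous G) (hper : YPeriodic L G)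
    (hε : 0 < ε) (hφ : MemLp φ 2 (volume.restrict (thinDomain G ε))) :
    lpNorm (Function.uncurry (unfoldOp L ε φ)) 2 (volume.restrict (omega ×ˢ cellYstar L G)) ≤
      √(L 0 * L 1 / ε) * lpNorm φ 2 (volume.restrict (thinDomain G ε)) := by
  rw [← toReal_eLpNorm (memLp_unfoldOp hL hGc hper hε hφ).1, ← toReal_eLpNorm hφ.1,
    ← ENNReal.toReal_ofReal (Real.sqrt_nonneg (L 0 * L 1 / ε)), ← ENNReal.toReal_mul]
  exact ENNReal.toReal_mono (by finiteness [hφ.2.ne]) (eLpNorm_unfoldOp_le hL hGc hper hε hφ.1)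

theorem integral_unfoldOp [NormedSpace ℝ F] (hL : ∀ i, 0 < L i) (hGc : Continuous G)
    (hper : YPeriodic L G) (hε : 0 < ε)
    (hφ : AEStronglyMeasurable φ (volume.restrict (thinDomain G ε))) :
    ∫ p in omega ×ˢ cellYstar L G, unfoldOp L ε φ p.1 p.2 =
      (L 0 * L 1 / ε) • ∫ x in innerDomain L G ε, φ x := by
  have hmp := measurePreserving_unfoldPoint hL hGc hper hε
  have hφ' := (hφ.mono_measure (Measure.restrict_mono_set _ (innerDomain_subset (L := L)))
    ).smul_measure (ENNReal.ofReal (L 0 * L 1 / ε))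
  rw [← hmp.map_eq] at hφ'
  calc ∫ p in omega ×ˢ cellYstar L G, unfoldOp L ε φ p.1 p.2
      = ∫ p in openCells L ε ×ˢ cellYstar L G, φ (unfoldPoint L ε p) := by
        refine (integral_congr_ae (unfoldOp_ae_eq hL hε φ (omega ×ˢ cellYstar L G))).trans ?_
        rw [integral_indicator measurableSet_openCells_prod_univ,
          restrict_prod_restrict_openCells hL hε]
        rfl
    _ = (L 0 * L 1 / ε) • ∫ x in innerDomain L G ε, φ x := by
        rw [← integral_map hmp.measurable.aemeasurable hφ', hmp.map_eq, integral_smul_measure,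
          ENNReal.toReal_ofReal (div_nonneg (mul_pos (hL 0) (hL 1)).le hε.le)]

theorem unfoldOp_sub (φ ψ : E 3 → F) :
    unfoldOp L ε (φ - ψ) = unfoldOp L ε φ - unfoldOp L ε ψ := by
  ext1 x
  by_cases hx : x ∈ omegaEps L ε
  · simp only [Pi.sub_apply, unfoldOp_of_mem _ hx, Pi.sub_comp]
  · simp only [Pi.sub_apply, unfoldOp_of_notMem _ hx, sub_zero]

theorem ae_unfoldOp_of_ae (hL : ∀ i, 0 < L i) (hGc : Continuous G) (hper : YPeriodic L G)
    (hε : 0 < ε) {P : F → Prop} (hP : P 0)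
    (hφ : ∀ᵐ x ∂(volume.restrict (thinDomain G ε)), P (φ x)) :
    ∀ᵐ p ∂((volume : Measure (E 2 × E 3)).restrict (omega ×ˢ cellYstar L G)),
      P (unfoldOp L ε φ p.1 p.2) := by
  have hcells : ∀ᵐ p ∂(volume.restrict (openCells L ε ×ˢ cellYstar L G)),
      P (φ (unfoldPoint L ε p)) :=
    (measurePreserving_unfoldPoint hL hGc hper hε).quasiMeasurePreserving.ae
      (Measure.ae_smul_measure (ae_mono (Measure.restrict_mono_set _ innerDomain_subset) hφ) _)
  rw [← restrict_prod_restrict_openCells hL hε,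
    ae_restrict_iff' measurableSet_openCells_prod_univ] at hcells
  filter_upwards [hcells, unfoldOp_ae_eq hL hε φ (omega ×ˢ cellYstar L G)] with p hp heq
  rw [show unfoldOp L ε φ p.1 p.2 = _ from heq]
  by_cases hx : p ∈ openCells L ε ×ˢ (Set.univ : Set (E 3))
  · rw [Set.indicator_of_mem hx]
    exact hp hx
  · rwa [Set.indicator_of_notMem hx]

end UnfoldOp

section UnfoldTest

variable {L : Fin 2 → ℝ} {G : E 2 → ℝ} {ε : ℝ} {F : Type*} [NormedAddCommGroup F]
  [InnerProductSpace ℝ F] {φ : E 3 → F}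

theorem contDiff_cellMap {n : WithTop ℕ∞} (k : Fin 2 → ℤ) : ContDiff ℝ n (cellMap L ε k) := by
  unfold cellMap
  fun_prop

theorem contDiff_unfoldOp {n : WithTop ℕ∞} (hφ : ContDiff ℝ n φ) (x : E 2) :
    ContDiff ℝ n (unfoldOp L ε φ x) := by
  by_cases hx : x ∈ omegaEps L ε
  · rw [unfoldOp_of_mem φ hx]
    exact hφ.comp (contDiff_cellMap _)
  · rw [unfoldOp_of_notMem φ hx]
    exact contDiff_const

theorem pderiv_unfoldOp (hφ : Differentiable ℝ φ) (x : E 2) (i : Fin 3) (y : E 3) :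
    pderiv i (unfoldOp L ε φ x) y = ε • unfoldOp L ε (pderiv i φ) x y := by
  by_cases hx : x ∈ omegaEps L ε
  · rw [unfoldOp_of_mem φ hx, unfoldOp_of_mem _ hx]
    have hcell : HasFDerivAt (cellMap L ε (cellIndex L ε x)) (ε • ContinuousLinearMap.id ℝ (E 3))
        y := ((hasFDerivAt_id y).add_const _).const_smul ε
    rw [pderiv, ((hφ _).hasFDerivAt.comp y hcell).fderiv]
    simp [pderiv]
  · rw [unfoldOp_of_notMem φ hx, unfoldOp_of_notMem _ hx]
    simp [pderiv]

theorem IsTest.unfoldOp_eq_zero (hper : YPeriodic L G) (hε : ε ≠ 0)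
    (hφ : IsTest (thinDomain G ε) φ) (x : E 2) {y : E 3}
    (hy : y ∈ bottomYstar L ∪ topYstar L G) : unfoldOp L ε φ x y = 0 := by
  by_cases hx : x ∈ omegaEps L ε
  · rw [unfoldOp_of_mem φ hx]
    refine hφ.eq_zero ?_
    rintro ⟨-, hpos, hlt⟩
    rw [hper.apply_hat_cellMap hε] at hlt
    rw [cellMap_two] at hpos hlt
    rcases hy with ⟨-, hbottom⟩ | ⟨-, htop⟩
    · simp [hbottom] at hpos
    · simp [htop] at hlt
  · rw [unfoldOp_of_notMem φ hx, Pi.zero_apply]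

end UnfoldTest

/-! ### Weak compactness for jets with zero trace -/

section Hilbert

variable {H : Type*} [NormedAddCommGroup H] [InnerProductSpace ℝ H] [CompleteSpace H]

theorem exists_subseq_tendsto_inner [TopologicalSpace.SeparableSpace H] {x : ℕ → H} {M : ℝ}
    (hx : ∀ n, ‖x n‖ ≤ M) :
    ∃ (a : H) (σ : ℕ → ℕ), StrictMono σ ∧
      ∀ w, Tendsto (fun n => inner ℝ (x (σ n)) w) atTop (𝓝 (inner ℝ a w)) := by
  obtain ⟨a, -, σ, hσ, hlim⟩ := WeakDual.isSeqCompact_closedBall ℝ H 0 M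
    (x := fun n => StrongDual.toWeakDual (InnerProductSpace.toDual ℝ H (x n)))
    (fun n => by simpa using hx n)
  refine ⟨(InnerProductSpace.toDual ℝ H).symm (WeakDual.toStrongDual a), σ, hσ, fun w => ?_⟩
  rw [InnerProductSpace.toDual_symm_apply]
  exact ((WeakDual.eval_continuous w).tendsto a).comp hlim

theorem mem_topologicalClosure_of_tendsto_inner (K : Submodule ℝ H) {x : ℕ → H} {a : H}
    (hx : ∀ n, x n ∈ K.topologicalClosure)
    (h : ∀ w, Tendsto (fun n => inner ℝ (x n) w) atTop (𝓝 (inner ℝ a w))) :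
    a ∈ K.topologicalClosure := by
  rw [← Submodule.orthogonal_orthogonal_eq_closure] at hx ⊢
  rw [Submodule.mem_orthogonal']
  exact fun w hw => tendsto_nhds_unique (h w)
    (tendsto_const_nhds.congr fun n => ((Submodule.mem_orthogonal' _ _).1 (hx n) w hw).symm)

end Hilbert

section Slices

variable {X Y F : Type*} [MeasurableSpace X] [MeasurableSpace Y] [NormedAddCommGroup F]
  {ρ : Measure X} {τ : Measure Y}

theorem eLpNorm_two_sq (f : X → F) : eLpNorm f 2 ρ ^ 2 = ∫⁻ x, ‖f x‖ₑ ^ 2 ∂ρ := by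
  simpa using eLpNorm_nnreal_pow_eq_lintegral (μ := ρ) (f := f) (p := 2) (by simp)

variable [SFinite τ]

theorem lintegral_eLpNorm_slice_sq {h : X × Y → F} (hh : AEStronglyMeasurable h (ρ.prod τ)) :
    ∫⁻ x, eLpNorm (fun y => h (x, y)) 2 τ ^ 2 ∂ρ = eLpNorm h 2 (ρ.prod τ) ^ 2 := by
  rw [eLpNorm_two_sq, lintegral_prod _ (hh.enorm.pow_const 2)]
  exact lintegral_congr fun x => eLpNorm_two_sq _

theorem aemeasurable_eLpNorm_slice_sq {h : X × Y → F} (hh : AEStronglyMeasurable h (ρ.prod τ)) :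
    AEMeasurable (fun x => eLpNorm (fun y => h (x, y)) 2 τ ^ 2) ρ := by
  simp only [eLpNorm_two_sq]
  exact (hh.enorm.pow_const 2).lintegral_prod_right'

theorem ae_memLp_slice {h : X × Y → F} (hh : MemLp h 2 (ρ.prod τ)) :
    ∀ᵐ x ∂ρ, MemLp (fun y => h (x, y)) 2 τ := by
  have hfinite : ∀ᵐ x ∂ρ, eLpNorm (fun y => h (x, y)) 2 τ ^ 2 < ⊤ :=
    ae_lt_top' (aemeasurable_eLpNorm_slice_sq hh.1) <| by
      rw [lintegral_eLpNorm_slice_sq hh.1]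
      finiteness [hh.2.ne]
  filter_upwards [hfinite, hh.1.prodMk_left] with x hx hx'
  exact ⟨hx', by simpa using hx⟩

/-- The squares of the slice norms are summable along a subsequence of rapid convergence. -/
theorem exists_subseq_ae_tendsto_slice {h : ℕ → X × Y → F}
    (hh : ∀ n, AEStronglyMeasurable (h n) (ρ.prod τ))
    (hlim : Tendsto (fun n => eLpNorm (h n) 2 (ρ.prod τ)) atTop (𝓝 0)) :
    ∃ σ : ℕ → ℕ, StrictMono σ ∧
      ∀ᵐ x ∂ρ, Tendsto (fun n => eLpNorm (fun y => h (σ n) (x, y)) 2 τ) atTop (𝓝 0) := by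
  have hlim_sq : Tendsto (fun n => eLpNorm (h n) 2 (ρ.prod τ) ^ 2) atTop (𝓝 0) := by
    simpa using ENNReal.Tendsto.pow (n := 2) hlim
  obtain ⟨σ, hσ, hrapid⟩ := extraction_forall_of_eventually'
    (P := fun n k => eLpNorm (h k) 2 (ρ.prod τ) ^ 2 ≤ (2⁻¹ : ℝ≥0∞) ^ n) fun n =>
      eventually_atTop.1 (hlim_sq.eventually (ge_mem_nhds (ENNReal.pow_pos (by simp) n)))
  refine ⟨σ, hσ, ?_⟩
  have hsum : ∫⁻ x, ∑' n, eLpNorm (fun y => h (σ n) (x, y)) 2 τ ^ 2 ∂ρ ≠ ⊤ := by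
    rw [lintegral_tsum fun n => aemeasurable_eLpNorm_slice_sq (hh _)]
    simp only [lintegral_eLpNorm_slice_sq (hh _)]
    refine ne_top_of_le_ne_top ?_ (ENNReal.tsum_le_tsum hrapid)
    simp [ENNReal.tsum_geometric]
  filter_upwards [ae_lt_top' (AEMeasurable.tsum fun n =>
    aemeasurable_eLpNorm_slice_sq (hh (σ n))) hsum] with x hx
  have hsqrt := (ENNReal.continuous_rpow_const (y := (1 / 2 : ℝ))).tendsto 0 |>.comp
    (ENNReal.tendsto_atTop_zero_of_tsum_ne_top hx.ne)
  rw [ENNReal.zero_rpow_of_pos (by simp)] at hsqrt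
  refine hsqrt.congr fun n => ?_
  rw [Function.comp_apply, ← ENNReal.rpow_natCast, ← ENNReal.rpow_mul]
  simp

end Slices

/-- First order jets of maps from `ℝ³` to `ℝ³`: the value followed by the three partial
derivatives. -/
abbrev JetSpace : Type := PiLp 2 (fun _ : Fin 4 => E 3)

/-- The jet `(u, D₁u, D₂u, D₃u)`. -/
noncomputable def jet {α : Type*} (u : α → E 3) (Du : Fin 3 → α → E 3) (p : α) : JetSpace :=
  WithLp.toLp 2 (Fin.cons (u p) fun i => Du i p)

section Jet

variable {α : Type*} {m : MeasurableSpace α} {ν : Measure α} {u w : α → E 3}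
  {Du Dw : Fin 3 → α → E 3}

theorem jet_sub : jet u Du - jet w Dw = jet (u - w) (Du - Dw) := by
  ext p j : 2
  exact Fin.cases rfl (fun _ => rfl) j

theorem memLp_jet_iff : MemLp (jet u Du) 2 ν ↔ MemLp u 2 ν ∧ ∀ i, MemLp (Du i) 2 ν := by
  rw [memLp_piLp_iff, Fin.forall_fin_succ]
  rfl

theorem norm_le_sum_norm_apply {ι : Type*} [Fintype ι] {p : ℝ≥0∞} [Fact (1 ≤ p)]
    {V : ι → Type*} [∀ i, NormedAddCommGroup (V i)] (v : PiLp p V) : ‖v‖ ≤ ∑ i, ‖v i‖ := by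
  classical
  have hsum : v = ∑ i, PiLp.single p i (v i) := by
    ext i : 1
    rw [WithLp.ofLp_sum, Finset.sum_apply, Finset.sum_eq_single i
      (fun k _ hk => PiLp.single_eq_of_ne' p hk _) (by simp), PiLp.single_eq_same]
  calc ‖v‖ = ‖∑ i, PiLp.single p i (v i)‖ := by rw [← hsum]
    _ ≤ ∑ i, ‖PiLp.single p i (v i)‖ := norm_sum_le _ _
    _ = ∑ i, ‖v i‖ := by simp only [PiLp.norm_single]

theorem eLpNorm_jet_le (hu : AEStronglyMeasurable u ν) (hDu : ∀ i, AEStronglyMeasurable (Du i) ν) :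
    eLpNorm (jet u Du) 2 ν ≤ eLpNorm u 2 ν + ∑ i, eLpNorm (Du i) 2 ν := by
  calc eLpNorm (jet u Du) 2 ν
      ≤ eLpNorm ((fun p => ‖u p‖) + ∑ i, fun p => ‖Du i p‖) 2 ν := by
        refine eLpNorm_mono_real fun p => (norm_le_sum_norm_apply _).trans_eq ?_
        rw [Fin.sum_univ_succ, Pi.add_apply, Finset.sum_apply]
        rfl
    _ ≤ eLpNorm (fun p => ‖u p‖) 2 ν + ∑ i, eLpNorm (fun p => ‖Du i p‖) 2 ν :=
        (eLpNorm_add_le hu.norm (Finset.aestronglyMeasurable_sum _ fun i _ => (hDu i).norm)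
          (by simp)).trans (by gcongr; exact eLpNorm_sum_le (fun i _ => (hDu i).norm) (by simp))
    _ = eLpNorm u 2 ν + ∑ i, eLpNorm (Du i) 2 ν := by simp only [eLpNorm_norm]

theorem lpNorm_jet_le (hu : MemLp u 2 ν) (hDu : ∀ i, MemLp (Du i) 2 ν) :
    lpNorm (jet u Du) 2 ν ≤ lpNorm u 2 ν + ∑ i, lpNorm (Du i) 2 ν := by
  have hsum : ∑ i, eLpNorm (Du i) 2 ν ≠ ⊤ := ENNReal.sum_ne_top.2 fun i _ => (hDu i).2.ne
  simp only [← toReal_eLpNorm hu.1, ← toReal_eLpNorm (hDu _).1,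
    ← toReal_eLpNorm (memLp_jet_iff.2 ⟨hu, hDu⟩).1]
  rw [← ENNReal.toReal_sum fun i _ => (hDu i).2.ne, ← ENNReal.toReal_add hu.2.ne hsum]
  exact ENNReal.toReal_mono (ENNReal.add_ne_top.2 ⟨hu.2.ne, hsum⟩)
    (eLpNorm_jet_le hu.1 fun i => (hDu i).1)

end Jet

section SliceJet

/-- The jet of a differentiable field. -/
noncomputable def gradJet (φ : E 3 → E 3) : E 3 → JetSpace := jet φ fun i => pderiv i φ

theorem gradJet_zero : gradJet 0 = 0 := by
  ext y j : 2
  exact Fin.cases rfl (fun i => by simp [gradJet, jet, pderiv]) j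

theorem gradJet_add {φ ψ : E 3 → E 3} (hφ : ContDiff ℝ ∞ φ) (hψ : ContDiff ℝ ∞ ψ) :
    gradJet (φ + ψ) = gradJet φ + gradJet ψ := by
  ext y j : 2
  exact Fin.cases rfl (fun i => congrFun (pderiv_add hφ hψ i) y) j

theorem gradJet_const_smul {φ : E 3 → E 3} (hφ : ContDiff ℝ ∞ φ) (c : ℝ) :
    gradJet (c • φ) = c • gradJet φ := by
  ext y j : 2
  exact Fin.cases rfl (fun i => congrFun (pderiv_const_smul hφ c i) y) j

/-- Almost every slice of `f` is the jet of a smooth function that vanishes on `Γ`. -/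
def IsSliceJet (A : Set (E 2)) (Z Γ : Set (E 3)) (f : E 2 × E 3 → JetSpace) : Prop :=
  ∀ᵐ x ∂(volume.restrict A), ∃ φ : E 3 → E 3, ContDiff ℝ ∞ φ ∧ (∀ y ∈ Γ, φ y = 0) ∧
    (fun y => f (x, y)) =ᵐ[volume.restrict Z] gradJet φ

variable {A : Set (E 2)} {Z Γ : Set (E 3)}

theorem restrict_prod_eq (A : Set (E 2)) (Z : Set (E 3)) :
    (volume : Measure (E 2 × E 3)).restrict (A ×ˢ Z) =
      (volume.restrict A).prod (volume.restrict Z) := by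
  rw [Measure.prod_restrict, Measure.volume_eq_prod]

theorem ae_ae_of_ae_restrict_prod {P : E 2 × E 3 → Prop}
    (h : ∀ᵐ p ∂((volume : Measure (E 2 × E 3)).restrict (A ×ˢ Z)), P p) :
    ∀ᵐ x ∂(volume.restrict A), ∀ᵐ y ∂(volume.restrict Z), P (x, y) := by
  rw [restrict_prod_eq] at h
  exact Measure.ae_ae_of_ae_prod h

theorem IsSliceJet.congr {f g : E 2 × E 3 → JetSpace} (hf : IsSliceJet A Z Γ f)
    (h : g =ᵐ[volume.restrict (A ×ˢ Z)] f) : IsSliceJet A Z Γ g := by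
  filter_upwards [hf, ae_ae_of_ae_restrict_prod h] with x ⟨φ, hφ, hzero, hjet⟩ hx
  exact ⟨φ, hφ, hzero, EventuallyEq.trans hx hjet⟩

theorem isSliceJet_zero : IsSliceJet A Z Γ 0 :=
  Eventually.of_forall fun _ =>
    ⟨0, contDiff_const, fun _ _ => rfl, Eventually.of_forall fun y => by rw [gradJet_zero]; rfl⟩

theorem IsSliceJet.add {f g : E 2 × E 3 → JetSpace} (hf : IsSliceJet A Z Γ f)
    (hg : IsSliceJet A Z Γ g) : IsSliceJet A Z Γ (f + g) := by
  filter_upwards [hf, hg] with x ⟨φ, hφ, hφ0, hφjet⟩ ⟨ψ, hψ, hψ0, hψjet⟩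
  refine ⟨φ + ψ, hφ.add hψ, fun y hy => by simp [hφ0 y hy, hψ0 y hy], ?_⟩
  rw [gradJet_add hφ hψ]
  exact hφjet.add hψjet

theorem IsSliceJet.const_smul {f : E 2 × E 3 → JetSpace} (hf : IsSliceJet A Z Γ f) (c : ℝ) :
    IsSliceJet A Z Γ (c • f) := by
  filter_upwards [hf] with x ⟨φ, hφ, hφ0, hφjet⟩
  refine ⟨c • φ, hφ.const_smul c, fun y hy => by simp [hφ0 y hy], ?_⟩
  rw [gradJet_const_smul hφ]
  exact hφjet.const_smul c

/-- The `L²` classes whose slices are jets of smooth functions vanishing on `Γ`. The closure of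
this subspace is weakly closed and retains the zero trace on `Γ`. -/
def sliceJets (A : Set (E 2)) (Z Γ : Set (E 3)) :
    Submodule ℝ (Lp JetSpace 2 ((volume : Measure (E 2 × E 3)).restrict (A ×ˢ Z))) where
  carrier := {f | IsSliceJet A Z Γ f}
  zero_mem' := isSliceJet_zero.congr (Lp.coeFn_zero _ _ _)
  add_mem' hf hg := (IsSliceJet.add hf hg).congr (Lp.coeFn_add _ _)
  smul_mem' c _ hf := (IsSliceJet.const_smul hf c).congr (Lp.coeFn_smul _ _)

theorem tendstoH1_of_tendsto_gradJet {φ : ℕ → E 3 → E 3} {J : E 3 → JetSpace}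
    (h : Tendsto (fun n => eLpNorm (gradJet (φ n) - J) 2 (volume.restrict Z)) atTop (𝓝 0)) :
    TendstoH1 Z φ (fun y => J y 0) (fun i y => J y i.succ) := by
  have hcomponent : ∀ j : Fin 4, Tendsto (fun n => eLpNorm (fun y => gradJet (φ n) y j - J y j) 2
      (volume.restrict Z)) atTop (𝓝 0) := fun j =>
    tendsto_of_tendsto_of_tendsto_of_le_of_le tendsto_const_nhds h (fun _ => zero_le)
      fun n => eLpNorm_mono fun y => PiLp.norm_apply_le (gradJet (φ n) y - J y) j
  exact ⟨hcomponent 0, fun i => hcomponent i.succ⟩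

theorem ae_hasTrace_of_mem_closure (hΓ : MeasurableSet Γ) {J : E 2 × E 3 → JetSpace}
    (hJ : MemLp J 2 (volume.restrict (A ×ˢ Z)))
    (hcl : hJ.toLp ∈ (sliceJets A Z Γ).topologicalClosure) :
    ∀ᵐ x ∂(volume.restrict A),
      HasTrace Z Γ (fun y => J (x, y) 0) (fun i y => J (x, y) i.succ) (fun _ => 0) := by
  obtain ⟨s, hs, hlim⟩ := mem_closure_iff_seq_limit.1 hcl
  rw [Lp.tendsto_Lp_iff_tendsto_eLpNorm _ _ hJ] at hlim
  have hmeas : ∀ n, AEStronglyMeasurable (⇑(s n) - J) (volume.restrict (A ×ˢ Z)) := fun n =>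
    (Lp.aestronglyMeasurable _).sub hJ.1
  rw [restrict_prod_eq] at hJ
  simp only [restrict_prod_eq] at hlim hmeas
  obtain ⟨σ, -, hσ⟩ := exists_subseq_ae_tendsto_slice hmeas hlim
  filter_upwards [hσ, ae_memLp_slice hJ, ae_all_iff.2 hs] with x hslice hmem hjets
  choose φ hφ hzero hjet using fun n => hjets (σ n)
  have hH1 : TendstoH1 Z φ (fun y => J (x, y) 0) (fun i y => J (x, y) i.succ) :=
    tendstoH1_of_tendsto_gradJet (J := fun y => J (x, y)) <| hslice.congr fun n =>
      eLpNorm_congr_ae ((hjet n).sub (ae_eq_refl _))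
  rw [memLp_piLp_iff] at hmem
  refine ⟨isH1_of_tendstoH1 hφ (hmem 0) (fun i => hmem i.succ) hH1, φ, hφ, hH1, ?_⟩
  refine tendsto_const_nhds.congr fun n => ?_
  rw [eLpNorm_congr_ae (g := fun _ => (0 : E 3)), eLpNorm_zero']
  filter_upwards [ae_restrict_mem hΓ] with y hy
  rw [hzero n y hy, sub_zero]

end SliceJet

section WeakLimit

variable {A : Set (E 2)} {Z Γ : Set (E 3)} {J : ℕ → E 2 × E 3 → JetSpace}

theorem inner_jetSpace_single (v : JetSpace) (j : Fin 4) (w : E 3) :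
    inner ℝ v (PiLp.single 2 j w : JetSpace) = inner ℝ (v j) w := by
  rw [PiLp.inner_apply, Finset.sum_eq_single j
    (fun k _ hk => by rw [PiLp.single_eq_of_ne 2 hk, inner_zero_right]) (by simp),
    PiLp.single_eq_same]

theorem memLp_piLp_single {α ι F : Type*} [MeasurableSpace α] {ν : Measure α} [Fintype ι]
    [DecidableEq ι] [NormedAddCommGroup F] {p q : ℝ≥0∞} [Fact (1 ≤ q)] {f : α → F}
    (hf : MemLp f p ν) (j : ι) :
    MemLp (fun x => (PiLp.single q j (f x) : PiLp q fun _ : ι => F)) p ν := by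
  refine memLp_piLp_iff.2 fun k => ?_
  rcases eq_or_ne k j with rfl | hk
  · simpa only [PiLp.single_eq_same] using hf
  · simp [hk]

theorem weakTendstoL2_apply (hJ : ∀ n, MemLp (J n) 2 (volume.restrict (A ×ˢ Z)))
    {a : Lp JetSpace 2 ((volume : Measure (E 2 × E 3)).restrict (A ×ˢ Z))}
    (h : ∀ w, Tendsto (fun n => inner ℝ (hJ n).toLp w) atTop (𝓝 (inner ℝ a w))) (j : Fin 4) :
    WeakTendstoL2 A Z (fun n x y => J n (x, y) j) (fun x y => a (x, y) j) := by
  refine ⟨fun n => memLp_piLp_iff.1 (hJ n) j, memLp_piLp_iff.1 (Lp.memLp a) j, fun w hw => ?_⟩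
  have hsingle : MemLp (fun p : E 2 × E 3 => (PiLp.single 2 j (w p.1 p.2) : JetSpace)) 2
      (volume.restrict (A ×ˢ Z)) := memLp_piLp_single hw j
  have hlim := h hsingle.toLp
  simp only [L2.inner_def] at hlim
  convert hlim using 2
  · refine integral_congr_ae ?_
    filter_upwards [hsingle.coeFn_toLp, (hJ _).coeFn_toLp] with p hw hJ
    rw [hw, hJ, inner_jetSpace_single]
  · refine integral_congr_ae ?_
    filter_upwards [hsingle.coeFn_toLp] with p hw
    rw [hw, inner_jetSpace_single]

theorem exists_subseq_weakTendstoL2 (hΓ : MeasurableSet Γ)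
    (hJ : ∀ n, MemLp (J n) 2 (volume.restrict (A ×ˢ Z)))
    (hcl : ∀ n, (hJ n).toLp ∈ (sliceJets A Z Γ).topologicalClosure) {M : ℝ}
    (hM : ∀ n, lpNorm (J n) 2 (volume.restrict (A ×ˢ Z)) ≤ M) :
    ∃ σ : ℕ → ℕ, StrictMono σ ∧ ∃ (u : E 2 → E 3 → E 3) (Du : Fin 3 → E 2 → E 3 → E 3),
      (∀ᵐ x ∂(volume.restrict A), HasTrace Z Γ (u x) (fun i => Du i x) (fun _ => 0)) ∧
      WeakTendstoL2 A Z (fun n x y => J (σ n) (x, y) 0) u ∧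
      ∀ i : Fin 3, WeakTendstoL2 A Z (fun n x y => J (σ n) (x, y) i.succ) (Du i) := by
  have : Fact ((2 : ℝ≥0∞) ≠ ⊤) := ⟨by simp⟩
  have : MeasureTheory.IsSeparable ((volume : Measure (E 2 × E 3)).restrict (A ×ˢ Z)) :=
    isSeparable_of_sigmaFinite _
  have hbound : ∀ n, ‖(hJ n).toLp‖ ≤ M := fun n => by
    rw [Lp.norm_toLp, toReal_eLpNorm (hJ n).1]
    exact hM n
  obtain ⟨a, σ, hσ, hweak⟩ := exists_subseq_tendsto_inner hbound
  have ha : a ∈ (sliceJets A Z Γ).topologicalClosure :=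
    mem_topologicalClosure_of_tendsto_inner _ (fun n => hcl (σ n)) hweak
  rw [← Lp.toLp_coeFn a (Lp.memLp a)] at ha
  exact ⟨σ, hσ, fun x y => a (x, y) 0, fun i x y => a (x, y) i.succ,
    ae_hasTrace_of_mem_closure hΓ _ ha, weakTendstoL2_apply (fun n => hJ (σ n)) hweak 0,
    fun i => weakTendstoL2_apply (fun n => hJ (σ n)) hweak i.succ⟩

end WeakLimit

section UnfoldedJets

variable {L : Fin 2 → ℝ} {G : E 2 → ℝ} {ε : ℝ} {v : E 3 → E 3} {Dv : Fin 3 → E 3 → E 3}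

theorem unfoldOp_jet (L : Fin 2 → ℝ) (ε : ℝ) (v : E 3 → E 3) (Dv : Fin 3 → E 3 → E 3) (x : E 2)
    (y : E 3) : unfoldOp L ε (jet v fun i => ε • Dv i) x y =
      jet (unfoldOp L ε v x) (fun i => ε • unfoldOp L ε (Dv i) x) y := by
  by_cases hx : x ∈ omegaEps L ε
  · simp only [jet, unfoldOp_of_mem _ hx]
    rfl
  · ext j : 1
    simp only [jet, unfoldOp_of_notMem _ hx]
    exact Fin.cases rfl (fun _ => (smul_zero ε).symm) j

theorem measurableSet_bottom_union_top (hG : Continuous G) :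
    MeasurableSet (bottomYstar L ∪ topYstar L G) := by
  have hcell : MeasurableSet (hat ⁻¹' cellY L) :=
    ((isOpen_setOf_forall_mem fun _ => isOpen_Ioo).preimage continuous_hat).measurableSet
  have hheight : Continuous fun x : E 3 => x 2 := by fun_prop
  exact (hcell.inter (isClosed_eq hheight continuous_const).measurableSet).union
    (hcell.inter (isClosed_eq hheight (hG.comp continuous_hat)).measurableSet)

theorem memLp_scaledJet {ν : Measure (E 3)} (hv : MemLp v 2 ν) (hDv : ∀ i, MemLp (Dv i) 2 ν) :
    MemLp (jet v fun i => ε • Dv i) 2 ν :=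
  memLp_jet_iff.2 ⟨hv, fun i => (hDv i).const_smul ε⟩

theorem IsTest.isSliceJet_unfoldOp (hper : YPeriodic L G) (hε : ε ≠ 0)
    (hv : IsTest (thinDomain G ε) v) :
    IsSliceJet omega (cellYstar L G) (bottomYstar L ∪ topYstar L G)
      (Function.uncurry (unfoldOp L ε (jet v fun i => ε • ThinBingham.pderiv i v))) := by
  refine Eventually.of_forall fun x => ⟨unfoldOp L ε v x, contDiff_unfoldOp hv.1 x,
    fun y hy => hv.unfoldOp_eq_zero hper hε x hy, Eventually.of_forall fun y => ?_⟩
  change unfoldOp L ε _ x y = _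
  rw [unfoldOp_jet]
  simp only [gradJet, jet, pderiv_unfoldOp (hv.1.differentiable (by simp)), Pi.smul_apply]

theorem tendsto_eLpNorm_scaledJet {ν : Measure (E 3)} {φ : ℕ → E 3 → E 3}
    {Dφ : ℕ → Fin 3 → E 3 → E 3} (hφ : ∀ n, MemLp (φ n - v) 2 ν)
    (hDφ : ∀ n i, MemLp (Dφ n i - Dv i) 2 ν)
    (hlim : Tendsto (fun n => eLpNorm (φ n - v) 2 ν) atTop (𝓝 0))
    (hDlim : ∀ i, Tendsto (fun n => eLpNorm (Dφ n i - Dv i) 2 ν) atTop (𝓝 0)) :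
    Tendsto (fun n => eLpNorm ((jet (φ n) fun i => ε • Dφ n i) - jet v fun i => ε • Dv i) 2 ν)
      atTop (𝓝 0) := by
  have hbound : Tendsto (fun n => eLpNorm (φ n - v) 2 ν +
      ∑ i, ‖ε‖ₑ * eLpNorm (Dφ n i - Dv i) 2 ν) atTop (𝓝 0) := by
    simpa using hlim.add (tendsto_finsetSum Finset.univ fun i _ =>
      ENNReal.Tendsto.const_mul (a := ‖ε‖ₑ) (hDlim i) (Or.inr (by simp)))
  refine tendsto_of_tendsto_of_tendsto_of_le_of_le tendsto_const_nhds hbound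
    (fun _ => zero_le) fun n => ?_
  simp only [← eLpNorm_const_smul]
  have hDsub : ((fun i => ε • Dφ n i) - fun i => ε • Dv i) = fun i => ε • (Dφ n i - Dv i) :=
    funext fun i => (smul_sub ε _ _).symm
  rw [jet_sub, hDsub]
  exact eLpNorm_jet_le (hφ n).1 fun i => ((hDφ n i).const_smul ε).1

theorem IsH10.toLp_unfoldOp_jet_mem (hL : ∀ i, 0 < L i) (hGc : Continuous G)
    (hper : YPeriodic L G) (hε : 0 < ε) (hv : IsH10 (thinDomain G ε) v Dv) :
    (memLp_unfoldOp hL hGc hper hε (memLp_scaledJet (ε := ε) hv.1.1 hv.1.2.1)).toLp ∈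
      (sliceJets omega (cellYstar L G) (bottomYstar L ∪ topYstar L G)).topologicalClosure := by
  obtain ⟨⟨hvL2, hDvL2, -⟩, φ, hφ, hlim, hDlim⟩ := hv
  have hφL2 : ∀ n, MemLp (φ n) 2 (volume.restrict (thinDomain G ε)) := fun n => (hφ n).memLp _ 2
  have hDφL2 : ∀ n i, MemLp (pderiv i (φ n)) 2 (volume.restrict (thinDomain G ε)) :=
    fun n i => ((hφ n).pderiv i).memLp _ 2
  have hJL2 := fun n => memLp_scaledJet (ε := ε) (hφL2 n) (hDφL2 n)
  have hthin := tendsto_eLpNorm_scaledJet (ε := ε) (fun n => (hφL2 n).sub hvL2)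
    (fun n i => (hDφL2 n i).sub (hDvL2 i)) hlim hDlim
  refine mem_closure_of_tendsto (b := atTop)
    (f := fun n => (memLp_unfoldOp hL hGc hper hε (hJL2 n)).toLp) ?_
    (Eventually.of_forall fun n => ((hφ n).isSliceJet_unfoldOp hper hε.ne').congr
      (MemLp.coeFn_toLp _))
  rw [Lp.tendsto_Lp_iff_tendsto_eLpNorm'']
  have hscaled := ENNReal.Tendsto.const_mul (a := ENNReal.ofReal √(L 0 * L 1 / ε)) hthin
    (Or.inr ENNReal.ofReal_ne_top)
  rw [mul_zero] at hscaled
  refine tendsto_of_tendsto_of_tendsto_of_le_of_le tendsto_const_nhds hscaled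
    (fun _ => zero_le) fun n => ?_
  refine le_of_eq_of_le ?_ (eLpNorm_unfoldOp_le hL hGc hper hε
    ((hJL2 n).sub (memLp_scaledJet hvL2 hDvL2)).1)
  rw [unfoldOp_sub]
  rfl

theorem IsAdmissible.lpNorm_unfoldOp_jet_le {G₁ K : ℝ} (hL : ∀ i, 0 < L i) (hGc : Continuous G)
    (hper : YPeriodic L G) (hε : 0 < ε) (hG₁ : 0 ≤ G₁) (hG : ∀ y, G y ≤ G₁)
    (hv : IsAdmissible G ε v Dv)
    (hK : ∀ i, √ε * lpNorm (Dv i) 2 (volume.restrict (thinDomain G ε)) ≤ K) :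
    lpNorm (Function.uncurry (unfoldOp L ε (jet v fun i => ε • Dv i))) 2
      (volume.restrict (omega ×ˢ cellYstar L G)) ≤ √(L 0 * L 1) * ((2 * G₁ + 3) * K) := by
  have hjet := lpNorm_jet_le hv.1.1.1 fun i => (hv.1.1.2.1 i).const_smul ε
  have hpoincare := hv.lpNorm_le hε.le hG₁ hG
  simp only [lpNorm_const_smul, Fin.sum_univ_three] at hjet
  rw [coe_nnnorm, Real.norm_of_nonneg hε.le] at hjet
  set N : Fin 3 → ℝ := fun i => lpNorm (Dv i) 2 (volume.restrict (thinDomain G ε))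
  have hsum : √ε * (2 * G₁ * N 2 + (N 0 + N 1 + N 2)) ≤ (2 * G₁ + 3) * K := by
    linarith [hK 0, hK 1, hK 2, mul_le_mul_of_nonneg_left (hK 2) hG₁]
  have hscale : √(L 0 * L 1 / ε) * ε = √(L 0 * L 1) * √ε := by
    rw [Real.sqrt_div (mul_pos (hL 0) (hL 1)).le, div_mul_eq_mul_div, mul_div_assoc,
      Real.div_sqrt]
  calc lpNorm (Function.uncurry (unfoldOp L ε (jet v fun i => ε • Dv i))) 2
        (volume.restrict (omega ×ˢ cellYstar L G))
      ≤ √(L 0 * L 1 / ε) * lpNorm (jet v fun i => ε • Dv i) 2 (volume.restrict (thinDomain G ε)) :=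
        lpNorm_unfoldOp_le hL hGc hper hε (memLp_scaledJet hv.1.1.1 hv.1.1.2.1)
    _ ≤ √(L 0 * L 1 / ε) * (ε * (2 * G₁ * N 2 + (N 0 + N 1 + N 2))) := by
        gcongr
        linarith
    _ = √(L 0 * L 1) * (√ε * (2 * G₁ * N 2 + (N 0 + N 1 + N 2))) := by
        rw [← mul_assoc, hscale, mul_assoc]
    _ ≤ √(L 0 * L 1) * ((2 * G₁ + 3) * K) := by gcongr

end UnfoldedJets

/-! ### Vertical integration -/

section Vertical

/-- The point of `ℝ³` with horizontal part `x` and height `t`. -/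
noncomputable def join (x : E 2) (t : ℝ) : E 3 := !₂[x 0, x 1, t]

@[simp] theorem hat_join (x : E 2) (t : ℝ) : hat (join x t) = x := by
  ext i
  fin_cases i <;> simp [hat, join]

/-- The inclusion of the horizontal plane `{x₃ = 0}`. -/
noncomputable def horizontal : E 2 →L[ℝ] E 3 :=
  LinearMap.toContinuousLinearMap
    { toFun x := join x 0
      map_add' x y := by ext i; fin_cases i <;> simp [join]
      map_smul' c x := by ext i; fin_cases i <;> simp [join] }

theorem join_eq (x : E 2) (t : ℝ) :
    join x t = horizontal x + t • EuclideanSpace.single 2 (1 : ℝ) := by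
  ext i
  fin_cases i <;> simp [join, horizontal]

theorem horizontal_single (i : Fin 2) :
    horizontal (EuclideanSpace.single i (1 : ℝ)) = EuclideanSpace.single i.castSucc (1 : ℝ) := by
  ext j
  fin_cases i <;> fin_cases j <;> simp [join, horizontal]

theorem hasFDerivAt_join_left (x : E 2) (t : ℝ) :
    HasFDerivAt (fun x => join x t) horizontal x := by
  simp only [join_eq]
  exact horizontal.hasFDerivAt.add_const _

theorem hasDerivAt_join_right (x : E 2) (t : ℝ) :
    HasDerivAt (join x) (EuclideanSpace.single 2 (1 : ℝ)) t := by
  rw [funext (join_eq x)]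
  simpa using ((hasDerivAt_id t).smul_const _).const_add (horizontal x)

theorem continuous_join_right (x : E 2) : Continuous (join x) :=
  continuous_iff_continuousAt.2 fun t => (hasDerivAt_join_right x t).continuousAt

variable {F : Type*} [NormedAddCommGroup F] {ψ : E 3 → F}

theorem exists_isCompact_height (hc : HasCompactSupport ψ) :
    ∃ K : Set ℝ, IsCompact K ∧ ∀ x, ∀ t ∉ K, ψ (join x t) = 0 :=
  ⟨(fun x : E 3 => x 2) '' tsupport ψ, hc.isCompact.image (by fun_prop), fun _ _ ht =>
    image_eq_zero_of_notMem_tsupport fun h => ht ⟨_, h, by simp [join]⟩⟩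

theorem integrable_join (hψ : Continuous ψ) (hc : HasCompactSupport ψ) (x : E 2) :
    Integrable fun t => ψ (join x t) := by
  obtain ⟨K, hK, hKψ⟩ := exists_isCompact_height hc
  exact (hψ.comp (continuous_join_right x)).integrable_of_hasCompactSupport
    (HasCompactSupport.intro hK (hKψ x))

variable [NormedSpace ℝ F]

/-- The vertical integral `x̂ ↦ ∫ ψ(x̂, t) dt`. -/
noncomputable def vint (ψ : E 3 → F) (x : E 2) : F := ∫ t, ψ (join x t)

theorem hasCompactSupport_fderiv_comp_horizontal (hc : HasCompactSupport ψ) :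
    HasCompactSupport fun z => (fderiv ℝ ψ z).comp horizontal :=
  (hc.fderiv (𝕜 := ℝ)).comp_left (g := fun T : E 3 →L[ℝ] F => T.comp horizontal)
    (ContinuousLinearMap.zero_comp horizontal)

theorem hasFDerivAt_vint (hψ : ContDiff ℝ 1 ψ) (hc : HasCompactSupport ψ) (x : E 2) :
    HasFDerivAt (vint ψ) (vint (fun z => (fderiv ℝ ψ z).comp horizontal) x) x := by
  set Dψ : E 3 → E 2 →L[ℝ] F := fun z => (fderiv ℝ ψ z).comp horizontal
  have hDcont : Continuous Dψ := (hψ.continuous_fderiv one_ne_zero).clm_comp continuous_const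
  have hDc : HasCompactSupport Dψ := hasCompactSupport_fderiv_comp_horizontal hc
  obtain ⟨M, hM⟩ := hDc.exists_bound_of_continuous hDcont
  obtain ⟨K, hK, hKψ⟩ := exists_isCompact_height hDc
  refine hasFDerivAt_integral_of_dominated_of_fderiv_le (𝕜 := ℝ) (F := fun x t => ψ (join x t))
    (F' := fun x t => Dψ (join x t)) (bound := K.indicator fun _ => M) univ_mem
    (Eventually.of_forall fun x => (integrable_join hψ.continuous hc x).1)
    (integrable_join hψ.continuous hc x) (integrable_join hDcont hDc x).1
    (Eventually.of_forall fun t x _ => ?_)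
    ((integrable_indicator_iff hK.measurableSet).2 (integrableOn_const hK.measure_lt_top.ne))
    (Eventually.of_forall fun t x _ => ?_)
  · by_cases ht : t ∈ K
    · rw [Set.indicator_of_mem ht]
      exact hM _
    · rw [Set.indicator_of_notMem ht, hKψ x t ht, norm_zero]
  · exact ((hψ.differentiable one_ne_zero) _).hasFDerivAt.comp x (hasFDerivAt_join_left x t)

theorem contDiff_vint (hψ : ContDiff ℝ ∞ ψ) (hc : HasCompactSupport ψ) :
    ContDiff ℝ ∞ (vint ψ) := by
  refine contDiff_infty.2 fun n => ?_
  induction n generalizing F with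
  | zero =>
    exact contDiff_zero.2 <| continuous_iff_continuousAt.2 fun x =>
      (hasFDerivAt_vint (hψ.of_le (by simp)) hc x).continuousAt
  | succ n ih =>
    have hDψ : ContDiff ℝ ∞ fun z => (fderiv ℝ ψ z).comp horizontal :=
      (hψ.fderiv_right (by simp)).clm_comp contDiff_const
    exact contDiff_succ_iff_hasFDerivAt.2
      ⟨_, ih hDψ (hasCompactSupport_fderiv_comp_horizontal hc),
        hasFDerivAt_vint (hψ.of_le (by simp)) hc⟩

end Vertical

section VerticalTest

variable {F : Type*} [NormedAddCommGroup F] [InnerProductSpace ℝ F]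
  {ψ : E 3 → F} {U : Set (E 3)} {A : Set (E 2)} {a : ℝ}

theorem pderiv_vint (hψ : ContDiff ℝ ∞ ψ) (hc : HasCompactSupport ψ) (i : Fin 2) (x : E 2) :
    pderiv i (vint ψ) x = vint (pderiv i.castSucc ψ) x := by
  have hDψ : Continuous fun z => (fderiv ℝ ψ z).comp horizontal :=
    (hψ.continuous_fderiv (by simp)).clm_comp continuous_const
  rw [pderiv, (hasFDerivAt_vint (hψ.of_le (by simp)) hc x).fderiv, vint,
    ContinuousLinearMap.integral_apply
      (integrable_join hDψ (hasCompactSupport_fderiv_comp_horizontal hc) x)]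
  simp only [ContinuousLinearMap.comp_apply, horizontal_single, vint, pderiv]

theorem IsTest.vint_pderiv_two (hψ : IsTest U ψ) (x : E 2) :
    vint (ThinBingham.pderiv 2 ψ) x = 0 :=
  integral_eq_zero_of_hasDerivAt_of_integrable
    (fun t => ((hψ.1.differentiable (by simp)) _).hasFDerivAt.comp_hasDerivAt t
      (hasDerivAt_join_right x t))
    (integrable_join (hψ.pderiv 2).1.continuous (hψ.pderiv 2).2.1 x)
    (integrable_join hψ.1.continuous hψ.2.1 x)

theorem IsTest.vint (hψ : IsTest U ψ) (hU : U ⊆ hat ⁻¹' A) : IsTest A (vint ψ) := by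
  have hzero : ∀ x, x ∉ hat '' tsupport ψ → ThinBingham.vint ψ x = 0 := fun x hx =>
    integral_eq_zero_of_ae <| Eventually.of_forall fun t =>
      image_eq_zero_of_notMem_tsupport fun h => hx ⟨_, h, hat_join x t⟩
  have hcompact : IsCompact (hat '' tsupport ψ) := hψ.2.1.isCompact.image continuous_hat
  refine ⟨contDiff_vint hψ.1 hψ.2.1, HasCompactSupport.intro hcompact hzero, ?_⟩
  have hsubset : tsupport (ThinBingham.vint ψ) ⊆ hat '' tsupport ψ :=
    closure_minimal (Function.support_subset_iff'.2 hzero) hcompact.isClosed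
  exact hsubset.trans (Set.image_subset_iff.2 (hψ.2.2.trans hU))

theorem integral_smul_comp_hat [CompleteSpace F] {ψ : E 3 → ℝ} (hψ : IsTest U ψ)
    (hU : U ⊆ cylinder A a) {h : E 2 → F} (hh : MemLp h 2 (volume.restrict A)) :
    ∫ x in U, ψ x • h (hat x) = ∫ x in A, vint ψ x • h x := by
  have hint : Integrable fun x => ψ x • h (hat x) :=
    (integrableOn_iff_integrable_of_support_subset (s := U) <|
      Function.support_subset_iff'.2 fun x hx => by simp [hψ.eq_zero hx]).1 <|
        memLp_one_iff_integrable.1 ((memLp_comp_hat hU hh).smul (hψ.memLp _ 2))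
  have hsplit := measurePreserving_splitHomeomorph.symm splitHomeomorph.toMeasurableEquiv
  have hintsplit : Integrable fun p : E 2 × ℝ => ψ (join p.1 p.2) • h (hat (join p.1 p.2)) :=
    hsplit.integrable_comp_of_integrable hint
  calc ∫ x in U, ψ x • h (hat x)
      = ∫ x, ψ x • h (hat x) :=
        setIntegral_eq_integral_of_forall_compl_eq_zero fun x hx => by simp [hψ.eq_zero hx]
    _ = ∫ p : E 2 × ℝ, ψ (join p.1 p.2) • h (hat (join p.1 p.2)) :=
        (hsplit.integral_comp' fun x => ψ x • h (hat x)).symm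
    _ = ∫ x, vint ψ x • h x := by
        rw [Measure.volume_eq_prod, integral_prod _ hintsplit]
        simp only [hat_join, integral_smul_const, ThinBingham.vint]
    _ = ∫ x in A, vint ψ x • h x :=
        (setIntegral_eq_integral_of_forall_compl_eq_zero fun x hx => by
          simp [(hψ.vint fun _ hx => (hU hx).1).eq_zero hx]).symm

theorem IsH1.comp_hat [CompleteSpace F] (hU : U ⊆ cylinder A a) {q : E 2 → F}
    {Dq : Fin 2 → E 2 → F} (hq : IsH1 A q Dq) :
    IsH1 U (fun x => q (hat x)) (Fin.snoc (fun i x => Dq i (hat x)) 0) := by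
  refine ⟨memLp_comp_hat hU hq.1, fun j => ?_, fun j φ hφ => ?_⟩
  · refine Fin.lastCases ?_ (fun i => ?_) j
    · rw [Fin.snoc_last]
      exact MemLp.zero
    · rw [Fin.snoc_castSucc]
      exact memLp_comp_hat hU (hq.2.1 i)
  · rw [integral_smul_comp_hat (hφ.pderiv j) hU hq.1]
    refine Fin.lastCases ?_ (fun i => ?_) j
    · simp only [hφ.vint_pderiv_two, show Fin.last 2 = 2 from rfl]
      simp [Fin.snoc]
    · simp only [Fin.snoc_castSucc]
      rw [integral_smul_comp_hat hφ hU (hq.2.1 i),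
        ← hq.2.2 i _ (hφ.vint fun _ hx => (hU hx).1)]
      simp only [pderiv_vint hφ.1 hφ.2.1]

end VerticalTest

/-! ### Orthogonality of solenoidal fields and gradients -/

section Orthogonality

variable {d : ℕ} {U : Set (E d)}

theorem IsTest.coord {φ : E d → E d} (hφ : IsTest U φ) (i : Fin d) : IsTest U fun x => φ x i :=
  ⟨contDiff_euclidean.1 hφ.1 i, hφ.2.1.comp_left (g := fun v : E d => v i) rfl,
    (tsupport_comp_subset (g := fun v : E d => v i) rfl φ).trans hφ.2.2⟩

theorem pderiv_coord {φ : E d → E d} (hφ : ContDiff ℝ ∞ φ) (i j : Fin d) (x : E d) :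
    pderiv j (fun x => φ x i) x = pderiv j φ x i := by
  have h := (EuclideanSpace.proj i : E d →L[ℝ] ℝ).hasFDerivAt.comp x
    (hφ.differentiable (by simp) x).hasFDerivAt
  exact congrArg (· (EuclideanSpace.single j 1)) h.fderiv

/-- The bilinear map `(v, c) ↦ vᵢ c`. -/
noncomputable def coordMul (i : Fin d) : E d →L[ℝ] ℝ →L[ℝ] ℝ :=
  (ContinuousLinearMap.mul ℝ ℝ).comp (EuclideanSpace.proj i)

@[simp] theorem coordMul_apply (i : Fin d) (v : E d) (c : ℝ) : coordMul i v c = v i * c := rfl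

theorem norm_coordMul_le (i : Fin d) : ‖coordMul i‖ ≤ 1 := by
  refine ContinuousLinearMap.opNorm_le_bound₂ _ zero_le_one fun v c => ?_
  rw [coordMul_apply, norm_mul, one_mul]
  gcongr
  exact PiLp.norm_apply_le v i

theorem integrable_coord_mul {α : Type*} [MeasurableSpace α] {ν : Measure α}
    {v : α → E d} {c : α → ℝ} (hv : MemLp v 2 ν) (hc : MemLp c 2 ν) (i : Fin d) :
    Integrable (fun x => v x i * c x) ν :=
  integrable_bilin (coordMul i) hv hc

theorem abs_integral_coord_mul_le {α : Type*} [MeasurableSpace α] {ν : Measure α}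
    {v : α → E d} {c : α → ℝ} (hv : MemLp v 2 ν) (hc : MemLp c 2 ν) (i : Fin d) :
    |∫ x, v x i * c x ∂ν| ≤ lpNorm v 2 ν * lpNorm c 2 ν := by
  refine (norm_integral_bilin_le (coordMul i) hv hc).trans ?_
  rw [mul_assoc]
  exact mul_le_of_le_one_left (mul_nonneg lpNorm_nonneg lpNorm_nonneg) (norm_coordMul_le i)

theorem IsH10.integral_sum_coord_mul_eq_neg {v : E d → E d} {Dv : Fin d → E d → E d}
    (hv : IsH10 U v Dv) {q : E d → ℝ} {Dq : Fin d → E d → ℝ} (hq : IsH1 U q Dq) :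
    ∫ x in U, ∑ j, v x j * Dq j x = - ∫ x in U, divg Dv x * q x := by
  obtain ⟨hv1, φ, hφ, hlim⟩ := hv
  have hleft : Tendsto (fun n => ∑ j, ∫ x in U, φ n x j * Dq j x) atTop
      (𝓝 (∑ j, ∫ x in U, v x j * Dq j x)) :=
    tendsto_finsetSum _ fun j _ => tendsto_integral_bilin (coordMul j)
      (fun n => (hφ n).1.continuous.aestronglyMeasurable) hv1.1 (hq.2.1 j) hlim.1
  have hright : Tendsto (fun n => ∑ j, ∫ x in U, pderiv j (φ n) x j * q x) atTop
      (𝓝 (∑ j, ∫ x in U, Dv j x j * q x)) :=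
    tendsto_finsetSum _ fun j _ => tendsto_integral_bilin (coordMul j)
      (fun n => ((hφ n).pderiv j).1.continuous.aestronglyMeasurable) (hv1.2.1 j) hq.1 (hlim.2 j)
  have hparts : ∀ n, ∑ j, ∫ x in U, φ n x j * Dq j x =
      - ∑ j, ∫ x in U, pderiv j (φ n) x j * q x := fun n => by
    rw [← Finset.sum_neg_distrib]
    refine Finset.sum_congr rfl fun j _ => ?_
    have h := hq.2.2 j _ ((hφ n).coord j)
    simp only [smul_eq_mul, pderiv_coord (hφ n).1] at h
    rw [h, neg_neg]
  simp only [divg, Finset.sum_mul]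
  rw [integral_finsetSum _ fun j _ => integrable_coord_mul hv1.1 (hq.2.1 j) j,
    integral_finsetSum _ fun j _ => integrable_coord_mul (hv1.2.1 j) hq.1 j]
  exact tendsto_nhds_unique hleft (hright.neg.congr fun n => (hparts n).symm)

theorem IsTest.coord_mul {ψ : E d → ℝ} (hψ : IsTest U ψ) (k : Fin d) :
    IsTest U fun x => x k * ψ x :=
  ⟨ContDiff.mul (by fun_prop) hψ.1, hψ.2.1.mul_left, tsupport_mul_subset_right.trans hψ.2.2⟩

theorem pderiv_coord_mul {ψ : E d → ℝ} (hψ : ContDiff ℝ ∞ ψ) (j k : Fin d) (x : E d) :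
    pderiv j (fun x => x k * ψ x) x = x k * pderiv j ψ x + if j = k then ψ x else 0 := by
  have hproj : DifferentiableAt ℝ (fun x : E d => x k) x := by fun_prop
  have h := pderiv_proj j k x
  simp only [pderiv] at h ⊢
  rw [fderiv_fun_mul hproj (hψ.differentiable (by simp) x)]
  simp [h]

variable {F : Type*} [NormedAddCommGroup F] [InnerProductSpace ℝ F] {k : Fin d} {a : ℝ}

theorem norm_coord_smul_ae_le (hUm : MeasurableSet U) (hU : ∀ x ∈ U, |x k| ≤ a) (v : E d → F) :
    ∀ᵐ x ∂(volume.restrict U), ‖x k • v x‖ ≤ a * ‖v x‖ := by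
  filter_upwards [ae_restrict_mem hUm] with x hx
  rw [norm_smul]
  exact mul_le_mul_of_nonneg_right (hU x hx) (norm_nonneg _)

theorem IsL2.coord_smul (hUm : MeasurableSet U) (hU : ∀ x ∈ U, |x k| ≤ a) {v : E d → F}
    (hv : IsL2 U v) : IsL2 U fun x => x k • v x :=
  have hcoord : Continuous fun x : E d => x k := by fun_prop
  MemLp.of_le_mul hv (hcoord.aestronglyMeasurable.smul hv.1) (norm_coord_smul_ae_le hUm hU v)

theorem lpNorm_coord_smul_le (ha : 0 ≤ a) (hUm : MeasurableSet U) (hU : ∀ x ∈ U, |x k| ≤ a)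
    {v : E d → F} (hv : IsL2 U v) :
    lpNorm (fun x => x k • v x) 2 (volume.restrict U) ≤ a * lpNorm v 2 (volume.restrict U) :=
  lpNorm_le_mul_lpNorm_of_ae_le_mul ha (hv.coord_smul hUm hU).1 hv
    (norm_coord_smul_ae_le hUm hU v)

theorem IsH1.coord_smul (hUm : MeasurableSet U) (hU : ∀ x ∈ U, |x k| ≤ a) {v : E d → F}
    {Dv : Fin d → E d → F} (hv : IsH1 U v Dv) :
    IsH1 U (fun x => x k • v x) (fun j x => x k • Dv j x + if j = k then v x else 0) := by
  have hite : ∀ j, IsL2 U fun x => if j = k then v x else 0 := fun j => by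
    split_ifs
    · exact hv.1
    · exact MemLp.zero
  have hDv : ∀ j, IsL2 U fun x => x k • Dv j x := fun j => (hv.2.1 j).coord_smul hUm hU
  refine ⟨hv.1.coord_smul hUm hU, fun j => (hDv j).add (hite j), fun j ψ hψ => ?_⟩
  have hint : ∀ {φ : E d → ℝ} {w : E d → F}, IsTest U φ → IsL2 U w →
      Integrable (fun x => φ x • w x) (volume.restrict U) := fun hφ hw =>
    memLp_one_iff_integrable.1 (hw.smul (hφ.memLp _ 2))
  have hsplit : ∀ x, pderiv j ψ x • x k • v x = pderiv j (fun x => x k * ψ x) x • v x -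
      ψ x • if j = k then v x else 0 := fun x => by
    rw [pderiv_coord_mul hψ.1]
    split_ifs <;> module
  have hjoin : ∀ x, (x k * ψ x) • Dv j x = ψ x • x k • Dv j x := fun x => by module
  simp only [hsplit, smul_add]
  rw [integral_sub (hint ((hψ.coord_mul k).pderiv j) hv.1) (hint hψ (hite j)),
    integral_add (hint hψ (hDv j)) (hint hψ (hite j)), hv.2.2 j _ (hψ.coord_mul k)]
  simp only [hjoin, neg_add, sub_eq_add_neg]

end Orthogonality

section Flux

variable {G : E 2 → ℝ} {G₁ ε : ℝ} {v : E 3 → E 3} {Dv : Fin 3 → E 3 → E 3}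
  {q : E 2 → ℝ} {Dq : Fin 2 → E 2 → ℝ}

theorem IsAdmissible.integral_sum_coord_mul_eq_zero (hv : IsAdmissible G ε v Dv)
    {p : E 3 → ℝ} {Dp : Fin 3 → E 3 → ℝ} (hp : IsH1 (thinDomain G ε) p Dp) :
    ∫ x in thinDomain G ε, ∑ j, v x j * Dp j x = 0 := by
  rw [hv.1.integral_sum_coord_mul_eq_neg hp, neg_eq_zero]
  refine integral_eq_zero_of_ae ?_
  filter_upwards [hv.2] with x hx
  rw [hx, zero_mul, Pi.zero_apply]

theorem IsAdmissible.integral_horizontal_eq_zero (hε : 0 ≤ ε) (hG : ∀ y, G y ≤ G₁)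
    (hv : IsAdmissible G ε v Dv) (hq : IsH1 omega q Dq) :
    ∑ i : Fin 2, ∫ x in thinDomain G ε, v x i.castSucc * Dq i (hat x) = 0 := by
  have hcyl := thinDomain_subset_cylinder hε hG
  rw [← integral_finsetSum _ fun i _ => integrable_coord_mul hv.1.1.1
    (memLp_comp_hat hcyl (hq.2.1 i)) i.castSucc,
    ← hv.integral_sum_coord_mul_eq_zero (hq.comp_hat hcyl)]
  simp only [Fin.sum_univ_castSucc (n := 2), Fin.snoc_castSucc, Fin.snoc_last, Pi.zero_apply,
    mul_zero, add_zero]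

theorem IsAdmissible.integral_vertical_eq_neg (hGc : Continuous G) (hε : 0 ≤ ε)
    (hG : ∀ y, G y ≤ G₁) (hv : IsAdmissible G ε v Dv) (hq : IsH1 omega q Dq) :
    ∫ x in thinDomain G ε, v x 2 * q (hat x) =
      - ∑ i : Fin 2, ∫ x in thinDomain G ε, v x i.castSucc * (x 2 • Dq i (hat x)) := by
  have hcyl := thinDomain_subset_cylinder hε hG
  have hmeas := (isOpen_thinDomain hGc ε).measurableSet
  have hheight : ∀ x ∈ thinDomain G ε, |x 2| ≤ ε * G₁ := abs_height_le hε hG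
  have hp := (hq.comp_hat hcyl).coord_smul (k := 2) hmeas hheight
  have h := hv.integral_sum_coord_mul_eq_zero hp
  rw [integral_finsetSum _ fun i _ => integrable_coord_mul hv.1.1.1 (hp.2.1 i) i,
    Fin.sum_univ_castSucc (n := 2)] at h
  have hne : ∀ i : Fin 2, i.castSucc ≠ 2 := by decide
  simp only [Fin.snoc_castSucc, Fin.snoc_last, Pi.zero_apply, smul_zero, zero_add, hne, if_false,
    add_zero] at h
  exact eq_neg_of_add_eq_zero_right h

theorem IsAdmissible.abs_integral_vertical_le (hGc : Continuous G) (hε : 0 ≤ ε) (hG₁ : 0 ≤ G₁)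
    (hG : ∀ y, G y ≤ G₁) (hv : IsAdmissible G ε v Dv) (hq : IsH1 omega q Dq) :
    |∫ x in thinDomain G ε, v x 2 * q (hat x)| ≤
      ∑ i, lpNorm v 2 (volume.restrict (thinDomain G ε)) *
        (ε * G₁ * (√(ε * G₁) * lpNorm (Dq i) 2 (volume.restrict omega))) := by
  have hcyl := thinDomain_subset_cylinder hε hG
  have hmeas := (isOpen_thinDomain hGc ε).measurableSet
  have hheight : ∀ x ∈ thinDomain G ε, |x 2| ≤ ε * G₁ := abs_height_le hε hG
  rw [hv.integral_vertical_eq_neg hGc hε hG hq, abs_neg]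
  refine (Finset.abs_sum_le_sum_abs _ _).trans (Finset.sum_le_sum fun i _ => ?_)
  have hDq := memLp_comp_hat hcyl (hq.2.1 i)
  have hxDq := IsL2.coord_smul (k := 2) hmeas hheight hDq
  refine (abs_integral_coord_mul_le hv.1.1.1 hxDq _).trans ?_
  gcongr
  · exact lpNorm_nonneg
  · refine (lpNorm_coord_smul_le (by positivity) hmeas hheight hDq).trans ?_
    gcongr
    exact lpNorm_comp_hat_le hcyl (hq.2.1 i)

end Flux

/-! ### Averages of unfolded sequences -/

section Product

variable {F : Type*} [NormedAddCommGroup F] {A : Set (E 2)} {Z : Set (E 3)} {h : E 2 → F}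

theorem memLp_comp_fst (hZ : volume Z ≠ ⊤) {p : ℝ≥0∞} (hh : MemLp h p (volume.restrict A)) :
    MemLp (fun q : E 2 × E 3 => h q.1) p (volume.restrict (A ×ˢ Z)) := by
  rw [restrict_prod_eq]
  refine MemLp.comp_of_map (f := Prod.fst) ?_ measurable_fst.aemeasurable
  rw [Measure.map_fst_prod]
  exact hh.smul_measure (by simpa using hZ)

theorem lpNorm_comp_fst (hh : AEStronglyMeasurable h (volume.restrict A)) :
    lpNorm (fun q : E 2 × E 3 => h q.1) 2 (volume.restrict (A ×ˢ Z)) =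
      √(volume.real Z) * lpNorm h 2 (volume.restrict A) := by
  have hmap : AEStronglyMeasurable h
      (Measure.map Prod.fst ((volume.restrict A).prod (volume.restrict Z))) := by
    rw [Measure.map_fst_prod]
    exact hh.smul_measure _
  have hcomp := eLpNorm_map_measure (p := 2) hmap measurable_fst.aemeasurable
  rw [Measure.map_fst_prod, eLpNorm_smul_measure_of_ne_top (by norm_num),
    Measure.restrict_apply_univ] at hcomp
  have hfst : AEStronglyMeasurable (fun q : E 2 × E 3 => h q.1) (volume.restrict (A ×ˢ Z)) := by
    rw [restrict_prod_eq]
    exact hmap.comp_aemeasurable measurable_fst.aemeasurable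
  rw [← toReal_eLpNorm hfst, ← toReal_eLpNorm hh, restrict_prod_eq]
  refine (congrArg ENNReal.toReal hcomp.symm).trans ?_
  rw [smul_eq_mul, ENNReal.toReal_mul, ← ENNReal.toReal_rpow, Real.sqrt_eq_rpow]
  norm_num [measureReal_def]

end Product

section Average

variable {L : Fin 2 → ℝ} {G : E 2 → ℝ} {G₁ ε : ℝ}

theorem volume_cellYstar_ne_top (hG : ∀ y, G y ≤ G₁) : volume (cellYstar L G) ≠ ⊤ := by
  have hcellY : volume (cellY L) ≠ ⊤ := by
    rw [cellY, volume_setOf_forall_mem fun i => Set.Ioo 0 (L i)]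
    exact (ENNReal.prod_lt_top fun i _ => by simp).ne
  exact ((volume_le_of_subset_cylinder (cellYstar_subset_cylinder hG)).trans_lt
    (by finiteness)).ne

theorem isFiniteMeasure_restrict_prod (hG : ∀ y, G y ≤ G₁) :
    IsFiniteMeasure ((volume : Measure (E 2 × E 3)).restrict (omega ×ˢ cellYstar L G)) := by
  refine ⟨?_⟩
  rw [Measure.restrict_apply_univ, Measure.volume_eq_prod, Measure.prod_prod, volume_omega,
    one_mul]
  exact (volume_cellYstar_ne_top hG).lt_top

theorem thinDomain_diff_innerDomain_subset_cylinder (hε : 0 ≤ ε) (hG : ∀ y, G y ≤ G₁) :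
    thinDomain G ε \ innerDomain L G ε ⊆ cylinder (omega \ openCells L ε) (ε * G₁) :=
  fun _ hx => ⟨⟨hx.1.1, fun h => hx.2 ⟨hx.1, h⟩⟩, (thinDomain_subset_cylinder hε hG hx.1).2⟩

theorem dist_hat_cellMap_le (hL : ∀ i, 0 < L i) (hε : 0 < ε) {x : E 2} {y : E 3}
    (hx : x ∈ omegaEps L ε) (hy : hat y ∈ cellY L) :
    dist (hat (cellMap L ε (cellIndex L ε x) y)) x ≤ ε * √(L 0 ^ 2 + L 1 ^ 2) := by
  rw [omegaEps_eq hL hε] at hx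
  obtain ⟨-, hxcell⟩ := cellIndex_mem hL hε hx
  have hycell := (hat_cellMap_mem_epsCell hε (k := cellIndex L ε x)).2 hy
  have hside : ∀ i, |hat (cellMap L ε (cellIndex L ε x) y) i - x i| ≤ ε * L i := fun i => by
    rw [abs_le]
    constructor <;> linarith [(hxcell i).1, (hxcell i).2, (hycell i).1, (hycell i).2]
  have hsq : ∀ i, dist (hat (cellMap L ε (cellIndex L ε x) y) i) (x i) ^ 2 ≤ ε ^ 2 * L i ^ 2 :=
    fun i => mul_pow ε (L i) 2 ▸ pow_le_pow_left₀ dist_nonneg (hside i) 2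
  calc dist (hat (cellMap L ε (cellIndex L ε x) y)) x
      ≤ √(ε ^ 2 * (L 0 ^ 2 + L 1 ^ 2)) := by
        rw [EuclideanSpace.dist_eq, Fin.sum_univ_two, mul_add]
        exact Real.sqrt_le_sqrt (add_le_add (hsq 0) (hsq 1))
    _ = ε * √(L 0 ^ 2 + L 1 ^ 2) := by rw [Real.sqrt_mul (sq_nonneg ε), Real.sqrt_sq hε.le]

variable {F : Type*} [NormedAddCommGroup F] {h : E 2 → F}

theorem eventually_norm_unfoldOp_comp_hat_sub_le (hL : ∀ i, 0 < L i) (hh : UniformContinuous h)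
    {δ : ℝ} (hδ : 0 < δ) :
    ∀ᶠ ε in 𝓝[>] 0, ∀ x, ∀ y ∈ cellYstar L G,
      ‖unfoldOp L ε (fun z => h (hat z)) x y - (omegaEps L ε).indicator h x‖ ≤ δ := by
  obtain ⟨r, hr, hdist⟩ := Metric.uniformContinuous_iff.1 hh δ hδ
  have hsmall : ∀ᶠ ε in 𝓝[>] (0 : ℝ), ε * √(L 0 ^ 2 + L 1 ^ 2) < r :=
    ((Continuous.tendsto' (by fun_prop) 0 0 (by simp)).mono_left
      nhdsWithin_le_nhds).eventually (gt_mem_nhds hr)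
  filter_upwards [hsmall, self_mem_nhdsWithin] with ε hεr hε x y hy
  by_cases hx : x ∈ omegaEps L ε
  · rw [unfoldOp_of_mem _ hx, Set.indicator_of_mem hx, ← dist_eq_norm]
    exact (hdist ((dist_hat_cellMap_le hL hε hx hy.1).trans_lt hεr)).le
  · simpa [unfoldOp_of_notMem _ hx, Set.indicator_of_notMem hx] using hδ.le

/-- The defect `T_ε(h) - 1_{ω^ε} h` in unfolding a function `h` of the horizontal variable. -/
noncomputable def unfoldDefect (L : Fin 2 → ℝ) (ε : ℝ) (h : E 2 → F) (p : E 2 × E 3) : F :=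
  unfoldOp L ε (fun z => h (hat z)) p.1 p.2 - (omegaEps L ε).indicator h p.1

theorem memLp_unfoldDefect (hL : ∀ i, 0 < L i) (hGc : Continuous G) (hper : YPeriodic L G)
    (hε : 0 < ε) (hG : ∀ y, G y ≤ G₁) {p : ℝ≥0∞} (hh : MemLp h p (volume.restrict omega)) :
    MemLp (unfoldDefect L ε h) p (volume.restrict (omega ×ˢ cellYstar L G)) :=
  (memLp_unfoldOp hL hGc hper hε
    (memLp_comp_hat (thinDomain_subset_cylinder hε.le hG) hh)).sub
    (memLp_comp_fst (volume_cellYstar_ne_top hG) (hh.indicator isOpen_interior.measurableSet))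

theorem lpNorm_unfoldDefect_le (hL : ∀ i, 0 < L i) (hGc : Continuous G) (hper : YPeriodic L G)
    (hε : 0 < ε) (hG : ∀ y, G y ≤ G₁) (hh : MemLp h 2 (volume.restrict omega)) :
    lpNorm (unfoldDefect L ε h) 2 (volume.restrict (omega ×ˢ cellYstar L G)) ≤
      (√(L 0 * L 1 * G₁) + √(volume.real (cellYstar L G))) *
        lpNorm h 2 (volume.restrict omega) := by
  have hL0 := hL 0
  have hL1 := hL 1
  have hcyl := thinDomain_subset_cylinder hε.le hG
  have hcomp := memLp_comp_hat hcyl hh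
  have hind := hh.indicator (s := omegaEps L ε) isOpen_interior.measurableSet
  have hunfold : lpNorm (Function.uncurry (unfoldOp L ε fun z => h (hat z))) 2
      (volume.restrict (omega ×ˢ cellYstar L G)) ≤
      √(L 0 * L 1 * G₁) * lpNorm h 2 (volume.restrict omega) := by
    calc _ ≤ √(L 0 * L 1 / ε) * (√(ε * G₁) * lpNorm h 2 (volume.restrict omega)) :=
          (lpNorm_unfoldOp_le hL hGc hper hε hcomp).trans
            (mul_le_mul_of_nonneg_left (lpNorm_comp_hat_le hcyl hh) (Real.sqrt_nonneg _))
      _ = _ := by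
          rw [← mul_assoc, ← Real.sqrt_mul (by positivity), div_mul_eq_mul_div,
            mul_left_comm, mul_div_cancel_left₀ _ hε.ne']
  have hindicator : lpNorm (fun p : E 2 × E 3 => (omegaEps L ε).indicator h p.1) 2
      (volume.restrict (omega ×ˢ cellYstar L G)) ≤
      √(volume.real (cellYstar L G)) * lpNorm h 2 (volume.restrict omega) := by
    rw [lpNorm_comp_fst hind.1]
    gcongr
    simpa only [one_mul] using lpNorm_le_mul_lpNorm_of_ae_le_mul zero_le_one hind.1 hh
      (.of_forall fun x => (norm_indicator_le_norm_self _ _).trans_eq (one_mul _).symm)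
  rw [add_mul]
  exact (lpNorm_sub_le (memLp_unfoldOp hL hGc hper hε hcomp) one_le_two).trans
    (add_le_add hunfold hindicator)

theorem tendsto_lpNorm_unfoldDefect_of_uniformContinuous (hL : ∀ i, 0 < L i) (hGc : Continuous G)
    (hper : YPeriodic L G) (hG : ∀ y, G y ≤ G₁) (huc : UniformContinuous h)
    (hh : MemLp h 2 (volume.restrict omega)) :
    Tendsto (fun ε => lpNorm (unfoldDefect L ε h) 2 (volume.restrict (omega ×ˢ cellYstar L G)))
      (𝓝[>] 0) (𝓝 0) := by
  have hfin := isFiniteMeasure_restrict_prod (L := L) hG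
  set N := lpNorm (fun _ : E 2 × E 3 => (1 : ℝ)) 2 (volume.restrict (omega ×ˢ cellYstar L G))
  have hN : 0 ≤ N := lpNorm_nonneg
  rw [Metric.tendsto_nhds]
  intro η hη
  have hδ : 0 < η / (N + 1) := by positivity
  filter_upwards [eventually_norm_unfoldOp_comp_hat_sub_le (G := G) hL huc hδ,
    self_mem_nhdsWithin] with ε hclose hε
  have hle : lpNorm (unfoldDefect L ε h) 2 (volume.restrict (omega ×ˢ cellYstar L G)) ≤
      η / (N + 1) * N := by
    refine lpNorm_le_mul_lpNorm_of_ae_le_mul hδ.le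
      (memLp_unfoldDefect hL hGc hper hε hG hh).1 (memLp_const _) ?_
    filter_upwards [ae_restrict_mem (isOpen_omega.measurableSet.prod
      (isOpen_cellYstar hGc L).measurableSet)] with p hp
    simpa [unfoldDefect] using hclose p.1 p.2 hp.2
  rw [Real.dist_0_eq_abs, abs_of_nonneg lpNorm_nonneg]
  refine hle.trans_lt ?_
  rw [div_mul_eq_mul_div, div_lt_iff₀ (by positivity)]
  nlinarith

theorem tendsto_lpNorm_unfoldDefect [NormedSpace ℝ F] (hL : ∀ i, 0 < L i) (hGc : Continuous G)
    (hper : YPeriodic L G) (hG : ∀ y, G y ≤ G₁) (hh : MemLp h 2 (volume.restrict omega)) :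
    Tendsto (fun ε => lpNorm (unfoldDefect L ε h) 2 (volume.restrict (omega ×ˢ cellYstar L G)))
      (𝓝[>] 0) (𝓝 0) := by
  have hreg : ((volume : Measure (E 2)).restrict omega).Regular :=
    Measure.Regular.restrict_of_measure_ne_top (by simp [volume_omega])
  set K := √(L 0 * L 1 * G₁) + √(volume.real (cellYstar L G))
  have hK : 0 ≤ K := by positivity
  rw [Metric.tendsto_nhds]
  intro η hη
  have hδ : 0 < η / (2 * (K + 1)) := by positivity
  obtain ⟨k, hksupp, hkclose, hkcont, hk⟩ := hh.exists_hasCompactSupport_eLpNorm_sub_le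
    (by norm_num) (ENNReal.ofReal_pos.2 hδ).ne'
  have hclose : lpNorm (h - k) 2 (volume.restrict omega) ≤ η / (2 * (K + 1)) := by
    rw [← toReal_eLpNorm (hh.sub hk).1]
    exact ENNReal.toReal_le_of_le_ofReal hδ.le hkclose
  have huc := hkcont.uniformContinuous_of_tendsto_cocompact hksupp.is_zero_at_infty
  filter_upwards [(tendsto_lpNorm_unfoldDefect_of_uniformContinuous hL hGc hper hG huc
    hk).eventually (gt_mem_nhds (half_pos hη)), self_mem_nhdsWithin] with ε hkε hε
  have hsplit : unfoldDefect L ε h = unfoldDefect L ε k + unfoldDefect L ε (h - k) := by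
    ext p
    have hsub := congrFun₂ (unfoldOp_sub (L := L) (ε := ε) (fun z => h (hat z))
      fun z => k (hat z)) p.1 p.2
    simp only [Pi.sub_apply] at hsub
    simp only [unfoldDefect, Pi.add_apply, Set.indicator_sub', Pi.sub_apply]
    rw [show unfoldOp L ε (fun z => h (hat z) - k (hat z)) p.1 p.2 = _ from hsub]
    abel
  have hrest : lpNorm (unfoldDefect L ε (h - k)) 2
      (volume.restrict (omega ×ˢ cellYstar L G)) ≤ η / 2 := by
    calc _ ≤ K * (η / (2 * (K + 1))) :=
          (lpNorm_unfoldDefect_le hL hGc hper hε hG (hh.sub hk)).trans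
            (mul_le_mul_of_nonneg_left hclose hK)
      _ ≤ η / 2 := by
          rw [mul_div_assoc', div_le_div_iff₀ (by positivity) two_pos]
          nlinarith
  rw [Real.dist_0_eq_abs, abs_of_nonneg lpNorm_nonneg, hsplit]
  linarith [lpNorm_add_le (g := unfoldDefect L ε (h - k))
    (memLp_unfoldDefect hL hGc hper hε hG hk) one_le_two]

end Average

theorem WeakTendstoL2.tendsto_integral_coord_mul {A : Set (E 2)} {Z : Set (E 3)}
    {un : ℕ → E 2 → E 3 → E 3} {u : E 2 → E 3 → E 3} (hu : WeakTendstoL2 A Z un u)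
    {c : E 2 × E 3 → ℝ} (hc : MemLp c 2 (volume.restrict (A ×ˢ Z))) (j : Fin 3) :
    Tendsto (fun n => ∫ p in A ×ˢ Z, un n p.1 p.2 j * c p) atTop
      (𝓝 (∫ p in A ×ˢ Z, u p.1 p.2 j * c p)) := by
  have hw : IsL2Prod A Z fun x y => EuclideanSpace.single j (c (x, y)) :=
    memLp_piLp_single hc j
  simpa only [innerL2, EuclideanSpace.inner_single_right, conj_trivial, mul_comm (c _)] using
    hu.2.2 _ hw

section Concentration

variable {α F : Type*} [MeasurableSpace α] {ν : Measure α} [NormedAddCommGroup F] {f : α → F}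
  {p : ℝ≥0∞}

theorem lpNorm_mono_measure {ρ : Measure α} (hf : MemLp f p ν) (hρ : ρ ≤ ν) :
    lpNorm f p ρ ≤ lpNorm f p ν := by
  rw [← toReal_eLpNorm hf.1, ← toReal_eLpNorm (hf.mono_measure hρ).1]
  exact ENNReal.toReal_mono hf.2.ne (eLpNorm_mono_measure f hρ)

theorem tendsto_lpNorm_restrict_of_tendsto_measure {ι : Type*} {l : Filter ι} (hp : 1 ≤ p)
    (hp' : p ≠ ⊤) (hf : MemLp f p ν) {s : ι → Set α} (hs : ∀ i, MeasurableSet (s i))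
    (h : Tendsto (fun i => ν (s i)) l (𝓝 0)) :
    Tendsto (fun i => lpNorm f p (ν.restrict (s i))) l (𝓝 0) := by
  rw [Metric.tendsto_nhds]
  intro η hη
  obtain ⟨δ, hδ, hsmall⟩ := hf.eLpNorm_indicator_le hp hp' (half_pos hη)
  filter_upwards [h.eventually (Iic_mem_nhds (ENNReal.ofReal_pos.2 hδ))] with i hi
  have hle := hsmall (s i) (hs i) hi
  rw [eLpNorm_indicator_eq_eLpNorm_restrict (hs i)] at hle
  rw [Real.dist_0_eq_abs, abs_of_nonneg lpNorm_nonneg, ← toReal_eLpNorm hf.1.restrict]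
  exact (ENNReal.toReal_le_of_le_ofReal (half_pos hη).le hle).trans_lt (half_lt_self hη)

end Concentration

section Average

variable {L : Fin 2 → ℝ} {G : E 2 → ℝ} {G₁ K : ℝ} {h : E 2 → ℝ}

theorem inv_mul_integral_innerDomain {ε : ℝ} (hL : ∀ i, 0 < L i) (hGc : Continuous G)
    (hper : YPeriodic L G) (hε : 0 < ε) (hG : ∀ y, G y ≤ G₁) {v : E 3 → E 3}
    (hv : IsL2 (thinDomain G ε) v) (hh : IsL2 omega h) (j : Fin 3) :
    ε⁻¹ * ∫ x in innerDomain L G ε, v x j * h (hat x) =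
      (L 0 * L 1)⁻¹ * ((∫ p in omega ×ˢ cellYstar L G, unfoldOp L ε v p.1 p.2 j * h p.1) +
        ∫ p in omega ×ˢ cellYstar L G, unfoldOp L ε v p.1 p.2 j * unfoldDefect L ε h p) := by
  have hL0 := (hL 0).ne'
  have hL1 := (hL 1).ne'
  have hTv := memLp_unfoldOp hL hGc hper hε hv
  have hcomp := memLp_comp_hat (thinDomain_subset_cylinder hε.le hG) hh
  have hprod : ∀ x y, unfoldOp L ε (fun z => v z j * h (hat z)) x y =
      unfoldOp L ε v x y j * h x + unfoldOp L ε v x y j * unfoldDefect L ε h (x, y) := by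
    intro x y
    rw [unfoldDefect]
    by_cases hx : x ∈ omegaEps L ε
    · simp only [unfoldOp_of_mem _ hx, Set.indicator_of_mem hx, Function.comp_apply]
      ring
    · simp [unfoldOp_of_notMem _ hx]
  have hcov := integral_unfoldOp hL hGc hper hε (integrable_coord_mul hv hcomp j).1
  have hadd := integral_add
    (integrable_coord_mul hTv (memLp_comp_fst (volume_cellYstar_ne_top hG) hh) j)
    (integrable_coord_mul hTv (memLp_unfoldDefect hL hGc hper hε hG hh) j)
  simp only [hprod, smul_eq_mul] at hcov
  simp only [Function.uncurry, hcov] at hadd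
  rw [← hadd]
  field_simp

variable {ε : ℕ → ℝ} {v : ℕ → E 3 → E 3}

theorem tendsto_integral_coord_mul_unfoldDefect (hL : ∀ i, 0 < L i) (hGc : Continuous G)
    (hper : YPeriodic L G) (hG : ∀ y, G y ≤ G₁) (hε : ∀ n, 0 < ε n) (hlim : Tendsto ε atTop (𝓝 0))
    (hv : ∀ n, IsL2 (thinDomain G (ε n)) (v n))
    (hvK : ∀ n, lpNorm (v n) 2 (volume.restrict (thinDomain G (ε n))) ≤ √(ε n) * K)
    (hh : IsL2 omega h) (j : Fin 3) :
    Tendsto (fun n => ∫ p in omega ×ˢ cellYstar L G,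
      unfoldOp L (ε n) (v n) p.1 p.2 j * unfoldDefect L (ε n) h p) atTop (𝓝 0) := by
  have hlim' : Tendsto ε atTop (𝓝[>] 0) :=
    tendsto_nhdsWithin_iff.2 ⟨hlim, .of_forall hε⟩
  have hdefect := ((tendsto_lpNorm_unfoldDefect hL hGc hper hG hh).comp hlim').const_mul
    (√(L 0 * L 1) * K)
  rw [mul_zero] at hdefect
  refine squeeze_zero_norm (fun n => ?_) hdefect
  have hLpos : 0 < L 0 * L 1 := mul_pos (hL 0) (hL 1)
  have hunfold : lpNorm (Function.uncurry (unfoldOp L (ε n) (v n))) 2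
      (volume.restrict (omega ×ˢ cellYstar L G)) ≤ √(L 0 * L 1) * K :=
    calc _ ≤ √(L 0 * L 1 / ε n) * (√(ε n) * K) :=
          (lpNorm_unfoldOp_le hL hGc hper (hε n) (hv n)).trans
            (mul_le_mul_of_nonneg_left (hvK n) (Real.sqrt_nonneg _))
      _ = _ := by
          rw [← mul_assoc, ← Real.sqrt_mul (div_pos hLpos (hε n)).le,
            div_mul_cancel₀ _ (hε n).ne']
  exact (abs_integral_coord_mul_le (memLp_unfoldOp hL hGc hper (hε n) (hv n))
    (memLp_unfoldDefect hL hGc hper (hε n) hG hh) j).trans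
    (mul_le_mul_of_nonneg_right hunfold lpNorm_nonneg)

theorem tendsto_integral_diff_innerDomain (hL : ∀ i, 0 < L i) (hG : ∀ y, G y ≤ G₁)
    (hε : ∀ n, 0 < ε n) (hlim : Tendsto ε atTop (𝓝 0))
    (hv : ∀ n, IsL2 (thinDomain G (ε n)) (v n))
    (hvK : ∀ n, lpNorm (v n) 2 (volume.restrict (thinDomain G (ε n))) ≤ √(ε n) * K)
    (hh : IsL2 omega h) (j : Fin 3) :
    Tendsto (fun n => (ε n)⁻¹ *
      ∫ x in thinDomain G (ε n) \ innerDomain L G (ε n), v n x j * h (hat x)) atTop (𝓝 0) := by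
  have hvol : Tendsto (fun n => volume.restrict omega (omega \ openCells L (ε n))) atTop (𝓝 0) := by
    simpa only [Measure.restrict_eq_self _ Set.sdiff_subset, Function.comp_def] using
      (tendsto_volume_omega_diff_openCells hL).comp
        (tendsto_nhdsWithin_iff.2 ⟨hlim, .of_forall hε⟩)
  have hedge := (tendsto_lpNorm_restrict_of_tendsto_measure one_le_two (by norm_num) hh
    (fun n => isOpen_omega.measurableSet.diff isOpen_openCells.measurableSet) hvol).const_mul
    (K * √G₁)
  simp only [Measure.restrict_restrict_of_subset Set.sdiff_subset, mul_zero] at hedge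
  refine squeeze_zero_norm (fun n => ?_) hedge
  have hthin : volume.restrict (thinDomain G (ε n) \ innerDomain L G (ε n)) ≤
      volume.restrict (thinDomain G (ε n)) := Measure.restrict_mono_set _ Set.sdiff_subset
  have hcyl := thinDomain_diff_innerDomain_subset_cylinder (L := L) (hε n).le hG
  have hhr : MemLp h 2 (volume.restrict (omega \ openCells L (ε n))) :=
    hh.mono_measure (Measure.restrict_mono_set _ Set.sdiff_subset)
  have hpair := abs_integral_coord_mul_le ((hv n).mono_measure hthin) (memLp_comp_hat hcyl hhr) j
  have hvn := (lpNorm_mono_measure (hv n) hthin).trans (hvK n)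
  have hhn := lpNorm_comp_hat_le hcyl hhr
  rw [norm_mul, norm_inv, Real.norm_of_nonneg (hε n).le, inv_mul_le_iff₀ (hε n)]
  calc _ ≤ √(ε n) * K * (√(ε n * G₁) *
        lpNorm h 2 (volume.restrict (omega \ openCells L (ε n)))) :=
        hpair.trans (mul_le_mul hvn hhn lpNorm_nonneg (lpNorm_nonneg.trans hvn))
    _ = √(ε n) * √(ε n) * (K * √G₁ *
        lpNorm h 2 (volume.restrict (omega \ openCells L (ε n)))) := by
        rw [Real.sqrt_mul (hε n).le]
        ring
    _ = _ := by rw [Real.mul_self_sqrt (hε n).le]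

theorem tendsto_average (hL : ∀ i, 0 < L i) (hGc : Continuous G) (hper : YPeriodic L G)
    (hG : ∀ y, G y ≤ G₁) (hε : ∀ n, 0 < ε n) (hlim : Tendsto ε atTop (𝓝 0))
    (hv : ∀ n, IsL2 (thinDomain G (ε n)) (v n))
    (hvK : ∀ n, lpNorm (v n) 2 (volume.restrict (thinDomain G (ε n))) ≤ √(ε n) * K)
    {u : E 2 → E 3 → E 3}
    (hu : WeakTendstoL2 omega (cellYstar L G) (fun n => unfoldOp L (ε n) (v n)) u)
    (hh : IsL2 omega h) (j : Fin 3) :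
    Tendsto (fun n => (ε n)⁻¹ * ∫ x in thinDomain G (ε n), v n x j * h (hat x)) atTop
      (𝓝 ((L 0 * L 1)⁻¹ * ∫ p in omega ×ˢ cellYstar L G, u p.1 p.2 j * h p.1)) := by
  have hweak := hu.tendsto_integral_coord_mul
    (memLp_comp_fst (volume_cellYstar_ne_top (L := L) hG) hh) j
  have hinner := ((hweak.add (tendsto_integral_coord_mul_unfoldDefect hL hGc hper hG hε hlim hv
    hvK hh j)).const_mul (L 0 * L 1)⁻¹).add
    (tendsto_integral_diff_innerDomain hL hG hε hlim hv hvK hh j)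
  rw [add_zero, add_zero] at hinner
  refine hinner.congr fun n => ?_
  have hinnerMeas : MeasurableSet (innerDomain L G (ε n)) :=
    ((isOpen_thinDomain hGc (ε n)).inter (isOpen_openCells.preimage continuous_hat)).measurableSet
  rw [← inv_mul_integral_innerDomain hL hGc hper (hε n) hG (hv n) hh, ← mul_add,
    ← integral_inter_add_sdiff hinnerMeas (integrable_coord_mul (hv n)
      (memLp_comp_hat (thinDomain_subset_cylinder (hε n).le hG) hh) j),
    Set.inter_eq_right.2 innerDomain_subset]

end Average

/-! ### Properties of the limit -/

section Mean

variable {X Y F : Type*} [MeasurableSpace X] [MeasurableSpace Y] {ρ : Measure X} {τ : Measure Y}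
  [NormedAddCommGroup F] [NormedSpace ℝ F]

theorem enorm_integral_sq_le {f : Y → F} (hf : AEStronglyMeasurable f τ) :
    ‖∫ y, f y ∂τ‖ₑ ^ 2 ≤ τ Set.univ * eLpNorm f 2 τ ^ 2 := by
  have hle : ‖∫ y, f y ∂τ‖ₑ ≤ eLpNorm f 2 τ * τ Set.univ ^ (1 / 2 : ℝ) := by
    refine (enorm_integral_le_lintegral_enorm f).trans ?_
    rw [← eLpNorm_one_eq_lintegral_enorm]
    refine (eLpNorm_le_eLpNorm_mul_rpow_measure_univ one_le_two hf).trans_eq ?_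
    norm_num
  refine (pow_le_pow_left' hle 2).trans_eq ?_
  rw [mul_pow, ← ENNReal.rpow_natCast (_ ^ _), ← ENNReal.rpow_mul, mul_comm]
  norm_num

theorem memLp_integral_prod_right [IsFiniteMeasure τ] {f : X × Y → F}
    (hf : MemLp f 2 (ρ.prod τ)) : MemLp (fun x => ∫ y, f (x, y) ∂τ) 2 ρ := by
  refine ⟨hf.1.integral_prod_right', ?_⟩
  have hsq : eLpNorm (fun x => ∫ y, f (x, y) ∂τ) 2 ρ ^ 2 ≤
      τ Set.univ * eLpNorm f 2 (ρ.prod τ) ^ 2 := by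
    rw [eLpNorm_two_sq, ← lintegral_eLpNorm_slice_sq hf.1,
      ← lintegral_const_mul' _ _ (by finiteness)]
    refine lintegral_mono_ae ?_
    filter_upwards [hf.1.prodMk_left] with x hx using enorm_integral_sq_le hx
  have hfinite := hsq.trans_lt (show τ Set.univ * eLpNorm f 2 (ρ.prod τ) ^ 2 < ⊤ by
    finiteness [hf.2.ne])
  simpa using hfinite

variable {A : Set (E 2)} {Z : Set (E 3)} {u : E 2 → E 3 → E 3}

theorem IsL2Prod.isL2_integral (hu : IsL2Prod A Z u) (hZ : volume Z ≠ ⊤) (j : Fin 3) :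
    IsL2 A fun x => ∫ y in Z, u x y j := by
  have : IsFiniteMeasure ((volume : Measure (E 3)).restrict Z) := ⟨by simpa using hZ.lt_top⟩
  have huj := memLp_piLp_iff.1 hu j
  rw [restrict_prod_eq] at huj
  exact memLp_integral_prod_right huj

theorem IsL2Prod.integral_mul_comp_fst (hu : IsL2Prod A Z u) (hZ : volume Z ≠ ⊤) {h : E 2 → ℝ}
    (hh : IsL2 A h) (j : Fin 3) :
    ∫ p in A ×ˢ Z, u p.1 p.2 j * h p.1 = ∫ x in A, (∫ y in Z, u x y j) * h x := by
  have hint := integrable_coord_mul hu (memLp_comp_fst hZ hh) j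
  simp only [Function.uncurry] at hint
  rw [restrict_prod_eq] at hint ⊢
  rw [integral_prod _ hint]
  simp only [integral_mul_const]

theorem meanFlux_apply (Z : Set (E 3)) (u : E 2 → E 3 → E 3) (x : E 2) (i : Fin 2) :
    meanFlux Z u x i = ∫ y in Z, u x y i.castSucc := by
  fin_cases i <;> rfl

theorem IsL2Prod.isL2_meanFlux (hu : IsL2Prod A Z u) (hZ : volume Z ≠ ⊤) :
    IsL2 A (meanFlux Z u) := by
  refine memLp_piLp_iff.2 fun i => ?_
  simp only [meanFlux_apply]
  exact hu.isL2_integral hZ i.castSucc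

end Mean

section WeakLimit

variable {A : Set (E 2)} {Z : Set (E 3)} {un : ℕ → E 2 → E 3 → E 3}
  {Dun : ℕ → Fin 3 → E 2 → E 3 → E 3} {u : E 2 → E 3 → E 3} {Du : Fin 3 → E 2 → E 3 → E 3}

theorem WeakTendstoL2.weakTendstoL2H1 (hu : WeakTendstoL2 A Z un u)
    (hDu : ∀ i, WeakTendstoL2 A Z (fun n => Dun n i) (Du i))
    (hunH1 : ∀ n, IsL2H1 A Z (un n) (Dun n)) (huH1 : IsL2H1 A Z u Du) :
    WeakTendstoL2H1 A Z un Dun u Du :=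
  ⟨hunH1, huH1, fun w Dw hw => (hu.2.2 w hw.1).add
    (tendsto_finsetSum _ fun i _ => (hDu i).2.2 (Dw i) (hw.2.1 i))⟩

theorem ae_divg_eq_zero_of_weakTendstoL2
    (hDu : ∀ i, WeakTendstoL2 A Z (fun n => Dun n i) (Du i))
    (hdiv : ∀ n, ∀ᵐ p ∂((volume : Measure (E 2 × E 3)).restrict (A ×ˢ Z)),
      divg (fun i => Dun n i p.1) p.2 = 0) :
    ∀ᵐ p ∂((volume : Measure (E 2 × E 3)).restrict (A ×ˢ Z)),
      divg (fun i => Du i p.1) p.2 = 0 := by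
  set D : E 2 × E 3 → ℝ := fun p => divg (fun i => Du i p.1) p.2
  have hD : MemLp D 2 (volume.restrict (A ×ˢ Z)) :=
    memLp_finsetSum _ fun i _ => memLp_piLp_iff.1 (hDu i).2.1 i
  have hsum : ∀ {Dw : Fin 3 → E 2 → E 3 → E 3}, (∀ i, IsL2Prod A Z (Dw i)) →
      ∑ i, ∫ p in A ×ˢ Z, Dw i p.1 p.2 i * D p =
        ∫ p in A ×ˢ Z, divg (fun i => Dw i p.1) p.2 * D p := fun {Dw} hDw => by
    have hint : ∀ i, Integrable (fun p => Dw i p.1 p.2 i * D p) (volume.restrict (A ×ˢ Z)) :=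
      fun i => integrable_coord_mul (hDw i) hD i
    rw [← integral_finsetSum _ fun i _ => hint i]
    simp only [divg, Finset.sum_mul]
  have hlim := tendsto_finsetSum Finset.univ fun i _ => (hDu i).tendsto_integral_coord_mul hD i
  simp only [hsum fun i => (hDu i).1 _, hsum fun i => (hDu i).2.1] at hlim
  have hzero : ∀ n, ∫ p in A ×ˢ Z, divg (fun i => Dun n i p.1) p.2 * D p = 0 := fun n => by
    refine integral_eq_zero_of_ae ?_
    filter_upwards [hdiv n] with p hp
    rw [hp, zero_mul, Pi.zero_apply]
  simp only [hzero] at hlim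
  have hsq : ∫ p in A ×ˢ Z, D p ^ 2 = 0 := by
    simpa only [sq] using tendsto_nhds_unique hlim tendsto_const_nhds
  rw [integral_eq_zero_iff_of_nonneg (fun p => sq_nonneg _) hD.integrable_sq] at hsq
  filter_upwards [hsq] with p hp using pow_eq_zero_iff two_ne_zero |>.1 hp

end WeakLimit

section UnfoldedFields

variable {L : Fin 2 → ℝ} {G : E 2 → ℝ} {G₁ K ε : ℝ} {v : E 3 → E 3} {Dv : Fin 3 → E 3 → E 3}

theorem IsH10.isL2H1_unfoldOp (hL : ∀ i, 0 < L i) (hGc : Continuous G) (hper : YPeriodic L G)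
    (hε : 0 < ε) (hv : IsH10 (thinDomain G ε) v Dv) :
    IsL2H1 omega (cellYstar L G) (unfoldOp L ε v) (fun i => ε • unfoldOp L ε (Dv i)) := by
  refine ⟨memLp_unfoldOp hL hGc hper hε hv.1.1,
    fun i => (memLp_unfoldOp hL hGc hper hε (hv.1.2.1 i)).const_smul ε, ?_⟩
  filter_upwards [ae_hasTrace_of_mem_closure (measurableSet_bottom_union_top hGc) _
    (hv.toLp_unfoldOp_jet_mem hL hGc hper hε)] with x hx
  simp only [Function.uncurry_apply_pair, unfoldOp_jet] at hx
  exact hx.1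

theorem IsAdmissible.ae_divg_unfoldOp_eq_zero (hL : ∀ i, 0 < L i) (hGc : Continuous G)
    (hper : YPeriodic L G) (hε : 0 < ε) (hv : IsAdmissible G ε v Dv) :
    ∀ᵐ p ∂((volume : Measure (E 2 × E 3)).restrict (omega ×ˢ cellYstar L G)),
      divg (fun i => (ε • unfoldOp L ε (Dv i)) p.1) p.2 = 0 := by
  have hunfold : ∀ x y, divg (fun i => (ε • unfoldOp L ε (Dv i)) x) y =
      ε * unfoldOp L ε (divg Dv) x y := fun x y => by
    by_cases hx : x ∈ omegaEps L ε
    · simp [divg, Finset.mul_sum, unfoldOp_of_mem _ hx]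
    · simp [divg, unfoldOp_of_notMem _ hx]
  filter_upwards [ae_unfoldOp_of_ae hL hGc hper hε (P := fun c : ℝ => c = 0) rfl hv.2] with p hp
  rw [hunfold, hp, mul_zero]

theorem IsAdmissible.lpNorm_le_sqrt_mul (hε : 0 ≤ ε) (hG₁ : 0 ≤ G₁) (hG : ∀ y, G y ≤ G₁)
    (hv : IsAdmissible G ε v Dv)
    (hK : √ε * lpNorm (Dv 2) 2 (volume.restrict (thinDomain G ε)) ≤ K) :
    lpNorm v 2 (volume.restrict (thinDomain G ε)) ≤ √ε * (2 * G₁ * K) := by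
  calc _ ≤ 2 * (ε * G₁) * lpNorm (Dv 2) 2 (volume.restrict (thinDomain G ε)) :=
        hv.lpNorm_le hε hG₁ hG
    _ = √ε * (2 * G₁ * (√ε * lpNorm (Dv 2) 2 (volume.restrict (thinDomain G ε)))) := by
        nth_rw 1 [← Real.mul_self_sqrt hε]
        ring
    _ ≤ √ε * (2 * G₁ * K) := by gcongr

end UnfoldedFields

section Flux

variable {L : Fin 2 → ℝ} {G : E 2 → ℝ} {G₁ K : ℝ} {ε : ℕ → ℝ} {v : ℕ → E 3 → E 3}
  {Dv : ℕ → Fin 3 → E 3 → E 3} {u : E 2 → E 3 → E 3}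

theorem integral_meanFlux_eq_zero (hL : ∀ i, 0 < L i) (hGc : Continuous G) (hper : YPeriodic L G)
    (hG : ∀ y, G y ≤ G₁) (hε : ∀ n, 0 < ε n) (hlim : Tendsto ε atTop (𝓝 0))
    (hv : ∀ n, IsAdmissible G (ε n) (v n) (Dv n))
    (hvK : ∀ n, lpNorm (v n) 2 (volume.restrict (thinDomain G (ε n))) ≤ √(ε n) * K)
    (hu : WeakTendstoL2 omega (cellYstar L G) (fun n => unfoldOp L (ε n) (v n)) u)
    {q : E 2 → ℝ} {Dq : Fin 2 → E 2 → ℝ} (hq : IsH1 omega q Dq) :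
    ∫ x in omega, ∑ i, meanFlux (cellYstar L G) u x i * Dq i x = 0 := by
  have hZ := volume_cellYstar_ne_top (L := L) hG
  have haverage := tendsto_finsetSum Finset.univ fun (i : Fin 2) _ =>
    tendsto_average hL hGc hper hG hε hlim (fun n => (hv n).1.1.1) hvK hu (hq.2.1 i) i.castSucc
  simp only [← Finset.mul_sum, (hv _).integral_horizontal_eq_zero (hε _).le hG hq, mul_zero]
    at haverage
  have hzero := (mul_eq_zero.1 (tendsto_nhds_unique haverage tendsto_const_nhds)).resolve_left
    (inv_ne_zero (mul_pos (hL 0) (hL 1)).ne')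
  rw [integral_finsetSum _ fun i _ =>
    integrable_coord_mul (hu.2.1.isL2_meanFlux hZ) (hq.2.1 i) i, ← hzero]
  simp only [meanFlux_apply, hu.2.1.integral_mul_comp_fst hZ (hq.2.1 _)]

theorem tendsto_inv_mul_integral_vertical (hGc : Continuous G) (hG₁ : 0 ≤ G₁)
    (hG : ∀ y, G y ≤ G₁) (hε : ∀ n, 0 < ε n) (hlim : Tendsto ε atTop (𝓝 0))
    (hv : ∀ n, IsAdmissible G (ε n) (v n) (Dv n))
    (hvK : ∀ n, lpNorm (v n) 2 (volume.restrict (thinDomain G (ε n))) ≤ √(ε n) * K)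
    {q : E 2 → ℝ} {Dq : Fin 2 → E 2 → ℝ} (hq : IsH1 omega q Dq) :
    Tendsto (fun n => (ε n)⁻¹ * ∫ x in thinDomain G (ε n), v n x 2 * q (hat x)) atTop (𝓝 0) := by
  have hbound := hlim.mul_const (∑ i, K * G₁ * √G₁ * lpNorm (Dq i) 2 (volume.restrict omega))
  rw [zero_mul] at hbound
  refine squeeze_zero_norm (fun n => ?_) hbound
  have hεn := (hε n).le
  rw [norm_mul, norm_inv, Real.norm_of_nonneg hεn, inv_mul_le_iff₀ (hε n), Finset.mul_sum,
    Finset.mul_sum]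
  refine ((hv n).abs_integral_vertical_le hGc hεn hG₁ hG hq).trans
    (Finset.sum_le_sum fun i _ => ?_)
  set N := lpNorm (Dq i) 2 (volume.restrict omega)
  have hN : 0 ≤ N := lpNorm_nonneg
  calc _ ≤ √(ε n) * K * (ε n * G₁ * (√(ε n * G₁) * N)) := by
        gcongr
        exact hvK n
    _ = √(ε n) * √(ε n) * (ε n * (K * G₁ * √G₁ * N)) := by
        rw [Real.sqrt_mul hεn]
        ring
    _ = _ := by rw [Real.mul_self_sqrt hεn]

theorem ae_integral_vertical_eq_zero (hL : ∀ i, 0 < L i) (hGc : Continuous G)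
    (hper : YPeriodic L G) (hG₁ : 0 ≤ G₁) (hG : ∀ y, G y ≤ G₁) (hε : ∀ n, 0 < ε n)
    (hlim : Tendsto ε atTop (𝓝 0)) (hv : ∀ n, IsAdmissible G (ε n) (v n) (Dv n))
    (hvK : ∀ n, lpNorm (v n) 2 (volume.restrict (thinDomain G (ε n))) ≤ √(ε n) * K)
    (hu : WeakTendstoL2 omega (cellYstar L G) (fun n => unfoldOp L (ε n) (v n)) u) :
    ∀ᵐ x ∂((volume : Measure (E 2)).restrict omega), ∫ y in cellYstar L G, u x y 2 = 0 := by
  have hZ := volume_cellYstar_ne_top (L := L) hG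
  have hweak : ∀ q : E 2 → ℝ, IsTest omega q →
      ∫ x in omega, (∫ y in cellYstar L G, u x y 2) * q x = 0 := fun q hq => by
    have haverage := tendsto_average hL hGc hper hG hε hlim (fun n => (hv n).1.1.1) hvK hu
      (hq.memLp _ 2) 2
    rw [← hu.2.1.integral_mul_comp_fst hZ (hq.memLp _ 2)]
    exact (mul_eq_zero.1 (tendsto_nhds_unique haverage
      (tendsto_inv_mul_integral_vertical hGc hG₁ hG hε hlim hv hvK hq.isH1))).resolve_left
      (inv_ne_zero (mul_pos (hL 0) (hL 1)).ne')
  have : IsFiniteMeasure ((volume : Measure (E 2)).restrict omega) := ⟨by simp [volume_omega]⟩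
  have hmean : IntegrableOn (fun x => ∫ y in cellYstar L G, u x y 2) omega :=
    MemLp.integrable one_le_two (hu.2.1.isL2_integral hZ 2)
  rw [ae_restrict_iff' isOpen_omega.measurableSet]
  refine isOpen_omega.ae_eq_zero_of_integral_contDiff_smul_eq_zero hmean.locallyIntegrableOn ?_
  intro q hq hqc hqs
  have hqt : IsTest omega q := ⟨hq, hqc, hqs⟩
  rw [← hweak q hqt, setIntegral_eq_integral_of_forall_compl_eq_zero
    (fun x hx => by rw [hqt.eq_zero hx, mul_zero])]
  simp only [smul_eq_mul, mul_comm]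

end Flux

/-- The pair `(u, Du)` is a limit of the fields `v n`, with gradients `Dv n`, in the thin domains
`Ω_{ε n}`: the unfolded fields and scaled gradients converge weakly to `u` and `Du`, and `u` has
the properties that incompressibility and the boundary condition leave in the limit. The unfolded
gradients occurring in the weak convergence in `L²(ω; H¹(Y*)³)` are quantified existentially, as
they are determined by the unfolded fields. -/
def IsUnfoldingLimit (L : Fin 2 → ℝ) (G : E 2 → ℝ) (ε : ℕ → ℝ) (v : ℕ → E 3 → E 3)
    (Dv : ℕ → Fin 3 → E 3 → E 3) (u : E 2 → E 3 → E 3) (Du : Fin 3 → E 2 → E 3 → E 3) : Prop :=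
  IsL2H1 omega (cellYstar L G) u Du ∧
  (∃ DT : ℕ → Fin 3 → E 2 → E 3 → E 3,
    WeakTendstoL2H1 omega (cellYstar L G) (fun n => unfoldOp L (ε n) (v n)) DT u Du) ∧
  (∀ i, WeakTendstoL2 omega (cellYstar L G)
    (fun n x y => ε n • unfoldOp L (ε n) (Dv n i) x y) (Du i)) ∧
  (∀ᵐ p ∂((volume : Measure (E 2 × E 3)).restrict (omega ×ˢ cellYstar L G)),
    divg (fun i => Du i p.1) p.2 = 0) ∧
  (∀ᵐ x ∂((volume : Measure (E 2)).restrict omega),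
    HasTrace (cellYstar L G) (bottomYstar L ∪ topYstar L G) (u x) (fun i => Du i x)
      (fun _ => 0)) ∧
  (∀ᵐ x ∂((volume : Measure (E 2)).restrict omega), ∫ y in cellYstar L G, u x y 2 = 0) ∧
  HasWeakDiv omega (meanFlux (cellYstar L G) u) (fun _ => 0) ∧
  HasZeroNormalTrace omega (meanFlux (cellYstar L G) u) (fun _ => 0)

section Compactness

variable {L : Fin 2 → ℝ} {G : E 2 → ℝ} {G₁ K : ℝ} {ε : ℕ → ℝ} {v : ℕ → E 3 → E 3}
  {Dv : ℕ → Fin 3 → E 3 → E 3}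

theorem exists_subseq_weakTendsto_unfoldOp (hL : ∀ i, 0 < L i) (hGc : Continuous G)
    (hper : YPeriodic L G) (hG₁ : 0 ≤ G₁) (hG : ∀ y, G y ≤ G₁) (hε : ∀ n, 0 < ε n)
    (hv : ∀ n, IsAdmissible G (ε n) (v n) (Dv n))
    (hK : ∀ n i, √(ε n) * lpNorm (Dv n i) 2 (volume.restrict (thinDomain G (ε n))) ≤ K) :
    ∃ σ : ℕ → ℕ, StrictMono σ ∧ ∃ (u : E 2 → E 3 → E 3) (Du : Fin 3 → E 2 → E 3 → E 3),
      (∀ᵐ x ∂((volume : Measure (E 2)).restrict omega),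
        HasTrace (cellYstar L G) (bottomYstar L ∪ topYstar L G) (u x) (fun i => Du i x)
          (fun _ => 0)) ∧
      WeakTendstoL2 omega (cellYstar L G) (fun n => unfoldOp L (ε (σ n)) (v (σ n))) u ∧
      ∀ i, WeakTendstoL2 omega (cellYstar L G)
        (fun n => ε (σ n) • unfoldOp L (ε (σ n)) (Dv (σ n) i)) (Du i) := by
  obtain ⟨σ, hσ, u, Du, htrace, hu, hDu⟩ := exists_subseq_weakTendstoL2
    (measurableSet_bottom_union_top hGc) _
    (fun n => (hv n).1.toLp_unfoldOp_jet_mem hL hGc hper (hε n))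
    fun n => (hv n).lpNorm_unfoldOp_jet_le hL hGc hper (hε n) hG₁ hG (hK n)
  simp only [Function.uncurry_apply_pair, unfoldOp_jet] at hu hDu
  exact ⟨σ, hσ, u, Du, htrace, hu, hDu⟩

theorem isUnfoldingLimit_of_weakTendstoL2 {u : E 2 → E 3 → E 3} {Du : Fin 3 → E 2 → E 3 → E 3}
    (hL : ∀ i, 0 < L i) (hGc : Continuous G) (hper : YPeriodic L G) (hG₁ : 0 ≤ G₁)
    (hG : ∀ y, G y ≤ G₁) (hε : ∀ n, 0 < ε n) (hlim : Tendsto ε atTop (𝓝 0))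
    (hv : ∀ n, IsAdmissible G (ε n) (v n) (Dv n))
    (hvK : ∀ n, lpNorm (v n) 2 (volume.restrict (thinDomain G (ε n))) ≤ √(ε n) * K)
    (htrace : ∀ᵐ x ∂((volume : Measure (E 2)).restrict omega),
      HasTrace (cellYstar L G) (bottomYstar L ∪ topYstar L G) (u x) (fun i => Du i x)
        (fun _ => 0))
    (hu : WeakTendstoL2 omega (cellYstar L G) (fun n => unfoldOp L (ε n) (v n)) u)
    (hDu : ∀ i, WeakTendstoL2 omega (cellYstar L G)
      (fun n => ε n • unfoldOp L (ε n) (Dv n i)) (Du i)) :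
    IsUnfoldingLimit L G ε v Dv u Du := by
  have huH1 : IsL2H1 omega (cellYstar L G) u Du :=
    ⟨hu.2.1, fun i => (hDu i).2.1, htrace.mono fun _ hx => hx.1⟩
  have hflux : ∀ {q : E 2 → ℝ} {Dq : Fin 2 → E 2 → ℝ}, IsH1 omega q Dq →
      ∫ x in omega, ∑ i, meanFlux (cellYstar L G) u x i * Dq i x = 0 :=
    integral_meanFlux_eq_zero hL hGc hper hG hε hlim hv hvK hu
  have hdiv : HasWeakDiv omega (meanFlux (cellYstar L G) u) (fun _ => 0) := fun φ hφ => by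
    simpa using hflux hφ.isH1
  exact ⟨huH1,
    ⟨_, hu.weakTendstoL2H1 hDu (fun n => (hv n).1.isL2H1_unfoldOp hL hGc hper (hε n)) huH1⟩, hDu,
    ae_divg_eq_zero_of_weakTendstoL2 hDu
      fun n => (hv n).ae_divg_unfoldOp_eq_zero hL hGc hper (hε n),
    htrace, ae_integral_vertical_eq_zero hL hGc hper hG₁ hG hε hlim hv hvK hu, hdiv,
    hu.2.1.isL2_meanFlux (volume_cellYstar_ne_top hG), MemLp.zero, hdiv,
    fun q Dq hq => by simpa using hflux hq⟩

theorem exists_subseq_isUnfoldingLimit (hL : ∀ i, 0 < L i) (hGc : Continuous G)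
    (hper : YPeriodic L G) (hG₁ : 0 ≤ G₁) (hG : ∀ y, G y ≤ G₁) (hε : ∀ n, 0 < ε n)
    (hlim : Tendsto ε atTop (𝓝 0)) (hv : ∀ n, IsAdmissible G (ε n) (v n) (Dv n))
    (hK : ∀ n i, √(ε n) * lpNorm (Dv n i) 2 (volume.restrict (thinDomain G (ε n))) ≤ K) :
    ∃ σ : ℕ → ℕ, StrictMono σ ∧ ∃ (u : E 2 → E 3 → E 3) (Du : Fin 3 → E 2 → E 3 → E 3),
      IsUnfoldingLimit L G (ε ∘ σ) (v ∘ σ) (Dv ∘ σ) u Du := by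
  obtain ⟨σ, hσ, u, Du, htrace, hu, hDu⟩ :=
    exists_subseq_weakTendsto_unfoldOp hL hGc hper hG₁ hG hε hv hK
  exact ⟨σ, hσ, u, Du, isUnfoldingLimit_of_weakTendstoL2 hL hGc hper hG₁ hG (fun n => hε (σ n))
    (hlim.comp hσ.tendsto_atTop) (fun n => hv (σ n))
    (fun n => (hv (σ n)).lpNorm_le_sqrt_mul (hε (σ n)).le hG₁ hG (hK (σ n) 2)) htrace hu hDu⟩

end Compactness

theorem IsBinghamSolution.sqrt_mul_lpNorm_le {G : E 2 → ℝ} {G₁ μ g ε C : ℝ} {f u : E 3 → E 3}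
    {Du : Fin 3 → E 3 → E 3} (hG₁ : 0 ≤ G₁) (hG : ∀ y, G y ≤ G₁) (hμ : 0 < μ) (hg : 0 ≤ g)
    (hε : 0 < ε) (hf : IsL2 (thinDomain G ε) f) (hfC : rescaledL2Norm G ε f ≤ C)
    (hu : IsBinghamSolution G μ g ε f u Du) (i : Fin 3) :
    √ε * lpNorm (Du i) 2 (volume.restrict (thinDomain G ε)) ≤ |2 * G₁ * C / μ| := by
  have henergy := hu.sum_lpNorm_sq_le hG₁ hG hμ hg hε hf hfC
  have hi := Finset.single_le_sum
    (f := fun i => lpNorm (Du i) 2 (volume.restrict (thinDomain G ε)) ^ 2)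
    (fun _ _ => sq_nonneg _) (Finset.mem_univ i)
  refine (le_abs_self _).trans (sq_le_sq.1 ?_)
  rw [mul_pow, Real.sq_sqrt hε.le]
  refine le_of_mul_le_mul_left ?_ hε
  calc _ = ε ^ 2 * lpNorm (Du i) 2 (volume.restrict (thinDomain G ε)) ^ 2 := by ring
    _ ≤ _ := by gcongr
    _ ≤ _ := henergy
    _ = _ := mul_comm _ _

end ThinBingham

theorem proposition5p2_general {L : Fin 2 → ℝ} (hL : ∀ i, 0 < L i) {G : E 2 → ℝ}
    (hGc : Continuous G) (hper : YPeriodic L G) {G₁ : ℝ} (hG : ∀ y, G y ≤ G₁) {μ g : ℝ}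
    (hμ : 0 < μ) (hg : 0 ≤ g) {ε : ℕ → ℝ} (hε : ∀ n, 0 < ε n) (hlim : Tendsto ε atTop (𝓝 0))
    {f : ℕ → E 3 → E 3} (hf : ∀ n, IsL2 (thinDomain G (ε n)) (f n)) {C : ℝ}
    (hfC : ∀ n, rescaledL2Norm G (ε n) (f n) ≤ C) {u : ℕ → E 3 → E 3}
    {Du : ℕ → Fin 3 → E 3 → E 3}
    (hu : ∀ n, IsBinghamSolution G μ g (ε n) (f n) (u n) (Du n)) :
    ∃ σ : ℕ → ℕ, StrictMono σ ∧ ∃ (w : E 2 → E 3 → E 3) (Dw : Fin 3 → E 2 → E 3 → E 3),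
      IsUnfoldingLimit L G (ε ∘ σ) (u ∘ σ) (Du ∘ σ) w Dw := by
  have hG' : ∀ y, G y ≤ max G₁ 0 := fun y => le_max_of_le_left (hG y)
  exact exists_subseq_isUnfoldingLimit hL hGc hper (le_max_right G₁ 0) hG' hε hlim
    (fun n => (hu n).1) fun n =>
      (hu n).sqrt_mul_lpNorm_le (le_max_right G₁ 0) hG' hμ hg (hε n) (hf n) (hfC n)

theorem proposition5p2
    (L : Fin 2 → ℝ) (hL : ∀ i, 0 < L i)
    (G : E 2 → ℝ) (hGsmooth : ContDiff ℝ ∞ G) (hGper : YPeriodic L G)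
    (G₀ G₁ : ℝ) (hG₀ : 0 < G₀) (hG : ∀ y, G₀ ≤ G y ∧ G y ≤ G₁)
    (μ g : ℝ) (hμ : 0 < μ) (hg : 0 < g)
    (ε : ℕ → ℝ) (hεpos : ∀ n, 0 < ε n) (hεlim : Tendsto ε atTop (𝓝 0))
    (f : ℕ → E 3 → E 3) (hf : ∀ n, IsL2 (thinDomain G (ε n)) (f n))
    (C : ℝ) (hfC : ∀ n, rescaledL2Norm G (ε n) (f n) ≤ C)
    (uε : ℕ → E 3 → E 3) (Duε : ℕ → Fin 3 → E 3 → E 3)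
    (hu : ∀ n, IsBinghamSolution G μ g (ε n) (f n) (uε n) (Duε n)) :
    ∃ σ : ℕ → ℕ, StrictMono σ ∧
      ∃ (u : E 2 → E 3 → E 3) (Du : Fin 3 → E 2 → E 3 → E 3),
        IsL2H1 omega (cellYstar L G) u Du ∧
        (∃ DT : ℕ → Fin 3 → E 2 → E 3 → E 3,
          WeakTendstoL2H1 omega (cellYstar L G)
            (fun n => unfoldOp L (ε (σ n)) (uε (σ n))) DT u Du) ∧
        (∀ i, WeakTendstoL2 omega (cellYstar L G)
          (fun n x y => ε (σ n) • unfoldOp L (ε (σ n)) (Duε (σ n) i) x y) (Du i)) ∧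
        (∀ᵐ p ∂((volume : Measure (E 2 × E 3)).restrict (omega ×ˢ cellYstar L G)),
          divg (fun i => Du i p.1) p.2 = 0) ∧
        (∀ᵐ x ∂((volume : Measure (E 2)).restrict omega),
          HasTrace (cellYstar L G) (bottomYstar L ∪ topYstar L G) (u x) (fun i => Du i x)
            (fun _ => 0)) ∧
        (∀ᵐ x ∂((volume : Measure (E 2)).restrict omega),
          ∫ y in cellYstar L G, u x y 2 = 0) ∧
        HasWeakDiv omega (meanFlux (cellYstar L G) u) (fun _ => 0) ∧
        HasZeroNormalTrace omega (meanFlux (cellYstar L G) u) (fun _ => 0) :=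
  proposition5p2_general hL hGsmooth.continuous hGper (fun y => (hG y).2) hμ hg.le hεpos hεlim hf
    hfC hu
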